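/- Let $\mathcal D$ be an abelian braided monoidal category with braiding $c$, in which countable direct sums exist and are preserved by $\otimes$ in each variable. Let $F^+,F^-\in\mathcal D$ and let $b:F^+\otimes F^-\to\mathbb 1$ be a morphism. **Perturbing objects.** Let $F=\iota^+(F^+)\oplus\iota^-(F^-)$ in the monoidal centre $\mathcal Z(\mathcal D)$, where $\iota^+(V)=(V,c_{V,-})$ and $\iota^-(V)=(V,(c_{-,V})^{-1})$. Write $\varphi_{F,X}:F\otimes X\to X\otimes F$ for the half-braiding of $F$, and similarly for other objects of $\mathcal Z(\mathcal D)$. The category $\mathcal D_F$ has as objects the pairs $(X,m)$ with $X\in\mathcal D$ and $m:F\otimes X\to X$ any morphism; its morphisms $(X,m)\to(Y,n)$ are the $f:X\to Y$ with $n\circ(\mathrm{id}_F\otimes f)=f\circ m$. It is monoidal with unit $(\mathbb 1,0)$ and $$(X,m)\otimes(Y,n)=\big(X\otimes Y,\; m\otimes\mathrm{id}_Y+(\mathrm{id}_X\otimes n)\circ(\varphi_{F,X}\otimes\mathrm{id}_Y)\big),$$ with the associators and unit isomorphisms of $\mathcal D$. For $(X,m)\in\mathcal D_F$ let $m^\pm:F^\pm\otimes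 X\to X$ be the restrictions of $m$. The object $(X,m)$ satisfies the *commutation condition with $b$* if, as morphisms $F^+\otimes F^-\otimes X\to X$, $$m^+\circ(\mathrm{id}\otimes m^-)-m^-\circ(\mathrm{id}\otimes m^+)\circ(c_{F^+,F^-}\otimes\mathrm{id}_X)=b\otimes\mathrm{id}_X-(\mathrm{id}_X\otimes b)\circ\varphi_{\iota^+(F^+)\otimes\iota^-(F^-),X}.$$ The full subcategory $\mathcal D'_F\subset\mathcal D_F$ of these objects contains the unit and is closed under $\otimes$. **Tensor algebras.** For $V\in\mathcal D$ let $T(V)=\bigoplus_{n\ge0}V^{\otimes n}$ with its concatenation product, and let $\iota_V:V\to T(V)$ be the inclusion. It is a Hopf algebra in $\mathcal D$, with the coproduct and counit that are the algebra morphisms determined by $\Delta\circ\iota_V=\iota_V\otimes\eta+\eta\otimes\iota_V$ and $\varepsilon\circ\iota_V=0$; here $A\otimes A$ has the product $(\mu\otimes\mu)\circ(\mathrm{id}\otimes c_{A,A}\otimes\mathrm{id})$. **Hopf pairings and Yetter–Drinfeld modules.** A *Hopf pairing* of Hopf algebras $H_1,H_2$ in $\mathcal D$ is a morphism $\rho:H_1\otimes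 H_2\to\mathbb 1$ with $$\rho(\mu\otimes\mathrm{id})=\rho(\mathrm{id}\otimes\rho\otimes\mathrm{id})(\mathrm{id}\otimes\mathrm{id}\otimes\Delta),\qquad \rho(\mathrm{id}\otimes\mu)=\rho(\mathrm{id}\otimes\rho\otimes\mathrm{id})(\Delta\otimes\mathrm{id}\otimes\mathrm{id}),$$ $$\rho(\eta\otimes\mathrm{id})=\varepsilon,\qquad \rho(\mathrm{id}\otimes\eta)=\varepsilon.$$ A *Yetter–Drinfeld module* for $(H_1,H_2,\rho)$ is an object $X$ with a left $H_1$-action $m_1:H_1\otimes X\to X$ and a right $H_2$-action $m_2:X\otimes H_2\to X$ such that, as morphisms $H_1\otimes X\otimes H_2\to X$, $$(\mathrm{id}_X\otimes\rho)\circ(L\otimes\mathrm{id}_{H_2})\circ(\mathrm{id}_{H_1}\otimes P)=(\rho\otimes\mathrm{id}_X)\circ(\mathrm{id}_{H_1}\otimes R)\circ(Q\otimes\mathrm{id}_{H_2}),$$ where $$L=(m_1\otimes\mathrm{id})(\mathrm{id}\otimes c_{H_1,X})(\Delta\otimes\mathrm{id}_X):H_1\otimes X\to X\otimes H_1,\qquad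 P=(m_2\otimes\mathrm{id})(\mathrm{id}_X\otimes\Delta):X\otimes H_2\to X\otimes H_2,$$ $$R=(\mathrm{id}\otimes m_2)(c_{X,H_2}\otimes\mathrm{id})(\mathrm{id}_X\otimes\Delta):X\otimes H_2\to H_2\otimes X,\qquad Q=(\mathrm{id}\otimes m_1)(\Delta\otimes\mathrm{id}_X):H_1\otimes X\to H_1\otimes X.$$ Morphisms are the morphisms of $\mathcal D$ compatible with both actions. Yetter–Drinfeld modules form a monoidal category ${}_{H_1}\mathcal{YD}_{\rho\,H_2}$, with unit $\mathbb 1$ (on which $H_1,H_2$ act by their counits), the associators and unit isomorphisms of $\mathcal D$, and the actions on $X\otimes Y$ $$(m_1^X\otimes m_1^Y)(\mathrm{id}\otimes c_{H_1,X}\otimes\mathrm{id})(\Delta\otimes\mathrm{id}_X\otimes\mathrm{id}_Y),\qquad (m_2^X\otimes m_2^Y)(\mathrm{id}\otimes c_{Y,H_2}\otimes\mathrm{id})(\mathrm{id}_X\otimes\mathrm{id}_Y\otimes\Delta).$$ **Theorem.** There is a unique Hopf pairing $\rho:T(F^+)\otimes T(F^-)\to\mathbb 1$ with $\rho\circ(\iota_{F^+}\otimes\iota_{F^-})=b$,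 and it is degree preserving, that is, it vanishes on $(F^+)^{\otimes n}\otimes(F^-)^{\otimes m}$ for $n\ne m$. For this $\rho$, the categories ${}_{T(F^+)}\mathcal{YD}_{\rho\,T(F^-)}$ and $\mathcal D'_F$ are isomorphic as monoidal categories. More precisely, the assignment $$(X,m_+,m_-)\mapsto(X,m),\qquad m^+=m_+\circ(\iota_{F^+}\otimes\mathrm{id}_X),\qquad m^-=m_-\circ(\mathrm{id}_X\otimes\iota_{F^-})\circ c_{X,F^-}^{-1},$$ which is the identity on morphisms, takes values in $\mathcal D'_F$ and is a monoidal functor (with identity structure morphisms) that has a two-sided inverse monoidal functor. -/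

import Mathlib

set_option linter.unusedSectionVars false

open CategoryTheory MonoidalCategory Limits

universe v u

namespace TensorYD

/-! ### The monoidal centre: direct sums, and the two lifts of an object of a braided category -/

section Centre

variable {D : Type u} [Category.{v} D] [MonoidalCategory D]

theorem halfBraiding_unit (V : Center D) :
    (V.2.β (𝟙_ D)).hom = (ρ_ V.1).hom ≫ (λ_ V.1).inv := by
  obtain ⟨g, hg⟩ : ∃ g : V.1 ⟶ V.1, g = (ρ_ V.1).inv ≫ (V.2.β (𝟙_ D)).hom ≫ (λ_ V.1).hom :=
    ⟨_, rfl⟩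
  have h1 : (V.2.β (𝟙_ D)).hom = (ρ_ V.1).hom ≫ g ≫ (λ_ V.1).inv := by simp [hg]
  have hiso : IsIso g := by rw [hg]; infer_instance
  have h2 := V.2.naturality (λ_ (𝟙_ D)).hom
  rw [V.2.monoidal, h1] at h2
  have h3 : g ≫ g = g := by
    have e1 : g ≫ g = (ρ_ V.1).inv ≫ (V.1 ◁ (λ_ (𝟙_ D)).inv) ≫ ((α_ V.1 (𝟙_ D) (𝟙_ D)).inv ≫
      ((ρ_ V.1).hom ≫ g ≫ (λ_ V.1).inv) ▷ 𝟙_ D ≫ (α_ (𝟙_ D) V.1 (𝟙_ D)).hom ≫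
      𝟙_ D ◁ ((ρ_ V.1).hom ≫ g ≫ (λ_ V.1).inv) ≫ (α_ (𝟙_ D) (𝟙_ D) V.1).inv) ≫
      (λ_ (𝟙_ D)).hom ▷ V.1 ≫ (λ_ V.1).hom := by
      calc _ = 𝟙 _ ⊗≫ g ⊗≫ g ⊗≫ 𝟙 _ := by monoidal
        _ = _ := by monoidal
    rw [e1]
    simp only [Category.assoc] at h2 ⊢
    rw [← reassoc_of% h2]
    monoidal
  have h4 : g = 𝟙 _ := by rw [← cancel_epi g, h3, Category.comp_id]
  rw [h1, h4, Category.id_comp]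

/-- The direct sum of two objects of the monoidal centre: the direct sum of the underlying objects
with the half-braiding that is the direct sum of the two half-braidings. -/
noncomputable def centreSum [Preadditive D] [MonoidalPreadditive D] [HasBinaryBiproducts D]
    (A B : Center D) : Center D :=
  ⟨A.1 ⊞ B.1,
    { β := fun U =>
        { hom := biprod.fst ▷ U ≫ (A.2.β U).hom ≫ U ◁ biprod.inl +
            biprod.snd ▷ U ≫ (B.2.β U).hom ≫ U ◁ biprod.inr
          inv := U ◁ biprod.fst ≫ (A.2.β U).inv ≫ biprod.inl ▷ U +
            U ◁ biprod.snd ≫ (B.2.β U).inv ≫ biprod.inr ▷ U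
          hom_inv_id := by
            simp only [Preadditive.comp_add, Preadditive.add_comp, Category.assoc,
              ← MonoidalCategory.whiskerLeft_comp_assoc, biprod.inl_fst, biprod.inl_snd,
              biprod.inr_fst, biprod.inr_snd, MonoidalPreadditive.whiskerLeft_zero,
              MonoidalCategory.whiskerLeft_id, Category.id_comp, zero_comp, comp_zero,
              Iso.hom_inv_id_assoc, add_zero, zero_add, ← comp_whiskerRight,
              ← MonoidalPreadditive.add_whiskerRight, biprod.total, id_whiskerRight]
          inv_hom_id := by
            simp only [Preadditive.comp_add, Preadditive.add_comp, Category.assoc,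
              ← comp_whiskerRight_assoc, biprod.inl_fst, biprod.inl_snd,
              biprod.inr_fst, biprod.inr_snd, MonoidalPreadditive.zero_whiskerRight,
              id_whiskerRight, Category.id_comp, zero_comp, comp_zero,
              Iso.inv_hom_id_assoc, add_zero, zero_add, ← MonoidalCategory.whiskerLeft_comp,
              ← MonoidalPreadditive.whiskerLeft_add, biprod.total,
              MonoidalCategory.whiskerLeft_id] }
      monoidal := fun U V => by
        have hA := A.2.monoidal U V
        have hB := B.2.monoidal U V
        simp only [hA, hB, Preadditive.comp_add, Preadditive.add_comp, comp_whiskerRight,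
          MonoidalCategory.whiskerLeft_comp, MonoidalPreadditive.whiskerLeft_add,
          MonoidalPreadditive.add_whiskerRight, Category.assoc]
        simp only [whisker_assoc, Category.assoc, Iso.inv_hom_id_assoc,
          ← MonoidalCategory.whiskerLeft_comp_assoc, ← comp_whiskerRight_assoc, biprod.inl_fst,
          biprod.inl_snd, biprod.inr_fst, biprod.inr_snd]
        simp
      naturality := fun {U V} f => by
        simp only [Preadditive.comp_add, Preadditive.add_comp, Category.assoc]
        simp only [whisker_exchange_assoc, whisker_exchange, HalfBraiding.naturality_assoc] }⟩

/-- The inclusion of the first summand, as a morphism of the centre. -/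
noncomputable def centreInl [Preadditive D] [MonoidalPreadditive D] [HasBinaryBiproducts D]
    (A B : Center D) : A ⟶ centreSum A B where
  f := (biprod.inl : A.1 ⟶ A.1 ⊞ B.1)
  comm U := by
    simp only [centreSum, Preadditive.comp_add, ← comp_whiskerRight_assoc, biprod.inl_fst,
      biprod.inl_snd]
    simp

/-- The inclusion of the second summand, as a morphism of the centre. -/
noncomputable def centreInr [Preadditive D] [MonoidalPreadditive D] [HasBinaryBiproducts D]
    (A B : Center D) : B ⟶ centreSum A B where
  f := (biprod.inr : B.1 ⟶ A.1 ⊞ B.1)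
  comm U := by
    simp only [centreSum, Preadditive.comp_add, ← comp_whiskerRight_assoc, biprod.inr_fst,
      biprod.inr_snd]
    simp

/-- For braided `D`: the object `(X, c_{X,-})` of the centre. -/
def plusLift [BraidedCategory D] (X : D) : Center D :=
  ⟨X, { β := fun U => β_ X U }⟩

/-- For braided `D`: the object `(X, c_{-,X}⁻¹)` of the centre. -/
def minusLift [BraidedCategory D] (X : D) : Center D :=
  ⟨X, { β := fun U => (β_ U X).symm }⟩

/-- Two objects `V`, `W` of the centre are mutually transparent if the half-braidings
`V ⊗ W ⟶ W ⊗ V` and `W ⊗ V ⟶ V ⊗ W` compose to the identity. -/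
class MutuallyTransparent (V W : Center D) : Prop where
  eq : (V.2.β W.1).hom ≫ (W.2.β V.1).hom = 𝟙 (V.1 ⊗ W.1)

instance [BraidedCategory D] (X Y : D) : MutuallyTransparent (plusLift X) (minusLift Y) where
  eq := (β_ X Y).hom_inv_id

end Centre

/-! ### The category `D_F` -/

section PertCategory

variable {D : Type u} [Category.{v} D] [MonoidalCategory D]

/-- An object of `D_F`: an object `X` of `D` with a morphism `F ⊗ X ⟶ X`. -/
structure Pert (F : Center D) where
  X : D
  m : F.1 ⊗ X ⟶ X

namespace Pert

variable {F : Center D}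

/-- A morphism of `D_F`. -/
@[ext]
structure Hom (M N : Pert F) where
  f : M.X ⟶ N.X
  comm : F.1 ◁ f ≫ N.m = M.m ≫ f

instance : Category (Pert F) where
  Hom M N := Hom M N
  id M := ⟨𝟙 M.X, by simp⟩
  comp g h := ⟨g.f ≫ h.f, by
    rw [MonoidalCategory.whiskerLeft_comp, Category.assoc, h.comm, ← Category.assoc, g.comm,
      Category.assoc]⟩

@[ext]
theorem hom_ext {M N : Pert F} {g h : M ⟶ N} (e : g.f = h.f) : g = h := Hom.ext e

@[simp] theorem id_f (M : Pert F) : Hom.f (𝟙 M) = 𝟙 M.X := rfl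

@[simp] theorem comp_f {M N K : Pert F} (g : M ⟶ N) (h : N ⟶ K) : (g ≫ h).f = g.f ≫ h.f := rfl

/-- An isomorphism in `D` compatible with the structure morphisms is an isomorphism in `D_F`. -/
def mkIso {M N : Pert F} (e : M.X ≅ N.X) (h : F.1 ◁ e.hom ≫ N.m = M.m ≫ e.hom) : M ≅ N where
  hom := ⟨e.hom, h⟩
  inv := ⟨e.inv, by
    rw [← cancel_mono e.hom, Category.assoc, Category.assoc, ← h,
      ← MonoidalCategory.whiskerLeft_comp_assoc]
    simp⟩

variable [Preadditive D]

/-- The morphism `T(m,n) : F ⊗ (X ⊗ Y) ⟶ X ⊗ Y`. -/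
def tensorMor (M N : Pert F) : F.1 ⊗ (M.X ⊗ N.X) ⟶ M.X ⊗ N.X :=
  (α_ F.1 M.X N.X).inv ≫
    (M.m ▷ N.X + (F.2.β M.X).hom ▷ N.X ≫ (α_ M.X F.1 N.X).hom ≫ M.X ◁ N.m)

variable [MonoidalPreadditive D]

theorem tensorMor_whiskerLeft (M : Pert F) {N N' : Pert F} (g : N ⟶ N') :
    F.1 ◁ M.X ◁ g.f ≫ tensorMor M N' = tensorMor M N ≫ M.X ◁ g.f := by
  have h := g.comm
  simp only [tensorMor, Preadditive.comp_add, Preadditive.add_comp, Category.assoc,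
    ← MonoidalCategory.whiskerLeft_comp, ← h]
  rw [associator_inv_naturality_right_assoc, associator_inv_naturality_right_assoc,
    whisker_exchange, whisker_exchange_assoc]
  simp

theorem tensorMor_whiskerRight {M M' : Pert F} (g : M ⟶ M') (N : Pert F) :
    F.1 ◁ g.f ▷ N.X ≫ tensorMor M' N = tensorMor M N ≫ g.f ▷ N.X := by
  have h := g.comm
  simp only [tensorMor, Preadditive.comp_add, Preadditive.add_comp, Category.assoc,
    ← comp_whiskerRight, ← h]
  rw [associator_inv_naturality_middle_assoc, associator_inv_naturality_middle_assoc,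
    ← comp_whiskerRight, ← comp_whiskerRight_assoc, HalfBraiding.naturality]
  simp [whisker_exchange]

theorem tensorMor_associator (M N K : Pert F) :
    F.1 ◁ (α_ M.X N.X K.X).hom ≫ tensorMor M ⟨N.X ⊗ K.X, tensorMor N K⟩ =
      tensorMor ⟨M.X ⊗ N.X, tensorMor M N⟩ K ≫ (α_ M.X N.X K.X).hom := by
  simp only [tensorMor, Preadditive.comp_add, Preadditive.add_comp, Category.assoc,
    MonoidalPreadditive.whiskerLeft_add, MonoidalPreadditive.add_whiskerRight,
    MonoidalCategory.whiskerLeft_comp, comp_whiskerRight, add_assoc, HalfBraiding.monoidal]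
  congr 1
  · monoidal
  · congr 1
    · monoidal
    · monoidal

instance : MonoidalCategoryStruct (Pert F) where
  tensorObj M N := ⟨M.X ⊗ N.X, tensorMor M N⟩
  tensorUnit := ⟨𝟙_ D, 0⟩
  whiskerLeft M {N N'} g := ⟨M.X ◁ g.f, tensorMor_whiskerLeft M g⟩
  whiskerRight g N := ⟨g.f ▷ N.X, tensorMor_whiskerRight g N⟩
  tensorHom {M M' N N'} g h := ⟨g.f ⊗ₘ h.f, by
    rw [MonoidalCategory.tensorHom_def, MonoidalCategory.whiskerLeft_comp, Category.assoc,
      tensorMor_whiskerLeft, ← Category.assoc, tensorMor_whiskerRight, Category.assoc]⟩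
  associator M N K := mkIso (α_ M.X N.X K.X) (tensorMor_associator M N K)
  leftUnitor M := mkIso (λ_ M.X) (by
    simp only [tensorMor, MonoidalPreadditive.zero_whiskerRight, zero_add, Category.assoc,
      halfBraiding_unit]
    monoidal)
  rightUnitor M := mkIso (ρ_ M.X) (by
    simp [tensorMor])

/-- `D_F` is a monoidal category, with the associators and unit isomorphisms of `D`. -/
instance : MonoidalCategory (Pert F) where
  tensorHom_def g h := hom_ext (MonoidalCategory.tensorHom_def g.f h.f)
  id_tensorHom_id M N := hom_ext (id_tensorHom_id M.X N.X)
  tensorHom_comp_tensorHom g h g' h' := hom_ext (tensorHom_comp_tensorHom g.f h.f g'.f h'.f)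
  whiskerLeft_id M N := hom_ext (MonoidalCategory.whiskerLeft_id M.X N.X)
  id_whiskerRight M N := hom_ext (id_whiskerRight M.X N.X)
  associator_naturality g h k := hom_ext (associator_naturality g.f h.f k.f)
  leftUnitor_naturality g := hom_ext (leftUnitor_naturality g.f)
  rightUnitor_naturality g := hom_ext (rightUnitor_naturality g.f)
  pentagon M N K L := hom_ext (pentagon M.X N.X K.X L.X)
  triangle M N := hom_ext (triangle M.X N.X)

end Pert

end PertCategory

/-! ### The commutation condition -/

section Commutation

variable {D : Type u} [Category.{v} D] [MonoidalCategory D] [Preadditive D]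
  [MonoidalPreadditive D] [HasBinaryBiproducts D] {A B : Center D}

/-- The restriction of `m : (A ⊕ B) ⊗ X ⟶ X` to `A ⊗ X`. -/
noncomputable def resLeft (M : Pert (centreSum A B)) : A.1 ⊗ M.X ⟶ M.X :=
  (centreInl A B).f ▷ M.X ≫ M.m

/-- The restriction of `m : (A ⊕ B) ⊗ X ⟶ X` to `B ⊗ X`. -/
noncomputable def resRight (M : Pert (centreSum A B)) : B.1 ⊗ M.X ⟶ M.X :=
  (centreInr A B).f ▷ M.X ≫ M.m

/-- The half-braiding of the tensor product `A ⊗ B` in the centre. -/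
def tensorHalf (A B : Center D) (X : D) : (A.1 ⊗ B.1) ⊗ X ⟶ X ⊗ (A.1 ⊗ B.1) :=
  ((Center.tensorObj A B).2.β X).hom

/-- The commutation condition of an object of `D_{A ⊕ B}` with `b : A ⊗ B ⟶ 𝟙`. -/
def commutation (b : A.1 ⊗ B.1 ⟶ 𝟙_ D) : ObjectProperty (Pert (centreSum A B)) := fun M =>
  (α_ A.1 B.1 M.X).hom ≫ A.1 ◁ resRight M ≫ resLeft M -
      (A.2.β B.1).hom ▷ M.X ≫ (α_ B.1 A.1 M.X).hom ≫ B.1 ◁ resLeft M ≫ resRight M =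
    b ▷ M.X ≫ (λ_ M.X).hom - tensorHalf A B M.X ≫ M.X ◁ b ≫ (ρ_ M.X).hom

theorem resLeft_tensor (M N : Pert (centreSum A B)) :
    resLeft (M ⊗ N) = (α_ A.1 M.X N.X).inv ≫ (resLeft M ▷ N.X +
      (A.2.β M.X).hom ▷ N.X ≫ (α_ M.X A.1 N.X).hom ≫ M.X ◁ resLeft N) := by
  change (centreInl A B).f ▷ (M.X ⊗ N.X) ≫ Pert.tensorMor M N = _
  have h := (centreInl A B).comm M.X
  simp only [Pert.tensorMor, Preadditive.comp_add, resLeft]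
  rw [associator_inv_naturality_left_assoc, associator_inv_naturality_left_assoc,
    ← comp_whiskerRight, ← comp_whiskerRight_assoc, h]
  simp

theorem resRight_tensor (M N : Pert (centreSum A B)) :
    resRight (M ⊗ N) = (α_ B.1 M.X N.X).inv ≫ (resRight M ▷ N.X +
      (B.2.β M.X).hom ▷ N.X ≫ (α_ M.X B.1 N.X).hom ≫ M.X ◁ resRight N) := by
  change (centreInr A B).f ▷ (M.X ⊗ N.X) ≫ Pert.tensorMor M N = _
  have h := (centreInr A B).comm M.X
  simp only [Pert.tensorMor, Preadditive.comp_add, resRight]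
  rw [associator_inv_naturality_left_assoc, associator_inv_naturality_left_assoc,
    ← comp_whiskerRight, ← comp_whiskerRight_assoc, h]
  simp

theorem commutation_unit (b : A.1 ⊗ B.1 ⟶ 𝟙_ D) : commutation b (𝟙_ (Pert (centreSum A B))) := by
  have h1 : resLeft (𝟙_ (Pert (centreSum A B))) = 0 := comp_zero
  have h2 : resRight (𝟙_ (Pert (centreSum A B))) = 0 := comp_zero
  have key : (α_ A.1 B.1 (𝟙_ D)).hom ≫ A.1 ◁ (0 : B.1 ⊗ 𝟙_ D ⟶ 𝟙_ D) ≫ (0 : A.1 ⊗ 𝟙_ D ⟶ 𝟙_ D) -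
      (A.2.β B.1).hom ▷ (𝟙_ D) ≫ (α_ B.1 A.1 (𝟙_ D)).hom ≫
        B.1 ◁ (0 : A.1 ⊗ 𝟙_ D ⟶ 𝟙_ D) ≫ (0 : B.1 ⊗ 𝟙_ D ⟶ 𝟙_ D) =
      b ▷ 𝟙_ D ≫ (λ_ (𝟙_ D)).hom - tensorHalf A B (𝟙_ D) ≫ 𝟙_ D ◁ b ≫ (ρ_ (𝟙_ D)).hom := by
    have h3 : tensorHalf A B (𝟙_ D) = (ρ_ (A.1 ⊗ B.1)).hom ≫ (λ_ (A.1 ⊗ B.1)).inv :=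
      halfBraiding_unit (Center.tensorObj A B)
    rw [h3]
    simp only [comp_zero, sub_zero, unitors_equal]
    rw [eq_comm, sub_eq_zero]
    monoidal
  unfold commutation
  rw [h1, h2]
  exact key

theorem tensorHalf_eq (X : D) : tensorHalf A B X = (α_ A.1 B.1 X).hom ≫ A.1 ◁ (B.2.β X).hom ≫
    (α_ A.1 X B.1).inv ≫ (A.2.β X).hom ▷ B.1 ≫ (α_ X A.1 B.1).hom := rfl

theorem tensorHalf_tensor (X Y : D) : tensorHalf A B (X ⊗ Y) =
    (α_ (A.1 ⊗ B.1) X Y).inv ≫ tensorHalf A B X ▷ Y ≫ (α_ X (A.1 ⊗ B.1) Y).hom ≫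
      X ◁ tensorHalf A B Y ≫ (α_ X Y (A.1 ⊗ B.1)).inv :=
  (Center.tensorObj A B).2.monoidal X Y

/-- The half-braiding of `A` is natural along a morphism `Z ⊗ X ⟶ W`. -/
theorem halfBraiding_naturality_tensor (A : Center D) {Z X W : D} (q : Z ⊗ X ⟶ W) :
    A.1 ◁ q ≫ (A.2.β W).hom = (α_ A.1 Z X).inv ≫ (A.2.β Z).hom ▷ X ≫ (α_ Z A.1 X).hom ≫
      Z ◁ (A.2.β X).hom ≫ (α_ Z X A.1).inv ≫ q ▷ A.1 := by
  rw [A.2.naturality, A.2.monoidal]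
  simp

theorem tensorHalf_swap (X : D) : tensorHalf A B X ≫ X ◁ (A.2.β B.1).hom =
    (A.2.β B.1).hom ▷ X ≫ (α_ B.1 A.1 X).hom ≫ B.1 ◁ (A.2.β X).hom ≫ (α_ B.1 X A.1).inv ≫
      (B.2.β X).hom ▷ A.1 ≫ (α_ X B.1 A.1).hom := by
  have h := halfBraiding_naturality_tensor A (B.2.β X).hom
  rw [A.2.monoidal] at h
  have h₂ := congrArg (fun t => (α_ A.1 B.1 X).hom ≫ t ≫ (α_ X B.1 A.1).hom) h
  simp only [Category.assoc, Iso.inv_hom_id, Category.comp_id, Iso.hom_inv_id_assoc] at h₂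
  rw [tensorHalf_eq]
  simpa using h₂

/-- The tensor product of two objects satisfying the commutation condition, in terms of the
restrictions `p, q` and `p', q'` of the two structure morphisms. -/
theorem commutation_tensor_aux [MutuallyTransparent A B] (b : A.1 ⊗ B.1 ⟶ 𝟙_ D) {X Y : D}
    (p : A.1 ⊗ X ⟶ X) (q : B.1 ⊗ X ⟶ X) (p' : A.1 ⊗ Y ⟶ Y) (q' : B.1 ⊗ Y ⟶ Y)
    (hX : (α_ A.1 B.1 X).hom ≫ A.1 ◁ q ≫ p -
        (A.2.β B.1).hom ▷ X ≫ (α_ B.1 A.1 X).hom ≫ B.1 ◁ p ≫ q =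
      b ▷ X ≫ (λ_ X).hom - tensorHalf A B X ≫ X ◁ b ≫ (ρ_ X).hom)
    (hY : (α_ A.1 B.1 Y).hom ≫ A.1 ◁ q' ≫ p' -
        (A.2.β B.1).hom ▷ Y ≫ (α_ B.1 A.1 Y).hom ≫ B.1 ◁ p' ≫ q' =
      b ▷ Y ≫ (λ_ Y).hom - tensorHalf A B Y ≫ Y ◁ b ≫ (ρ_ Y).hom) :
    (α_ A.1 B.1 (X ⊗ Y)).hom ≫
        A.1 ◁ ((α_ B.1 X Y).inv ≫ (q ▷ Y + (B.2.β X).hom ▷ Y ≫ (α_ X B.1 Y).hom ≫ X ◁ q')) ≫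
        (α_ A.1 X Y).inv ≫ (p ▷ Y + (A.2.β X).hom ▷ Y ≫ (α_ X A.1 Y).hom ≫ X ◁ p') -
      (A.2.β B.1).hom ▷ (X ⊗ Y) ≫ (α_ B.1 A.1 (X ⊗ Y)).hom ≫
        B.1 ◁ ((α_ A.1 X Y).inv ≫ (p ▷ Y + (A.2.β X).hom ▷ Y ≫ (α_ X A.1 Y).hom ≫ X ◁ p')) ≫
        (α_ B.1 X Y).inv ≫ (q ▷ Y + (B.2.β X).hom ▷ Y ≫ (α_ X B.1 Y).hom ≫ X ◁ q') =
      b ▷ (X ⊗ Y) ≫ (λ_ (X ⊗ Y)).hom -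
        tensorHalf A B (X ⊗ Y) ≫ (X ⊗ Y) ◁ b ≫ (ρ_ (X ⊗ Y)).hom := by
  have hX' := congrArg (fun t => (α_ (A.1 ⊗ B.1) X Y).inv ≫ t ▷ Y) hX
  have hY' := congrArg (fun t => (α_ (A.1 ⊗ B.1) X Y).inv ≫ tensorHalf A B X ▷ Y ≫
    (α_ X (A.1 ⊗ B.1) Y).hom ≫ X ◁ t) hY
  have hsub1 : ∀ {P Q R : D} (f g : P ⟶ Q), (f - g) ▷ R = f ▷ R - g ▷ R := fun f g => by
    exact Functor.map_sub (tensorRight _)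
  have hsub2 : ∀ {P Q R : D} (f g : P ⟶ Q), R ◁ (f - g) = R ◁ f - R ◁ g := fun f g => by
    exact Functor.map_sub (tensorLeft _)
  simp only [hsub1, hsub2, Preadditive.comp_sub] at hX' hY'
  have t1 : (α_ A.1 B.1 (X ⊗ Y)).hom ≫ A.1 ◁ ((α_ B.1 X Y).inv ≫ q ▷ Y) ≫
      (α_ A.1 X Y).inv ≫ p ▷ Y =
      (α_ (A.1 ⊗ B.1) X Y).inv ≫ ((α_ A.1 B.1 X).hom ≫ A.1 ◁ q ≫ p) ▷ Y := by monoidal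
  have t2 : (α_ A.1 B.1 (X ⊗ Y)).hom ≫ A.1 ◁ ((α_ B.1 X Y).inv ≫ q ▷ Y) ≫
      (α_ A.1 X Y).inv ≫ (A.2.β X).hom ▷ Y ≫ (α_ X A.1 Y).hom ≫ X ◁ p' =
      (A.2.β B.1).hom ▷ (X ⊗ Y) ≫ (α_ B.1 A.1 (X ⊗ Y)).hom ≫
        B.1 ◁ ((α_ A.1 X Y).inv ≫ (A.2.β X).hom ▷ Y ≫ (α_ X A.1 Y).hom ≫ X ◁ p') ≫
        (α_ B.1 X Y).inv ≫ q ▷ Y := by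
    calc _ = 𝟙 _ ⊗≫ (A.1 ◁ q ≫ (A.2.β X).hom) ▷ Y ⊗≫ X ◁ p' := by monoidal
      _ = 𝟙 _ ⊗≫ (A.2.β B.1).hom ▷ X ▷ Y ⊗≫ B.1 ◁ (A.2.β X).hom ▷ Y ⊗≫
          (q ▷ (A.1 ⊗ Y) ≫ X ◁ p') := by
        rw [halfBraiding_naturality_tensor]; monoidal
      _ = _ := by rw [← whisker_exchange]; monoidal
  have t3 : (α_ A.1 B.1 (X ⊗ Y)).hom ≫
      A.1 ◁ ((α_ B.1 X Y).inv ≫ (B.2.β X).hom ▷ Y ≫ (α_ X B.1 Y).hom ≫ X ◁ q') ≫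
      (α_ A.1 X Y).inv ≫ p ▷ Y =
      (A.2.β B.1).hom ▷ (X ⊗ Y) ≫ (α_ B.1 A.1 (X ⊗ Y)).hom ≫
        B.1 ◁ ((α_ A.1 X Y).inv ≫ p ▷ Y) ≫
        (α_ B.1 X Y).inv ≫ (B.2.β X).hom ▷ Y ≫ (α_ X B.1 Y).hom ≫ X ◁ q' := by
    symm
    calc _ = 𝟙 _ ⊗≫ (A.2.β B.1).hom ▷ X ▷ Y ⊗≫ (B.1 ◁ p ≫ (B.2.β X).hom) ▷ Y ⊗≫ X ◁ q' := by
          monoidal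
      _ = 𝟙 _ ⊗≫ ((A.2.β B.1).hom ≫ (B.2.β A.1).hom) ▷ X ▷ Y ⊗≫ A.1 ◁ (B.2.β X).hom ▷ Y ⊗≫
          (p ▷ (B.1 ⊗ Y) ≫ X ◁ q') := by
        rw [halfBraiding_naturality_tensor]; monoidal
      _ = _ := by rw [MutuallyTransparent.eq, ← whisker_exchange]; monoidal
  have t4 : (α_ A.1 B.1 (X ⊗ Y)).hom ≫
      A.1 ◁ ((α_ B.1 X Y).inv ≫ (B.2.β X).hom ▷ Y ≫ (α_ X B.1 Y).hom ≫ X ◁ q') ≫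
      (α_ A.1 X Y).inv ≫ (A.2.β X).hom ▷ Y ≫ (α_ X A.1 Y).hom ≫ X ◁ p' =
      (α_ (A.1 ⊗ B.1) X Y).inv ≫ tensorHalf A B X ▷ Y ≫
    (α_ X (A.1 ⊗ B.1) Y).hom ≫ X ◁ ((α_ A.1 B.1 Y).hom ≫ A.1 ◁ q' ≫ p') := by
    calc _ = 𝟙 _ ⊗≫ A.1 ◁ (B.2.β X).hom ▷ Y ⊗≫
          ((A.1 ⊗ X) ◁ q' ≫ (A.2.β X).hom ▷ Y) ⊗≫ X ◁ p' := by monoidal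
      _ = _ := by rw [whisker_exchange, tensorHalf_eq]; monoidal
  have s1 : (A.2.β B.1).hom ▷ (X ⊗ Y) ≫ (α_ B.1 A.1 (X ⊗ Y)).hom ≫
        B.1 ◁ ((α_ A.1 X Y).inv ≫ p ▷ Y) ≫ (α_ B.1 X Y).inv ≫ q ▷ Y =
      (α_ (A.1 ⊗ B.1) X Y).inv ≫
        ((A.2.β B.1).hom ▷ X ≫ (α_ B.1 A.1 X).hom ≫ B.1 ◁ p ≫ q) ▷ Y := by monoidal
  have s4 : (A.2.β B.1).hom ▷ (X ⊗ Y) ≫ (α_ B.1 A.1 (X ⊗ Y)).hom ≫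
        B.1 ◁ ((α_ A.1 X Y).inv ≫ (A.2.β X).hom ▷ Y ≫ (α_ X A.1 Y).hom ≫ X ◁ p') ≫
        (α_ B.1 X Y).inv ≫ (B.2.β X).hom ▷ Y ≫ (α_ X B.1 Y).hom ≫ X ◁ q' =
      (α_ (A.1 ⊗ B.1) X Y).inv ≫ tensorHalf A B X ▷ Y ≫ (α_ X (A.1 ⊗ B.1) Y).hom ≫
        X ◁ ((A.2.β B.1).hom ▷ Y ≫ (α_ B.1 A.1 Y).hom ≫ B.1 ◁ p' ≫ q') := by
    calc _ = 𝟙 _ ⊗≫ (A.2.β B.1).hom ▷ X ▷ Y ⊗≫ B.1 ◁ (A.2.β X).hom ▷ Y ⊗≫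
          ((B.1 ⊗ X) ◁ p' ≫ (B.2.β X).hom ▷ Y) ⊗≫ X ◁ q' := by monoidal
      _ = 𝟙 _ ⊗≫ ((A.2.β B.1).hom ▷ X ≫ (α_ B.1 A.1 X).hom ≫ B.1 ◁ (A.2.β X).hom ≫
          (α_ B.1 X A.1).inv ≫ (B.2.β X).hom ▷ A.1 ≫ (α_ X B.1 A.1).hom) ▷ Y ⊗≫
            X ◁ B.1 ◁ p' ≫ X ◁ q' := by rw [whisker_exchange]; monoidal
      _ = _ := by rw [← tensorHalf_swap]; monoidal
  have r1 : (α_ (A.1 ⊗ B.1) X Y).inv ≫ (b ▷ X ≫ (λ_ X).hom) ▷ Y =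
      b ▷ (X ⊗ Y) ≫ (λ_ (X ⊗ Y)).hom := by monoidal
  have r2 : (α_ (A.1 ⊗ B.1) X Y).inv ≫ (tensorHalf A B X ≫ X ◁ b ≫ (ρ_ X).hom) ▷ Y =
      (α_ (A.1 ⊗ B.1) X Y).inv ≫ tensorHalf A B X ▷ Y ≫ (α_ X (A.1 ⊗ B.1) Y).hom ≫
        X ◁ (b ▷ Y ≫ (λ_ Y).hom) := by monoidal
  have r3 : (α_ (A.1 ⊗ B.1) X Y).inv ≫ tensorHalf A B X ▷ Y ≫ (α_ X (A.1 ⊗ B.1) Y).hom ≫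
        X ◁ (tensorHalf A B Y ≫ Y ◁ b ≫ (ρ_ Y).hom) =
      tensorHalf A B (X ⊗ Y) ≫ (X ⊗ Y) ◁ b ≫ (ρ_ (X ⊗ Y)).hom := by
    rw [tensorHalf_tensor]; monoidal
  rw [r1, r2, ← t1, ← s1] at hX'
  rw [r3, ← t4, ← s4] at hY'
  simp only [Preadditive.comp_add, Preadditive.add_comp, MonoidalPreadditive.whiskerLeft_add]
  rw [t2, t3]
  rw [sub_eq_iff_eq_add] at hX' hY'
  rw [hX', hY']
  abel

theorem commutation_tensor [MutuallyTransparent A B] (b : A.1 ⊗ B.1 ⟶ 𝟙_ D)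
    {M N : Pert (centreSum A B)} (hM : commutation b M) (hN : commutation b N) :
    commutation b (M ⊗ N) := by
  have h := commutation_tensor_aux b _ _ _ _ hM hN
  rw [← resLeft_tensor M N, ← resRight_tensor M N] at h
  exact h

end Commutation

/-! ### The tensor algebra -/

section TensorAlgebra

variable {D : Type u} [Category.{v} D] [MonoidalCategory D] [HasCountableCoproducts D]

/-- `F^{⊗ n}`, with brackets `((𝟙 ⊗ F) ⊗ F) ⊗ …`. -/
def tensorPow (F : D) : ℕ → D
  | 0 => 𝟙_ D
  | n + 1 => tensorPow F n ⊗ F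

/-- The underlying object `⨁ₙ F^{⊗ n}` of the tensor algebra. -/
noncomputable def T (F : D) : D := ∐ tensorPow F

namespace T

variable (F : D)

/-- The canonical morphism `F^{⊗ n} ⟶ T(F)`. -/
noncomputable def incl (n : ℕ) : tensorPow F n ⟶ T F := Sigma.ι (tensorPow F) n

/-- The canonical morphism `F^{⊗ (n + 1)} ⟶ T(F)`, with its source written as `F^{⊗ n} ⊗ F`. -/
noncomputable def inclSucc (n : ℕ) : tensorPow F n ⊗ F ⟶ T F := incl F (n + 1)

/-- The unit of `T(F)`. -/
noncomputable def unit : 𝟙_ D ⟶ T F := incl F 0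

/-- The canonical morphism `F ⟶ T(F)`. -/
noncomputable def gen : F ⟶ T F := (λ_ F).inv ≫ incl F 1

section

variable [∀ X : D, PreservesColimitsOfShape (Discrete ℕ) (tensorLeft X)]

theorem left_ext {Y Z : D} {g h : Y ⊗ T F ⟶ Z} (e : ∀ n, Y ◁ incl F n ≫ g = Y ◁ incl F n ≫ h) :
    g = h := by
  refine (isColimitOfPreserves (tensorLeft Y) (coproductIsCoproduct (tensorPow F))).hom_ext ?_
  rintro ⟨n⟩
  exact e n

theorem left_exists {Y Z : D} (k : ∀ n, Y ⊗ tensorPow F n ⟶ Z) :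
    ∃ g : Y ⊗ T F ⟶ Z, ∀ n, Y ◁ incl F n ≫ g = k n := by
  let c : Cocone (Discrete.functor (tensorPow F) ⋙ tensorLeft Y) :=
    { pt := Z
      ι := Discrete.natTrans fun n => k n.as }
  exact ⟨(isColimitOfPreserves (tensorLeft Y) (coproductIsCoproduct (tensorPow F))).desc c,
    fun n => (isColimitOfPreserves (tensorLeft Y)
      (coproductIsCoproduct (tensorPow F))).fac c ⟨n⟩⟩

end

section

variable [∀ X : D, PreservesColimitsOfShape (Discrete ℕ) (tensorRight X)]

theorem right_ext {Y Z : D} {g h : T F ⊗ Y ⟶ Z} (e : ∀ n, incl F n ▷ Y ≫ g = incl F n ▷ Y ≫ h) :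
    g = h := by
  refine (isColimitOfPreserves (tensorRight Y) (coproductIsCoproduct (tensorPow F))).hom_ext ?_
  rintro ⟨n⟩
  exact e n

theorem right_exists {Y Z : D} (k : ∀ n, tensorPow F n ⊗ Y ⟶ Z) :
    ∃ g : T F ⊗ Y ⟶ Z, ∀ n, incl F n ▷ Y ≫ g = k n := by
  let c : Cocone (Discrete.functor (tensorPow F) ⋙ tensorRight Y) :=
    { pt := Z
      ι := Discrete.natTrans fun n => k n.as }
  exact ⟨(isColimitOfPreserves (tensorRight Y) (coproductIsCoproduct (tensorPow F))).desc c,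
    fun n => (isColimitOfPreserves (tensorRight Y)
      (coproductIsCoproduct (tensorPow F))).fac c ⟨n⟩⟩

/-- Right multiplication by a generator, `F^{⊗ n} ⊗ F ⟶ F^{⊗ (n + 1)}` in each degree. -/
noncomputable def shift : T F ⊗ F ⟶ T F :=
  (right_exists F (fun n => inclSucc F n)).choose

theorem incl_shift (n : ℕ) : incl F n ▷ F ≫ shift F = inclSucc F n :=
  (right_exists F (fun n => inclSucc F n)).choose_spec n

end

variable [∀ X : D, PreservesColimitsOfShape (Discrete ℕ) (tensorLeft X)]
  [∀ X : D, PreservesColimitsOfShape (Discrete ℕ) (tensorRight X)]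

theorem middle_ext {Y Z W : D} {g h : Y ⊗ (T F ⊗ W) ⟶ Z}
    (e : ∀ n, Y ◁ incl F n ▷ W ≫ g = Y ◁ incl F n ▷ W ≫ h) : g = h := by
  refine (isColimitOfPreserves (tensorRight W ⋙ tensorLeft Y)
    (coproductIsCoproduct (tensorPow F))).hom_ext ?_
  rintro ⟨n⟩
  exact e n

/-- The components of `extend`. -/
def extendAux {Y Z : D} (y : Y ⟶ Z) (z : Z ⊗ F ⟶ Z) : ∀ n, Y ⊗ tensorPow F n ⟶ Z
  | 0 => (ρ_ Y).hom ≫ y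
  | n + 1 => (α_ Y (tensorPow F n) F).inv ≫ extendAux y z n ▷ F ≫ z

/-- `Y ⊗ T(F)` is the free object with a morphism `- ⊗ F ⟶ -` on `Y`: this is the morphism
`Y ⊗ T(F) ⟶ Z` extending `y : Y ⟶ Z` along `z : Z ⊗ F ⟶ Z`. -/
noncomputable def extend {Y Z : D} (y : Y ⟶ Z) (z : Z ⊗ F ⟶ Z) : Y ⊗ T F ⟶ Z :=
  (left_exists F (extendAux F y z)).choose

theorem incl_extend {Y Z : D} (y : Y ⟶ Z) (z : Z ⊗ F ⟶ Z) (n : ℕ) :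
    Y ◁ incl F n ≫ extend F y z = extendAux F y z n :=
  (left_exists F (extendAux F y z)).choose_spec n

theorem inclSucc_extend {Y Z : D} (y : Y ⟶ Z) (z : Z ⊗ F ⟶ Z) (n : ℕ) :
    Y ◁ inclSucc F n ≫ extend F y z =
      (α_ Y (tensorPow F n) F).inv ≫ extendAux F y z n ▷ F ≫ z :=
  incl_extend F y z (n + 1)

theorem unit_extend {Y Z : D} (y : Y ⟶ Z) (z : Z ⊗ F ⟶ Z) :
    Y ◁ unit F ≫ extend F y z = (ρ_ Y).hom ≫ y :=
  incl_extend F y z 0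

theorem shift_extend {Y Z : D} (y : Y ⟶ Z) (z : Z ⊗ F ⟶ Z) :
    Y ◁ shift F ≫ extend F y z = (α_ Y (T F) F).inv ≫ extend F y z ▷ F ≫ z := by
  apply middle_ext
  intro n
  rw [← MonoidalCategory.whiskerLeft_comp_assoc, incl_shift, inclSucc_extend,
    associator_inv_naturality_middle_assoc, ← comp_whiskerRight_assoc, incl_extend]

/-- Two morphisms out of `Y ⊗ T(F)` which agree in degree zero and satisfy the same recursion
agree. -/
theorem free_ext {Y Z : D} (z : Z ⊗ F ⟶ Z) {g h : Y ⊗ T F ⟶ Z}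
    (e : Y ◁ unit F ≫ g = Y ◁ unit F ≫ h)
    (hg : Y ◁ shift F ≫ g = (α_ Y (T F) F).inv ≫ g ▷ F ≫ z)
    (hh : Y ◁ shift F ≫ h = (α_ Y (T F) F).inv ≫ h ▷ F ≫ z) : g = h := by
  apply left_ext
  intro n
  induction n with
  | zero => exact e
  | succ n ih =>
    change Y ◁ inclSucc F n ≫ g = Y ◁ inclSucc F n ≫ h
    rw [← incl_shift, MonoidalCategory.whiskerLeft_comp_assoc,
      MonoidalCategory.whiskerLeft_comp_assoc, hg, hh, associator_inv_naturality_middle_assoc,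
      associator_inv_naturality_middle_assoc, ← comp_whiskerRight_assoc, ih,
      comp_whiskerRight_assoc]

/-- Two morphisms out of `T(F)` which agree in degree zero and satisfy the same recursion agree. -/
theorem ext {Z : D} (z : Z ⊗ F ⟶ Z) {g h : T F ⟶ Z} (e : unit F ≫ g = unit F ≫ h)
    (hg : shift F ≫ g = g ▷ F ≫ z) (hh : shift F ≫ h = h ▷ F ≫ z) : g = h := by
  rw [← cancel_epi (λ_ (T F)).hom]
  refine free_ext F z ?_ ?_ ?_
  · rw [leftUnitor_naturality_assoc, leftUnitor_naturality_assoc, e]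
  · rw [leftUnitor_naturality_assoc, hg]; monoidal
  · rw [leftUnitor_naturality_assoc, hh]; monoidal

/-- The multiplication of `T(F)`. -/
noncomputable def mul : T F ⊗ T F ⟶ T F := extend F (𝟙 _) (shift F)

theorem mul_unit : T F ◁ unit F ≫ mul F = (ρ_ (T F)).hom := by
  rw [mul, unit_extend, Category.comp_id]

theorem mul_shift : T F ◁ shift F ≫ mul F = (α_ (T F) (T F) F).inv ≫ mul F ▷ F ≫ shift F :=
  shift_extend F _ _

theorem unit_mul : unit F ▷ T F ≫ mul F = (λ_ (T F)).hom := by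
  refine free_ext F (shift F) ?_ ?_ ?_
  · rw [whisker_exchange_assoc, mul_unit]; monoidal
  · rw [whisker_exchange_assoc, mul_shift]; monoidal
  · monoidal

/-- The tensor algebra is an algebra. -/
noncomputable instance : MonObj (T F) where
  one := unit F
  mul := mul F
  one_mul := unit_mul F
  mul_one := mul_unit F
  mul_assoc := by
    refine free_ext F (shift F) ?_ ?_ ?_
    · rw [whisker_exchange_assoc, mul_unit]
      calc _ = (ρ_ _).hom ≫ mul F := by monoidal
        _ = 𝟙 _ ⊗≫ T F ◁ (T F ◁ unit F ≫ mul F) ⊗≫ mul F := by rw [mul_unit]; monoidal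
        _ = _ := by monoidal
    · rw [whisker_exchange_assoc, mul_shift]; monoidal
    · calc _ = 𝟙 _ ⊗≫ T F ◁ (T F ◁ shift F ≫ mul F) ⊗≫ mul F := by monoidal
        _ = 𝟙 _ ⊗≫ T F ◁ ((α_ (T F) (T F) F).inv ≫ mul F ▷ F ≫ shift F) ⊗≫ mul F := by
          rw [mul_shift]
        _ = 𝟙 _ ⊗≫ T F ◁ mul F ▷ F ⊗≫ (T F ◁ shift F ≫ mul F) := by monoidal
        _ = _ := by rw [mul_shift]; monoidal

theorem gen_eq : gen F = (λ_ F).inv ≫ unit F ▷ F ≫ shift F :=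
  congrArg ((λ_ F).inv ≫ ·) (incl_shift F 0).symm

theorem gen_mul : T F ◁ gen F ≫ mul F = shift F := by
  calc _ = 𝟙 _ ⊗≫ T F ◁ unit F ▷ F ⊗≫ (T F ◁ shift F ≫ mul F) := by rw [gen_eq]; monoidal
    _ = 𝟙 _ ⊗≫ (T F ◁ unit F ≫ mul F) ▷ F ⊗≫ shift F := by rw [mul_shift]; monoidal
    _ = _ := by rw [mul_unit]; monoidal

open MonObj

theorem mul_eq : μ[T F] = mul F := rfl

theorem one_eq : η[T F] = unit F := rfl

theorem shift_eq : shift F = T F ◁ gen F ≫ μ[T F] := (gen_mul F).symm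

section Lift

variable {F} {A : D} [MonObj A]

/-- The algebra morphism `T(F) ⟶ A` extending a morphism `F ⟶ A`. -/
noncomputable def lift (k : F ⟶ A) : T F ⟶ A :=
  (λ_ (T F)).inv ≫ extend F η[A] (A ◁ k ≫ μ[A])

theorem unit_lift (k : F ⟶ A) : unit F ≫ lift k = η[A] := by
  rw [lift, leftUnitor_inv_naturality_assoc, unit_extend]
  monoidal

theorem shift_lift (k : F ⟶ A) : shift F ≫ lift k = lift k ▷ F ≫ A ◁ k ≫ μ[A] := by
  rw [lift, leftUnitor_inv_naturality_assoc, shift_extend]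
  monoidal

instance (k : F ⟶ A) : IsMonHom (lift k) where
  one_hom := unit_lift k
  mul_hom := by
    rw [mul_eq]
    refine free_ext F (A ◁ k ≫ μ[A]) ?_ ?_ ?_
    · calc _ = (T F ◁ unit F ≫ mul F) ≫ lift k := by monoidal
        _ = 𝟙 _ ⊗≫ lift k ▷ 𝟙_ D ⊗≫ (A ◁ η[A] ≫ μ[A]) := by
          rw [mul_unit, MonObj.mul_one]; monoidal
        _ = 𝟙 _ ⊗≫ (lift k ▷ 𝟙_ D ≫ A ◁ (unit F ≫ lift k)) ≫ μ[A] := by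
          rw [unit_lift]; monoidal
        _ = _ := by
          rw [MonoidalCategory.whiskerLeft_comp, ← whisker_exchange_assoc,
            MonoidalCategory.tensorHom_def]
          monoidal
    · calc _ = (T F ◁ shift F ≫ mul F) ≫ lift k := by monoidal
        _ = 𝟙 _ ⊗≫ mul F ▷ F ⊗≫ (shift F ≫ lift k) := by rw [mul_shift]; monoidal
        _ = _ := by rw [shift_lift]; monoidal
    · calc _ = 𝟙 _ ⊗≫ (T F ◁ shift F ≫ lift k ▷ T F) ⊗≫ A ◁ lift k ≫ μ[A] := by
            rw [MonoidalCategory.tensorHom_def]; monoidal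
        _ = 𝟙 _ ⊗≫ lift k ▷ (T F ⊗ F) ⊗≫ A ◁ (shift F ≫ lift k) ⊗≫ μ[A] := by
          rw [whisker_exchange]; monoidal
        _ = 𝟙 _ ⊗≫ lift k ▷ (T F ⊗ F) ⊗≫ A ◁ lift k ▷ F ⊗≫ A ◁ A ◁ k ⊗≫ (A ◁ μ[A] ≫ μ[A]) := by
          rw [shift_lift]; monoidal
        _ = 𝟙 _ ⊗≫ lift k ▷ (T F ⊗ F) ⊗≫ A ◁ lift k ▷ F ⊗≫ ((A ⊗ A) ◁ k ≫ μ[A] ▷ A) ⊗≫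
            μ[A] := by
          rw [MonObj.mul_assoc_flip]; monoidal
        _ = _ := by
          rw [whisker_exchange, MonoidalCategory.tensorHom_def]; monoidal

theorem gen_lift (k : F ⟶ A) : gen F ≫ lift k = k := by
  calc _ = (λ_ F).inv ≫ unit F ▷ F ≫ (shift F ≫ lift k) := by rw [gen_eq]; monoidal
    _ = (λ_ F).inv ≫ (unit F ≫ lift k) ▷ F ≫ A ◁ k ≫ μ[A] := by rw [shift_lift]; monoidal
    _ = (λ_ F).inv ≫ (η[A] ▷ F ≫ A ◁ k) ≫ μ[A] := by rw [unit_lift]; monoidal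
    _ = 𝟙 _ ⊗≫ k ⊗≫ (η[A] ▷ A ≫ μ[A]) := by rw [← whisker_exchange]; monoidal
    _ = _ := by rw [MonObj.one_mul]; monoidal

/-- An algebra morphism out of `T(F)` is determined by its restriction to `F`. -/
theorem lift_unique {g h : T F ⟶ A} [IsMonHom g] [IsMonHom h] (e : gen F ≫ g = gen F ≫ h) :
    g = h := by
  have key : ∀ (g : T F ⟶ A) [IsMonHom g], shift F ≫ g = g ▷ F ≫ A ◁ (gen F ≫ g) ≫ μ[A] := by
    intro g _
    rw [shift_eq, Category.assoc, IsMonHom.mul_hom, MonoidalCategory.tensorHom_def,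
      Category.assoc, whisker_exchange_assoc, MonoidalCategory.whiskerLeft_comp_assoc]
  refine ext F (A ◁ (gen F ≫ g) ≫ μ[A]) ?_ (key g) ?_
  · exact (IsMonHom.one_hom g).trans (IsMonHom.one_hom h).symm
  · rw [e]; exact key h

end Lift

section Coalgebra

variable [BraidedCategory D] [Preadditive D] [MonoidalPreadditive D]

/-- The restriction of the coproduct to the generators: `ι ⊗ η + η ⊗ ι`. -/
noncomputable def primitive : F ⟶ T F ⊗ T F :=
  (ρ_ F).inv ≫ (gen F ⊗ₘ unit F) + (λ_ F).inv ≫ (unit F ⊗ₘ gen F)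

/-- The coproduct of `T(F)`. -/
noncomputable def comul : T F ⟶ T F ⊗ T F := lift (primitive F)

/-- The counit of `T(F)`. -/
noncomputable def counit : T F ⟶ 𝟙_ D := lift 0

noncomputable instance : IsMonHom (comul F) := inferInstanceAs (IsMonHom (lift _))

noncomputable instance : IsMonHom (counit F) := inferInstanceAs (IsMonHom (lift _))

theorem gen_comul : gen F ≫ comul F = primitive F := gen_lift _

theorem gen_counit : gen F ≫ counit F = 0 := gen_lift _

theorem unit_comul : unit F ≫ comul F = (λ_ (𝟙_ D)).inv ≫ (unit F ⊗ₘ unit F) := unit_lift _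

theorem unit_counit : unit F ≫ counit F = 𝟙 _ := unit_lift _

noncomputable instance : ComonObj (T F) where
  counit := counit F
  comul := comul F
  counit_comul := by
    refine lift_unique ?_
    rw [reassoc_of% (gen_comul F), primitive, Preadditive.add_comp]
    have h1 : ((ρ_ F).inv ≫ (gen F ⊗ₘ unit F)) ≫ counit F ▷ T F = 0 := by
      calc _ = (ρ_ F).inv ≫ ((gen F ≫ counit F) ⊗ₘ unit F) := by monoidal
        _ = _ := by rw [gen_counit]; simp
    have h2 : ((λ_ F).inv ≫ (unit F ⊗ₘ gen F)) ≫ counit F ▷ T F = gen F ≫ (λ_ (T F)).inv := by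
      calc _ = (λ_ F).inv ≫ ((unit F ≫ counit F) ⊗ₘ gen F) := by monoidal
        _ = _ := by rw [unit_counit]; monoidal
    rw [h1, h2, zero_add]
  comul_counit := by
    refine lift_unique ?_
    rw [reassoc_of% (gen_comul F), primitive, Preadditive.add_comp]
    have h1 : ((λ_ F).inv ≫ (unit F ⊗ₘ gen F)) ≫ T F ◁ counit F = 0 := by
      calc _ = (λ_ F).inv ≫ (unit F ⊗ₘ (gen F ≫ counit F)) := by monoidal
        _ = _ := by rw [gen_counit]; simp
    have h2 : ((ρ_ F).inv ≫ (gen F ⊗ₘ unit F)) ≫ T F ◁ counit F = gen F ≫ (ρ_ (T F)).inv := by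
      calc _ = (ρ_ F).inv ≫ (gen F ⊗ₘ (unit F ≫ counit F)) := by monoidal
        _ = _ := by rw [unit_counit]; monoidal
    rw [h1, h2, add_zero]
  comul_assoc := by
    refine lift_unique ?_
    have h1 : ((ρ_ F).inv ≫ (gen F ⊗ₘ unit F)) ≫ T F ◁ comul F =
        (ρ_ F).inv ≫ (gen F ⊗ₘ ((λ_ (𝟙_ D)).inv ≫ (unit F ⊗ₘ unit F))) := by
      rw [← unit_comul]; monoidal
    have h2 : ((λ_ F).inv ≫ (unit F ⊗ₘ gen F)) ≫ T F ◁ comul F =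
        (λ_ F).inv ≫ (unit F ⊗ₘ ((ρ_ F).inv ≫ (gen F ⊗ₘ unit F))) +
        (λ_ F).inv ≫ (unit F ⊗ₘ ((λ_ F).inv ≫ (unit F ⊗ₘ gen F))) := by
      rw [← Preadditive.comp_add, ← MonoidalPreadditive.tensor_add, ← primitive, ← gen_comul]
      monoidal
    have h3 : ((λ_ F).inv ≫ (unit F ⊗ₘ gen F)) ≫ comul F ▷ T F =
        (λ_ F).inv ≫ (((λ_ (𝟙_ D)).inv ≫ (unit F ⊗ₘ unit F)) ⊗ₘ gen F) := by
      rw [← unit_comul]; monoidal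
    have h4 : ((ρ_ F).inv ≫ (gen F ⊗ₘ unit F)) ≫ comul F ▷ T F =
        (ρ_ F).inv ≫ (((ρ_ F).inv ≫ (gen F ⊗ₘ unit F)) ⊗ₘ unit F) +
        (ρ_ F).inv ≫ (((λ_ F).inv ≫ (unit F ⊗ₘ gen F)) ⊗ₘ unit F) := by
      rw [← Preadditive.comp_add, ← MonoidalPreadditive.add_tensor, ← primitive, ← gen_comul]
      monoidal
    have h5 : gen F ≫ comul F ≫ comul F ▷ T F ≫ (α_ (T F) (T F) (T F)).hom =
        (primitive F ≫ comul F ▷ T F) ≫ (α_ (T F) (T F) (T F)).hom := by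
      rw [← gen_comul]; simp
    rw [h5, reassoc_of% (gen_comul F), primitive, Preadditive.add_comp, Preadditive.add_comp,
      h1, h2, h3, h4, Preadditive.add_comp, Preadditive.add_comp, add_assoc]
    congr 1
    · monoidal
    · congr 1
      · monoidal
      · monoidal

noncomputable instance : BimonObj (T F) where
  mul_comul := by
    have h := IsMonHom.mul_hom (comul F)
    rw [MonObj.tensorObj.mul_def] at h
    exact h
  one_comul := IsMonHom.one_hom (comul F)
  mul_counit := IsMonHom.mul_hom (counit F)
  one_counit := IsMonHom.one_hom (counit F)

theorem mul_left_generator {A : D} [MonObj A] (k : F ⟶ A) :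
    (A ⊗ A) ◁ ((ρ_ F).inv ≫ (k ⊗ₘ η[A])) ≫ tensorμ A A A A ≫ (μ[A] ⊗ₘ μ[A]) =
      (α_ A A F).hom ≫ A ◁ (β_ A F).hom ≫ (α_ A F A).inv ≫ (A ◁ k ≫ μ[A]) ▷ A := by
  calc _ = 𝟙 _ ⊗≫ A ◁ (A ◁ k) ▷ 𝟙_ D ⊗≫ ((A ⊗ (A ⊗ A)) ◁ η[A] ≫ (A ◁ (β_ A A).hom) ▷ A) ⊗≫
        (A ⊗ A) ◁ μ[A] ≫ μ[A] ▷ A := by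
        simp only [tensorμ]
        rw [MonoidalCategory.tensorHom_def, MonoidalCategory.tensorHom_def' μ[A] μ[A]]
        monoidal
    _ = 𝟙 _ ⊗≫ A ◁ (A ◁ k ≫ (β_ A A).hom) ▷ 𝟙_ D ⊗≫ (A ⊗ A) ◁ (A ◁ η[A] ≫ μ[A]) ⊗≫
        μ[A] ▷ A := by
      rw [whisker_exchange]; monoidal
    _ = _ := by
      rw [BraidedCategory.braiding_naturality_right, MonObj.mul_one]; monoidal

theorem mul_right_generator {A : D} [MonObj A] (k : F ⟶ A) :
    (A ⊗ A) ◁ ((λ_ F).inv ≫ (η[A] ⊗ₘ k)) ≫ tensorμ A A A A ≫ (μ[A] ⊗ₘ μ[A]) =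
      (α_ A A F).hom ≫ A ◁ (A ◁ k ≫ μ[A]) := by
  calc _ = 𝟙 _ ⊗≫ (A ⊗ A) ◁ k ⊗≫ A ◁ (A ◁ η[A] ≫ (β_ A A).hom) ▷ A ⊗≫
        μ[A] ▷ (A ⊗ A) ≫ A ◁ μ[A] := by
        simp only [tensorμ]
        rw [MonoidalCategory.tensorHom_def', MonoidalCategory.tensorHom_def μ[A] μ[A]]
        monoidal
    _ = 𝟙 _ ⊗≫ (A ⊗ A) ◁ k ⊗≫ (A ◁ η[A] ≫ μ[A]) ▷ (A ⊗ A) ⊗≫ A ◁ μ[A] := by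
      rw [BraidedCategory.braiding_naturality_right, braiding_tensorUnit_right]; monoidal
    _ = _ := by
      rw [MonObj.mul_one]; monoidal

/-- The coproduct of a product with a generator. -/
theorem shift_comul : shift F ≫ comul F = comul F ▷ F ≫ (α_ (T F) (T F) F).hom ≫
    (T F ◁ (β_ (T F) F).hom ≫ (α_ (T F) F (T F)).inv ≫ shift F ▷ T F + T F ◁ shift F) := by
  have h1 := mul_left_generator F (gen F)
  have h2 := mul_right_generator F (gen F)
  rw [← shift_eq] at h1 h2
  have h3 : shift F ≫ comul F = comul F ▷ F ≫
      (T F ⊗ T F) ◁ ((ρ_ F).inv ≫ (gen F ⊗ₘ η[T F]) + (λ_ F).inv ≫ (η[T F] ⊗ₘ gen F)) ≫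
        tensorμ (T F) (T F) (T F) (T F) ≫ (μ[T F] ⊗ₘ μ[T F]) := by
    rw [← MonObj.tensorObj.mul_def]
    exact shift_lift (primitive F)
  rw [h3, MonoidalPreadditive.whiskerLeft_add, Preadditive.add_comp, h1, h2, Preadditive.comp_add,
    Preadditive.comp_add, Preadditive.comp_add]

/-- Left multiplication by a generator after moving it past `T(F)`, with a sign. -/
noncomputable def antipodeStep : T F ⊗ F ⟶ T F := -((β_ (T F) F).hom ≫ gen F ▷ T F ≫ mul F)

/-- The antipode of `T(F)`: the algebra morphism to the opposite algebra which is `-id` on the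
generators. -/
noncomputable def antipode : T F ⟶ T F := (λ_ (T F)).inv ≫ extend F (unit F) (antipodeStep F)

theorem unit_antipode : unit F ≫ antipode F = unit F := by
  rw [antipode, leftUnitor_inv_naturality_assoc, unit_extend]
  monoidal

theorem shift_antipode : shift F ≫ antipode F = antipode F ▷ F ≫ antipodeStep F := by
  rw [antipode, leftUnitor_inv_naturality_assoc, shift_extend]
  monoidal

theorem shift_counit : shift F ≫ counit F = 0 := by
  rw [counit, shift_lift]
  simp

theorem whiskerLeft_neg' {X Y Z : D} (f : X ⟶ Y) : Z ◁ (-f) = -(Z ◁ f) :=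
  Functor.map_neg (tensorLeft Z)

theorem whiskerRight_neg' {X Y Z : D} (f : X ⟶ Y) : (-f) ▷ Z = -(f ▷ Z) :=
  Functor.map_neg (tensorRight Z)

theorem unit_shift : unit F ▷ F ≫ shift F = (λ_ F).hom ≫ gen F := by
  rw [gen_eq, Iso.hom_inv_id_assoc]

theorem unit_swap : unit F ▷ F ≫ (β_ (T F) F).hom ≫ gen F ▷ T F ≫ mul F =
    (λ_ F).hom ≫ gen F := by
  calc _ = (β_ (𝟙_ D) F).hom ≫ (F ◁ unit F ≫ gen F ▷ T F) ≫ mul F := by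
        rw [BraidedCategory.braiding_naturality_left_assoc]; monoidal
    _ = (λ_ F).hom ≫ (ρ_ F).inv ≫ gen F ▷ 𝟙_ D ≫ (T F ◁ unit F ≫ mul F) := by
        rw [whisker_exchange, braiding_tensorUnit_left]; monoidal
    _ = _ := by rw [mul_unit]; monoidal

theorem mul_swap : mul F ▷ F ≫ (β_ (T F) F).hom ≫ gen F ▷ T F ≫ mul F =
    (α_ (T F) (T F) F).hom ≫ T F ◁ (β_ (T F) F).hom ≫ (α_ (T F) F (T F)).inv ≫
      ((β_ (T F) F).hom ≫ gen F ▷ T F ≫ mul F) ▷ T F ≫ mul F := by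
  have h : mul F ▷ T F ≫ mul F = (α_ (T F) (T F) (T F)).hom ≫ T F ◁ mul F ≫ mul F :=
    MonObj.mul_assoc (T F)
  symm
  calc _ = (α_ (T F) (T F) F).hom ≫ T F ◁ (β_ (T F) F).hom ≫ (α_ (T F) F (T F)).inv ≫
        (β_ (T F) F).hom ▷ T F ≫ gen F ▷ T F ▷ T F ≫ (mul F ▷ T F ≫ mul F) := by monoidal
    _ = ((α_ (T F) (T F) F).hom ≫ T F ◁ (β_ (T F) F).hom ≫ (α_ (T F) F (T F)).inv ≫
        (β_ (T F) F).hom ▷ T F ≫ (α_ _ _ _).hom) ≫ (gen F ▷ (T F ⊗ T F) ≫ T F ◁ mul F) ≫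
          mul F := by
      rw [h]; monoidal
    _ = _ := by
      rw [← BraidedCategory.braiding_tensor_left_hom, ← whisker_exchange,
        BraidedCategory.braiding_naturality_left_assoc]
      simp

theorem antipode_left_aux : comul F ≫ antipode F ▷ T F ≫ mul F = counit F ≫ unit F := by
  refine ext F (shift F + antipodeStep F) ?_ ?_ ?_
  · rw [reassoc_of% (unit_comul F), reassoc_of% (unit_counit F)]
    calc _ = 𝟙 _ ⊗≫ ((unit F ≫ antipode F) ⊗ₘ unit F) ≫ mul F := by monoidal
      _ = 𝟙 _ ⊗≫ unit F ▷ 𝟙_ D ≫ (T F ◁ unit F ≫ mul F) := by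
        rw [unit_antipode, MonoidalCategory.tensorHom_def]; monoidal
      _ = _ := by rw [mul_unit]; monoidal
  · rw [reassoc_of% (shift_comul F), Preadditive.add_comp, Preadditive.comp_add,
      Preadditive.comp_add, Preadditive.comp_add, add_comm]
    congr 1
    · calc _ = 𝟙 _ ⊗≫ comul F ▷ F ⊗≫ (T F ◁ shift F ≫ antipode F ▷ T F) ⊗≫ mul F := by
            monoidal
        _ = 𝟙 _ ⊗≫ comul F ▷ F ⊗≫ antipode F ▷ (T F ⊗ F) ⊗≫ (T F ◁ shift F ≫ mul F) := by
          rw [whisker_exchange]; monoidal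
        _ = _ := by rw [mul_shift]; monoidal
    · have e : (shift F ≫ antipode F) ▷ T F = -((antipode F ▷ F ≫
          (β_ (T F) F).hom ≫ gen F ▷ T F ≫ mul F) ▷ T F) := by
        rw [shift_antipode, antipodeStep, Preadditive.comp_neg, whiskerRight_neg']
      have e' : comul F ▷ F ≫ (α_ (T F) (T F) F).hom ≫ (T F ◁ (β_ (T F) F).hom ≫
          (α_ (T F) F (T F)).inv ≫ (antipode F ▷ F ≫
          (β_ (T F) F).hom ≫ gen F ▷ T F ≫ mul F) ▷ T F) ≫ mul F =
          (comul F ≫ antipode F ▷ T F ≫ mul F) ▷ F ≫ (β_ (T F) F).hom ≫ gen F ▷ T F ≫ mul F := by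
        calc _ = comul F ▷ F ≫ (α_ (T F) (T F) F).hom ≫ (T F ◁ (β_ (T F) F).hom ≫
              antipode F ▷ (F ⊗ T F)) ≫ (α_ (T F) F (T F)).inv ≫ ((β_ (T F) F).hom ≫
              gen F ▷ T F ≫ mul F) ▷ T F ≫ mul F := by monoidal
          _ = comul F ▷ F ≫ antipode F ▷ T F ▷ F ≫ ((α_ (T F) (T F) F).hom ≫
              T F ◁ (β_ (T F) F).hom ≫ (α_ (T F) F (T F)).inv ≫ ((β_ (T F) F).hom ≫
              gen F ▷ T F ≫ mul F) ▷ T F ≫ mul F) := by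
            rw [whisker_exchange]; monoidal
          _ = _ := by rw [← mul_swap]; simp
      rw [antipodeStep, Preadditive.comp_neg, ← e', Category.assoc, Category.assoc,
        ← comp_whiskerRight_assoc, e]
      simp
  · rw [reassoc_of% (shift_counit F), zero_comp, comp_whiskerRight, Category.assoc, antipodeStep,
      Preadditive.comp_add, Preadditive.comp_neg, unit_shift, unit_swap, add_neg_cancel, comp_zero]

theorem antipode_right_aux : comul F ≫ T F ◁ antipode F ≫ mul F = counit F ≫ unit F := by
  refine ext F 0 ?_ ?_ ?_
  · rw [reassoc_of% (unit_comul F), reassoc_of% (unit_counit F)]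
    calc _ = 𝟙 _ ⊗≫ (unit F ⊗ₘ (unit F ≫ antipode F)) ≫ mul F := by monoidal
      _ = 𝟙 _ ⊗≫ unit F ▷ 𝟙_ D ≫ (T F ◁ unit F ≫ mul F) := by
        rw [unit_antipode, MonoidalCategory.tensorHom_def]; monoidal
      _ = _ := by rw [mul_unit]; monoidal
  · have h : mul F ▷ T F ≫ mul F = (α_ (T F) (T F) (T F)).hom ≫ T F ◁ mul F ≫ mul F :=
      MonObj.mul_assoc (T F)
    have e : T F ◁ shift F ≫ T F ◁ antipode F ≫ mul F = -(T F ◁ antipode F ▷ F ≫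
        T F ◁ (β_ (T F) F).hom ≫ T F ◁ gen F ▷ T F ≫ T F ◁ mul F ≫ mul F) := by
      rw [← MonoidalCategory.whiskerLeft_comp_assoc, shift_antipode, antipodeStep,
        Preadditive.comp_neg, whiskerLeft_neg', Preadditive.neg_comp]
      simp only [MonoidalCategory.whiskerLeft_comp, Category.assoc]
    have e' : T F ◁ (β_ (T F) F).hom ≫ (α_ (T F) F (T F)).inv ≫ shift F ▷ T F ≫
        T F ◁ antipode F ≫ mul F = T F ◁ antipode F ▷ F ≫
        T F ◁ (β_ (T F) F).hom ≫ T F ◁ gen F ▷ T F ≫ T F ◁ mul F ≫ mul F := by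
      calc _ = T F ◁ (β_ (T F) F).hom ≫ (α_ (T F) F (T F)).inv ≫ (shift F ▷ T F ≫
            T F ◁ antipode F) ≫ mul F := by simp
        _ = T F ◁ ((β_ (T F) F).hom ≫ F ◁ antipode F) ≫ (α_ (T F) F (T F)).inv ≫
            (T F ◁ gen F) ▷ T F ≫ (mul F ▷ T F ≫ mul F) := by
          rw [← whisker_exchange, ← gen_mul]; monoidal
        _ = T F ◁ (antipode F ▷ F ≫ (β_ (T F) F).hom) ≫ (α_ (T F) F (T F)).inv ≫
            (T F ◁ gen F) ▷ T F ≫ (α_ (T F) (T F) (T F)).hom ≫ T F ◁ mul F ≫ mul F := by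
          rw [h, BraidedCategory.braiding_naturality_left]
        _ = _ := by monoidal
    rw [reassoc_of% (shift_comul F), comp_zero, Preadditive.add_comp, Category.assoc,
      Category.assoc, e, e', add_neg_cancel, comp_zero, comp_zero]
  · rw [reassoc_of% (shift_counit F), zero_comp, comp_zero]

noncomputable instance : HopfObj (T F) where
  antipode := antipode F
  antipode_left := antipode_left_aux F
  antipode_right := antipode_right_aux F

end Coalgebra

end T

end TensorAlgebra

/-! ### Hopf pairings and Yetter-Drinfeld modules -/

section YetterDrinfeld

open MonObj ComonObj

variable {D : Type u} [Category.{v} D] [MonoidalCategory D]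

section Pairing

variable {H K : D}

/-- The nested pairing `(H ⊗ H) ⊗ (K ⊗ K) ⟶ 𝟙`: the two inner tensor factors are paired first, then
the two outer ones. -/
def nested (r : H ⊗ K ⟶ 𝟙_ D) : (H ⊗ H) ⊗ (K ⊗ K) ⟶ 𝟙_ D :=
  (α_ H H (K ⊗ K)).hom ≫ H ◁ ((α_ H K K).inv ≫ r ▷ K ≫ (λ_ K).hom) ≫ r

/-- A Hopf pairing: the algebra structure of each of `H` and `K` is dual, with respect to the
pairing, to the coalgebra structure of the other one. -/
structure IsHopfPairing [MonObj H] [ComonObj H] [MonObj K] [ComonObj K] (r : H ⊗ K ⟶ 𝟙_ D) :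
    Prop where
  mul_left : μ[H] ▷ K ≫ r = (H ⊗ H) ◁ Δ[K] ≫ nested r
  one_left : η[H] ▷ K ≫ r = (λ_ K).hom ≫ ε[K]
  mul_right : H ◁ μ[K] ≫ r = Δ[H] ▷ (K ⊗ K) ≫ nested r
  one_right : H ◁ η[K] ≫ r = (ρ_ H).hom ≫ ε[H]

end Pairing

section Actions

variable [BraidedCategory D] {H K : D}

section

variable [ComonObj H] {X Y : D}

/-- For a left action `p`, the morphism `h ⊗ x ↦ h₁ x ⊗ h₂`. -/
def leftThrough (p : H ⊗ X ⟶ X) : H ⊗ X ⟶ X ⊗ H :=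
  Δ[H] ▷ X ≫ (α_ H H X).hom ≫ H ◁ (β_ H X).hom ≫ (α_ H X H).inv ≫ p ▷ H

theorem leftThrough_eq (p : H ⊗ X ⟶ X) : leftThrough p =
    Δ[H] ▷ X ≫ (α_ H H X).hom ≫ H ◁ (β_ H X).hom ≫ (α_ H X H).inv ≫ p ▷ H := rfl

/-- For a left action `p`, the morphism `h ⊗ x ↦ h₁ ⊗ h₂ x`. -/
def leftHalf (p : H ⊗ X ⟶ X) : H ⊗ X ⟶ H ⊗ X :=
  Δ[H] ▷ X ≫ (α_ H H X).hom ≫ H ◁ p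

/-- The left action on a tensor product: `h ⊗ x ⊗ y ↦ h₁ x ⊗ h₂ y`. -/
def leftTensor (p : H ⊗ X ⟶ X) (p' : H ⊗ Y ⟶ Y) : H ⊗ (X ⊗ Y) ⟶ X ⊗ Y :=
  (α_ H X Y).inv ≫ leftThrough p ▷ Y ≫ (α_ X H Y).hom ≫ X ◁ p'

theorem leftTensor_eq (p : H ⊗ X ⟶ X) (p' : H ⊗ Y ⟶ Y) : leftTensor p p' =
    (α_ H X Y).inv ≫ leftThrough p ▷ Y ≫ (α_ X H Y).hom ≫ X ◁ p' := rfl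

end

section

variable [ComonObj K] {X Y : D}

/-- For a right action `q`, the morphism `x ⊗ k ↦ k₁ ⊗ x k₂`. -/
def rightThrough (q : X ⊗ K ⟶ X) : X ⊗ K ⟶ K ⊗ X :=
  X ◁ Δ[K] ≫ (α_ X K K).inv ≫ (β_ X K).hom ▷ K ≫ (α_ K X K).hom ≫ K ◁ q

theorem rightThrough_eq (q : X ⊗ K ⟶ X) : rightThrough q =
    X ◁ Δ[K] ≫ (α_ X K K).inv ≫ (β_ X K).hom ▷ K ≫ (α_ K X K).hom ≫ K ◁ q := rfl

/-- For a right action `q`, the morphism `x ⊗ k ↦ x k₁ ⊗ k₂`. -/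
def rightHalf (q : X ⊗ K ⟶ X) : X ⊗ K ⟶ X ⊗ K :=
  X ◁ Δ[K] ≫ (α_ X K K).inv ≫ q ▷ K

/-- The right action on a tensor product: `x ⊗ y ⊗ k ↦ x k₁ ⊗ y k₂`. -/
def rightTensor (q : X ⊗ K ⟶ X) (q' : Y ⊗ K ⟶ Y) : (X ⊗ Y) ⊗ K ⟶ X ⊗ Y :=
  (α_ X Y K).hom ≫ X ◁ rightThrough q' ≫ (α_ X K Y).inv ≫ q ▷ Y

theorem rightTensor_eq (q : X ⊗ K ⟶ X) (q' : Y ⊗ K ⟶ Y) : rightTensor q q' =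
    (α_ X Y K).hom ≫ X ◁ rightThrough q' ≫ (α_ X K Y).inv ≫ q ▷ Y := rfl

end

variable [ComonObj H] [ComonObj K] {X : D}

/-- One side of the Yetter-Drinfeld condition: first act with `k₁`, then with `h₁`, and pair `h₂`
with `k₂`. -/
def ydLeft (r : H ⊗ K ⟶ 𝟙_ D) (p : H ⊗ X ⟶ X) (q : X ⊗ K ⟶ X) : H ⊗ (X ⊗ K) ⟶ X :=
  H ◁ rightHalf q ≫ (α_ H X K).inv ≫ leftThrough p ▷ K ≫ (α_ X H K).hom ≫ X ◁ r ≫ (ρ_ X).hom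

/-- The other side of the Yetter-Drinfeld condition: first act with `h₂`, then with `k₂`, and pair
`h₁` with `k₁`. -/
def ydRight (r : H ⊗ K ⟶ 𝟙_ D) (p : H ⊗ X ⟶ X) (q : X ⊗ K ⟶ X) : H ⊗ (X ⊗ K) ⟶ X :=
  (α_ H X K).inv ≫ leftHalf p ▷ K ≫ (α_ H X K).hom ≫ H ◁ rightThrough q ≫ (α_ H K X).inv ≫
    r ▷ X ≫ (λ_ X).hom

section Left

variable {X Y Z : D}

theorem leftThrough_comul (p : H ⊗ X ⟶ X) : leftThrough p ≫ X ◁ Δ[H] =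
    Δ[H] ▷ X ≫ (α_ H H X).hom ≫ H ◁ (β_ H X).hom ≫ (α_ H X H).inv ≫ leftThrough p ▷ H ≫
      (α_ X H H).hom := by
  have h : Δ[H] ≫ H ◁ Δ[H] = Δ[H] ≫ Δ[H] ▷ H ≫ (α_ H H H).hom := ComonObj.comul_assoc H
  calc _ = Δ[H] ▷ X ≫ (α_ H H X).hom ≫ H ◁ (β_ H X).hom ≫ (α_ H X H).inv ≫
        (p ▷ H ≫ X ◁ Δ[H]) := by simp [leftThrough]
    _ = Δ[H] ▷ X ≫ (α_ H H X).hom ≫ H ◁ ((β_ H X).hom ≫ X ◁ Δ[H]) ≫ (α_ H X (H ⊗ H)).inv ≫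
        p ▷ (H ⊗ H) := by rw [← whisker_exchange]; monoidal
    _ = (Δ[H] ≫ H ◁ Δ[H]) ▷ X ≫ (α_ H (H ⊗ H) X).hom ≫ H ◁ (β_ (H ⊗ H) X).hom ≫
        (α_ H X (H ⊗ H)).inv ≫ p ▷ (H ⊗ H) := by
      rw [← BraidedCategory.braiding_naturality_left]; monoidal
    _ = 𝟙 _ ⊗≫ Δ[H] ▷ X ⊗≫ (Δ[H] ▷ (H ⊗ X) ≫ (H ⊗ H) ◁ (β_ H X).hom) ⊗≫
        (H ◁ (β_ H X).hom) ▷ H ⊗≫ p ▷ (H ⊗ H) ⊗≫ 𝟙 _ := by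
      rw [h, BraidedCategory.braiding_tensor_left_hom]; monoidal
    _ = _ := by rw [← whisker_exchange, leftThrough]; monoidal

theorem leftThrough_tensor (p : H ⊗ X ⟶ X) (p' : H ⊗ Y ⟶ Y) :
    leftThrough (leftTensor p p') = (α_ H X Y).inv ≫ leftThrough p ▷ Y ≫ (α_ X H Y).hom ≫
      X ◁ leftThrough p' ≫ (α_ X Y H).inv := by
  symm
  calc _ = 𝟙 _ ⊗≫ (leftThrough p ≫ X ◁ Δ[H]) ▷ Y ⊗≫ X ◁ H ◁ (β_ H Y).hom ⊗≫ X ◁ p' ▷ H ⊗≫ 𝟙 _ := by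
        rw [leftThrough_eq p']; monoidal
    _ = 𝟙 _ ⊗≫ Δ[H] ▷ X ▷ Y ⊗≫ H ◁ (β_ H X).hom ▷ Y ⊗≫ (leftThrough p ▷ (H ⊗ Y) ≫
        (X ⊗ H) ◁ (β_ H Y).hom) ⊗≫ X ◁ p' ▷ H ⊗≫ 𝟙 _ := by
      rw [leftThrough_comul]; monoidal
    _ = _ := by
      rw [← whisker_exchange, leftThrough_eq (leftTensor p p'), BraidedCategory.braiding_tensor_right_hom,
        leftTensor]
      monoidal

theorem leftThrough_naturality {p : H ⊗ X ⟶ X} {p' : H ⊗ Y ⟶ Y} (g : X ⟶ Y)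
    (e : H ◁ g ≫ p' = p ≫ g) : H ◁ g ≫ leftThrough p' = leftThrough p ≫ g ▷ H := by
  calc _ = (H ◁ g ≫ Δ[H] ▷ Y) ≫ (α_ H H Y).hom ≫ H ◁ (β_ H Y).hom ≫ (α_ H Y H).inv ≫
        p' ▷ H := by simp [leftThrough]
    _ = Δ[H] ▷ X ≫ (α_ H H X).hom ≫ H ◁ (H ◁ g ≫ (β_ H Y).hom) ≫ (α_ H Y H).inv ≫
        p' ▷ H := by rw [whisker_exchange]; monoidal
    _ = Δ[H] ▷ X ≫ (α_ H H X).hom ≫ H ◁ (β_ H X).hom ≫ (α_ H X H).inv ≫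
        (H ◁ g ≫ p') ▷ H := by rw [BraidedCategory.braiding_naturality_right]; monoidal
    _ = _ := by rw [e, leftThrough]; monoidal

theorem leftTensor_naturality {X' Y' : D} {p : H ⊗ X ⟶ X} {p₁ : H ⊗ X' ⟶ X'} {p' : H ⊗ Y ⟶ Y}
    {p₁' : H ⊗ Y' ⟶ Y'} (g : X ⟶ X') (h : Y ⟶ Y') (e : H ◁ g ≫ p₁ = p ≫ g)
    (e' : H ◁ h ≫ p₁' = p' ≫ h) :
    H ◁ (g ⊗ₘ h) ≫ leftTensor p₁ p₁' = leftTensor p p' ≫ (g ⊗ₘ h) := by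
  calc _ = (α_ H X Y).inv ≫ (H ⊗ X) ◁ h ≫ (H ◁ g ≫ leftThrough p₁) ▷ Y' ≫
        (α_ X' H Y').hom ≫ X' ◁ p₁' := by
        rw [MonoidalCategory.tensorHom_def', leftTensor]; monoidal
    _ = (α_ H X Y).inv ≫ ((H ⊗ X) ◁ h ≫ leftThrough p ▷ Y') ≫ g ▷ H ▷ Y' ≫
        (α_ X' H Y').hom ≫ X' ◁ p₁' := by
        rw [leftThrough_naturality g e]; monoidal
    _ = (α_ H X Y).inv ≫ leftThrough p ▷ Y ≫ ((X ⊗ H) ◁ h ≫ g ▷ H ▷ Y') ≫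
        (α_ X' H Y').hom ≫ X' ◁ p₁' := by
        rw [whisker_exchange]; monoidal
    _ = (α_ H X Y).inv ≫ leftThrough p ▷ Y ≫ (α_ X H Y).hom ≫ g ▷ (H ⊗ Y) ≫
        X' ◁ (H ◁ h ≫ p₁') := by
        rw [whisker_exchange]; monoidal
    _ = (α_ H X Y).inv ≫ leftThrough p ▷ Y ≫ (α_ X H Y).hom ≫ (g ▷ (H ⊗ Y) ≫
        X' ◁ p') ≫ X' ◁ h := by
        rw [e']; monoidal
    _ = _ := by
        rw [← whisker_exchange, leftTensor, MonoidalCategory.tensorHom_def]; monoidal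

theorem leftTensor_associator (p : H ⊗ X ⟶ X) (p' : H ⊗ Y ⟶ Y) (p'' : H ⊗ Z ⟶ Z) :
    H ◁ (α_ X Y Z).hom ≫ leftTensor p (leftTensor p' p'') =
      leftTensor (leftTensor p p') p'' ≫ (α_ X Y Z).hom := by
  rw [leftTensor_eq (leftTensor p p'), leftThrough_tensor, leftTensor, leftTensor]
  monoidal

theorem leftTensor_unit_left (p : H ⊗ X ⟶ X) :
    H ◁ (λ_ X).hom ≫ p = leftTensor ((ρ_ H).hom ≫ ε[H]) p ≫ (λ_ X).hom := by
  symm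
  calc _ = 𝟙 _ ⊗≫ (Δ[H] ▷ 𝟙_ D ≫ (α_ _ _ _).hom ≫ H ◁ (β_ H (𝟙_ D)).hom ≫
      (α_ _ _ _).inv ≫ (ρ_ H).hom ▷ H ≫ ε[H] ▷ H) ▷ X ⊗≫ p := by
        rw [leftTensor, leftThrough]; monoidal
    _ = 𝟙 _ ⊗≫ (Δ[H] ≫ ε[H] ▷ H) ▷ X ⊗≫ p := by
        rw [braiding_tensorUnit_right]; monoidal
    _ = _ := by rw [ComonObj.counit_comul]; monoidal

theorem leftTensor_unit_right (p : H ⊗ X ⟶ X) :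
    H ◁ (ρ_ X).hom ≫ p = leftTensor p ((ρ_ H).hom ≫ ε[H]) ≫ (ρ_ X).hom := by
  symm
  calc _ = 𝟙 _ ⊗≫ Δ[H] ▷ X ⊗≫ H ◁ (β_ H X).hom ⊗≫ (p ▷ H ≫ X ◁ ε[H]) ⊗≫ 𝟙 _ := by
        rw [leftTensor, leftThrough]; monoidal
    _ = 𝟙 _ ⊗≫ Δ[H] ▷ X ⊗≫ H ◁ ((β_ H X).hom ≫ X ◁ ε[H]) ⊗≫ p ⊗≫ 𝟙 _ := by
        rw [← whisker_exchange]; monoidal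
    _ = 𝟙 _ ⊗≫ (Δ[H] ≫ H ◁ ε[H]) ▷ X ⊗≫ p ⊗≫ 𝟙 _ := by
        rw [← BraidedCategory.braiding_naturality_left, braiding_tensorUnit_left]; monoidal
    _ = _ := by rw [ComonObj.comul_counit]; monoidal

end Left

section Right

variable {X Y Z : D}

theorem rightThrough_comul (q : X ⊗ K ⟶ X) : rightThrough q ≫ Δ[K] ▷ X =
    X ◁ Δ[K] ≫ (α_ X K K).inv ≫ (β_ X K).hom ▷ K ≫ (α_ K X K).hom ≫ K ◁ rightThrough q ≫
      (α_ K K X).inv := by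
  have h : Δ[K] ≫ Δ[K] ▷ K = Δ[K] ≫ K ◁ Δ[K] ≫ (α_ K K K).inv :=
    ComonObj.comul_assoc_flip K
  calc _ = X ◁ Δ[K] ≫ (α_ X K K).inv ≫ (β_ X K).hom ▷ K ≫ (α_ K X K).hom ≫
        (K ◁ q ≫ Δ[K] ▷ X) := by simp [rightThrough]
    _ = X ◁ Δ[K] ≫ (α_ X K K).inv ≫ ((β_ X K).hom ≫ Δ[K] ▷ X) ▷ K ≫ (α_ (K ⊗ K) X K).hom ≫
        (K ⊗ K) ◁ q := by rw [whisker_exchange]; monoidal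
    _ = X ◁ (Δ[K] ≫ Δ[K] ▷ K) ≫ (α_ X (K ⊗ K) K).inv ≫ (β_ X (K ⊗ K)).hom ▷ K ≫
        (α_ (K ⊗ K) X K).hom ≫ (K ⊗ K) ◁ q := by
      rw [← BraidedCategory.braiding_naturality_right]; monoidal
    _ = 𝟙 _ ⊗≫ X ◁ Δ[K] ⊗≫ ((X ⊗ K) ◁ Δ[K] ≫ (β_ X K).hom ▷ (K ⊗ K)) ⊗≫
        K ◁ (β_ X K).hom ▷ K ⊗≫ (K ⊗ K) ◁ q ⊗≫ 𝟙 _ := by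
      rw [h, BraidedCategory.braiding_tensor_right_hom]; monoidal
    _ = _ := by rw [whisker_exchange, rightThrough]; monoidal

theorem rightThrough_tensor (q : X ⊗ K ⟶ X) (q' : Y ⊗ K ⟶ Y) :
    rightThrough (rightTensor q q') = (α_ X Y K).hom ≫ X ◁ rightThrough q' ≫ (α_ X K Y).inv ≫
      rightThrough q ▷ Y ≫ (α_ K X Y).hom := by
  symm
  calc _ = 𝟙 _ ⊗≫ X ◁ (rightThrough q' ≫ Δ[K] ▷ Y) ⊗≫ (β_ X K).hom ▷ K ▷ Y ⊗≫
        K ◁ q ▷ Y ⊗≫ 𝟙 _ := by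
        rw [rightThrough_eq q]; monoidal
    _ = 𝟙 _ ⊗≫ X ◁ Y ◁ Δ[K] ⊗≫ X ◁ (β_ Y K).hom ▷ K ⊗≫ ((X ⊗ K) ◁ rightThrough q' ≫
        (β_ X K).hom ▷ (K ⊗ Y)) ⊗≫ K ◁ q ▷ Y ⊗≫ 𝟙 _ := by
      rw [rightThrough_comul]; monoidal
    _ = _ := by
      rw [whisker_exchange, rightThrough_eq (rightTensor q q'),
        BraidedCategory.braiding_tensor_left_hom, rightTensor]
      monoidal

theorem rightThrough_naturality {q : X ⊗ K ⟶ X} {q' : Y ⊗ K ⟶ Y} (g : X ⟶ Y)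
    (e : g ▷ K ≫ q' = q ≫ g) : g ▷ K ≫ rightThrough q' = rightThrough q ≫ K ◁ g := by
  calc _ = (g ▷ K ≫ Y ◁ Δ[K]) ≫ (α_ Y K K).inv ≫ (β_ Y K).hom ▷ K ≫ (α_ K Y K).hom ≫
        K ◁ q' := by simp [rightThrough]
    _ = X ◁ Δ[K] ≫ (α_ X K K).inv ≫ (g ▷ K ≫ (β_ Y K).hom) ▷ K ≫ (α_ K Y K).hom ≫
        K ◁ q' := by rw [← whisker_exchange]; monoidal
    _ = X ◁ Δ[K] ≫ (α_ X K K).inv ≫ (β_ X K).hom ▷ K ≫ (α_ K X K).hom ≫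
        K ◁ (g ▷ K ≫ q') := by rw [BraidedCategory.braiding_naturality_left]; monoidal
    _ = _ := by rw [e, rightThrough]; monoidal

theorem rightTensor_naturality {X' Y' : D} {q : X ⊗ K ⟶ X} {q₁ : X' ⊗ K ⟶ X'} {q' : Y ⊗ K ⟶ Y}
    {q₁' : Y' ⊗ K ⟶ Y'} (g : X ⟶ X') (h : Y ⟶ Y') (e : g ▷ K ≫ q₁ = q ≫ g)
    (e' : h ▷ K ≫ q₁' = q' ≫ h) :
    (g ⊗ₘ h) ▷ K ≫ rightTensor q₁ q₁' = rightTensor q q' ≫ (g ⊗ₘ h) := by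
  calc _ = (α_ X Y K).hom ≫ g ▷ (Y ⊗ K) ≫ X' ◁ (h ▷ K ≫ rightThrough q₁') ≫
        (α_ X' K Y').inv ≫ q₁ ▷ Y' := by
        rw [MonoidalCategory.tensorHom_def, rightTensor]; monoidal
    _ = (α_ X Y K).hom ≫ (g ▷ (Y ⊗ K) ≫ X' ◁ rightThrough q') ≫ X' ◁ K ◁ h ≫
        (α_ X' K Y').inv ≫ q₁ ▷ Y' := by
        rw [rightThrough_naturality h e']; monoidal
    _ = (α_ X Y K).hom ≫ X ◁ rightThrough q' ≫ (g ▷ (K ⊗ Y) ≫ X' ◁ K ◁ h) ≫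
        (α_ X' K Y').inv ≫ q₁ ▷ Y' := by
        rw [← whisker_exchange]; monoidal
    _ = (α_ X Y K).hom ≫ X ◁ rightThrough q' ≫ X ◁ K ◁ h ≫
        (α_ X K Y').inv ≫ (g ▷ K ≫ q₁) ▷ Y' := by
        rw [← whisker_exchange]; monoidal
    _ = (α_ X Y K).hom ≫ X ◁ rightThrough q' ≫ (α_ X K Y).inv ≫ ((X ⊗ K) ◁ h ≫
        q ▷ Y') ≫ g ▷ Y' := by
        rw [e]; monoidal
    _ = _ := by
        rw [whisker_exchange, rightTensor, MonoidalCategory.tensorHom_def']; monoidal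

theorem rightTensor_associator (q : X ⊗ K ⟶ X) (q' : Y ⊗ K ⟶ Y) (q'' : Z ⊗ K ⟶ Z) :
    (α_ X Y Z).hom ▷ K ≫ rightTensor q (rightTensor q' q'') =
      rightTensor (rightTensor q q') q'' ≫ (α_ X Y Z).hom := by
  rw [rightTensor_eq q, rightThrough_tensor, rightTensor, rightTensor]
  monoidal

theorem rightTensor_unit_right (q : X ⊗ K ⟶ X) :
    (ρ_ X).hom ▷ K ≫ q = rightTensor q ((λ_ K).hom ≫ ε[K]) ≫ (ρ_ X).hom := by
  symm
  calc _ = 𝟙 _ ⊗≫ X ◁ (𝟙_ D ◁ Δ[K] ≫ (α_ _ _ _).inv ≫ (β_ (𝟙_ D) K).hom ▷ K ≫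
      (α_ _ _ _).hom ≫ K ◁ (λ_ K).hom ≫ K ◁ ε[K]) ⊗≫ q := by
        rw [rightTensor, rightThrough]; monoidal
    _ = 𝟙 _ ⊗≫ X ◁ (Δ[K] ≫ K ◁ ε[K]) ⊗≫ q := by
        rw [braiding_tensorUnit_left]; monoidal
    _ = _ := by rw [ComonObj.comul_counit]; monoidal

theorem rightTensor_unit_left (q : X ⊗ K ⟶ X) :
    (λ_ X).hom ▷ K ≫ q = rightTensor ((λ_ K).hom ≫ ε[K]) q ≫ (λ_ X).hom := by
  symm
  calc _ = 𝟙 _ ⊗≫ X ◁ Δ[K] ⊗≫ (β_ X K).hom ▷ K ⊗≫ (K ◁ q ≫ ε[K] ▷ X) ⊗≫ 𝟙 _ := by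
        rw [rightTensor, rightThrough]; monoidal
    _ = 𝟙 _ ⊗≫ X ◁ Δ[K] ⊗≫ ((β_ X K).hom ≫ ε[K] ▷ X) ▷ K ⊗≫ q ⊗≫ 𝟙 _ := by
        rw [whisker_exchange]; monoidal
    _ = 𝟙 _ ⊗≫ X ◁ (Δ[K] ≫ ε[K] ▷ K) ⊗≫ q ⊗≫ 𝟙 _ := by
        rw [← BraidedCategory.braiding_naturality_right, braiding_tensorUnit_right]; monoidal
    _ = _ := by rw [ComonObj.counit_comul]; monoidal

end Right

section Condition

variable {X Y : D}

theorem ydLeft_unit (r : H ⊗ K ⟶ 𝟙_ D) :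
    ydLeft r ((ρ_ H).hom ≫ ε[H]) ((λ_ K).hom ≫ ε[K]) = H ◁ (λ_ K).hom ≫ r := by
  calc _ = 𝟙 _ ⊗≫ H ◁ (Δ[K] ≫ ε[K] ▷ K) ⊗≫ (Δ[H] ▷ 𝟙_ D ≫ (α_ _ _ _).hom ≫
      H ◁ (β_ H (𝟙_ D)).hom ≫ (α_ _ _ _).inv ≫ (ρ_ H).hom ▷ H ≫ ε[H] ▷ H) ▷ K ⊗≫ r := by
        rw [ydLeft, rightHalf, leftThrough]; monoidal
    _ = 𝟙 _ ⊗≫ (Δ[H] ≫ ε[H] ▷ H) ▷ K ⊗≫ r := by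
        rw [ComonObj.counit_comul, braiding_tensorUnit_right]; monoidal
    _ = _ := by rw [ComonObj.counit_comul]; monoidal

theorem ydRight_unit (r : H ⊗ K ⟶ 𝟙_ D) :
    ydRight r ((ρ_ H).hom ≫ ε[H]) ((λ_ K).hom ≫ ε[K]) = H ◁ (λ_ K).hom ≫ r := by
  calc _ = 𝟙 _ ⊗≫ (Δ[H] ≫ H ◁ ε[H]) ▷ K ⊗≫ H ◁ (𝟙_ D ◁ Δ[K] ≫ (α_ _ _ _).inv ≫
      (β_ (𝟙_ D) K).hom ▷ K ≫ (α_ _ _ _).hom ≫ K ◁ (λ_ K).hom ≫ K ◁ ε[K]) ⊗≫ r := by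
        rw [ydRight, leftHalf, rightThrough]; monoidal
    _ = 𝟙 _ ⊗≫ H ◁ (Δ[K] ≫ K ◁ ε[K]) ⊗≫ r := by
        rw [ComonObj.comul_counit, braiding_tensorUnit_left]; monoidal
    _ = _ := by rw [ComonObj.comul_counit]; monoidal

theorem rightHalf_tensor (q : X ⊗ K ⟶ X) (q' : Y ⊗ K ⟶ Y) :
    rightHalf (rightTensor q q') = (α_ X Y K).hom ≫ X ◁ (Y ◁ Δ[K] ≫ (α_ Y K K).inv ≫
      (β_ Y K).hom ▷ K ≫ (α_ K Y K).hom) ≫ (α_ X K (Y ⊗ K)).inv ≫ q ▷ (Y ⊗ K) ≫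
      X ◁ rightHalf q' ≫ (α_ X Y K).inv := by
  have h : Δ[K] ≫ Δ[K] ▷ K = Δ[K] ≫ K ◁ Δ[K] ≫ (α_ K K K).inv :=
    ComonObj.comul_assoc_flip K
  calc _ = 𝟙 _ ⊗≫ X ◁ Y ◁ (Δ[K] ≫ Δ[K] ▷ K) ⊗≫ X ◁ (β_ Y K).hom ▷ K ▷ K ⊗≫
        ((X ⊗ K) ◁ q' ≫ q ▷ Y) ▷ K ⊗≫ 𝟙 _ := by
        rw [rightHalf, rightTensor, rightThrough]; monoidal
    _ = 𝟙 _ ⊗≫ X ◁ Y ◁ Δ[K] ⊗≫ X ◁ ((Y ⊗ K) ◁ Δ[K] ≫ (β_ Y K).hom ▷ (K ⊗ K)) ⊗≫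
        q ▷ (Y ⊗ K ⊗ K) ⊗≫ X ◁ q' ▷ K ⊗≫ 𝟙 _ := by
        rw [whisker_exchange, h]; monoidal
    _ = 𝟙 _ ⊗≫ X ◁ Y ◁ Δ[K] ⊗≫ X ◁ (β_ Y K).hom ▷ K ⊗≫
        ((X ⊗ K) ◁ (Y ◁ Δ[K]) ≫ q ▷ (Y ⊗ K ⊗ K)) ⊗≫ X ◁ q' ▷ K ⊗≫ 𝟙 _ := by
        rw [whisker_exchange]; monoidal
    _ = _ := by
        rw [whisker_exchange, rightHalf]; monoidal

theorem leftHalf_tensor (p : H ⊗ X ⟶ X) (p' : H ⊗ Y ⟶ Y) :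
    leftHalf (leftTensor p p') = (α_ H X Y).inv ≫ (Δ[H] ▷ X ≫ (α_ H H X).hom ≫
      H ◁ (β_ H X).hom ≫ (α_ H X H).inv) ▷ Y ≫ (α_ (H ⊗ X) H Y).hom ≫ (H ⊗ X) ◁ p' ≫
      leftHalf p ▷ Y ≫ (α_ H X Y).hom := by
  have h : Δ[H] ≫ H ◁ Δ[H] = Δ[H] ≫ Δ[H] ▷ H ≫ (α_ H H H).hom := ComonObj.comul_assoc H
  calc _ = 𝟙 _ ⊗≫ (Δ[H] ≫ H ◁ Δ[H]) ▷ X ▷ Y ⊗≫ H ◁ H ◁ (β_ H X).hom ▷ Y ⊗≫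
        H ◁ (p ▷ (H ⊗ Y) ≫ X ◁ p') ⊗≫ 𝟙 _ := by
        rw [leftHalf, leftTensor, leftThrough]; monoidal
    _ = 𝟙 _ ⊗≫ Δ[H] ▷ X ▷ Y ⊗≫ (Δ[H] ▷ (H ⊗ X) ≫ (H ⊗ H) ◁ (β_ H X).hom) ▷ Y ⊗≫
        (H ⊗ H ⊗ X) ◁ p' ⊗≫ H ◁ p ▷ Y ⊗≫ 𝟙 _ := by
        rw [← whisker_exchange, h]; monoidal
    _ = 𝟙 _ ⊗≫ Δ[H] ▷ X ▷ Y ⊗≫ H ◁ (β_ H X).hom ▷ Y ⊗≫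
        ((Δ[H] ▷ X) ▷ (H ⊗ Y) ≫ ((H ⊗ H) ⊗ X) ◁ p') ⊗≫ H ◁ p ▷ Y ⊗≫ 𝟙 _ := by
        rw [← whisker_exchange]; monoidal
    _ = _ := by
        rw [← whisker_exchange, leftHalf]; monoidal

theorem ydLeft_tensor (r : H ⊗ K ⟶ 𝟙_ D) (p : H ⊗ X ⟶ X) (q : X ⊗ K ⟶ X) (p' : H ⊗ Y ⟶ Y)
    (q' : Y ⊗ K ⟶ Y) : ydLeft r (leftTensor p p') (rightTensor q q') =
    H ◁ ((α_ X Y K).hom ≫ X ◁ (Y ◁ Δ[K] ≫ (α_ Y K K).inv ≫ (β_ Y K).hom ▷ K ≫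
      (α_ K Y K).hom) ≫ (α_ X K (Y ⊗ K)).inv ≫ q ▷ (Y ⊗ K)) ≫ (α_ H X (Y ⊗ K)).inv ≫
      leftThrough p ▷ (Y ⊗ K) ≫ (α_ X H (Y ⊗ K)).hom ≫ X ◁ ydLeft r p' q' := by
  calc _ = 𝟙 _ ⊗≫ H ◁ ((α_ X Y K).hom ≫ X ◁ (Y ◁ Δ[K] ≫ (α_ Y K K).inv ≫ (β_ Y K).hom ▷ K ≫
        (α_ K Y K).hom) ≫ (α_ X K (Y ⊗ K)).inv ≫ q ▷ (Y ⊗ K)) ⊗≫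
        ((H ⊗ X) ◁ rightHalf q' ≫ leftThrough p ▷ (Y ⊗ K)) ⊗≫ X ◁ leftThrough p' ▷ K ⊗≫
        X ◁ Y ◁ r ⊗≫ 𝟙 _ := by
        rw [ydLeft, rightHalf_tensor, leftThrough_tensor]; monoidal
    _ = _ := by rw [whisker_exchange, ydLeft]; monoidal

theorem ydRight_tensor (r : H ⊗ K ⟶ 𝟙_ D) (p : H ⊗ X ⟶ X) (q : X ⊗ K ⟶ X) (p' : H ⊗ Y ⟶ Y)
    (q' : Y ⊗ K ⟶ Y) : ydRight r (leftTensor p p') (rightTensor q q') =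
    (α_ H (X ⊗ Y) K).inv ≫ ((α_ H X Y).inv ≫ (Δ[H] ▷ X ≫ (α_ H H X).hom ≫ H ◁ (β_ H X).hom ≫
      (α_ H X H).inv) ▷ Y ≫ (α_ (H ⊗ X) H Y).hom ≫ (H ⊗ X) ◁ p') ▷ K ≫
      (α_ (H ⊗ X) Y K).hom ≫ (H ⊗ X) ◁ rightThrough q' ≫ (α_ (H ⊗ X) K Y).inv ≫
      (α_ H X K).hom ▷ Y ≫ ydRight r p q ▷ Y := by
  calc _ = 𝟙 _ ⊗≫ ((α_ H X Y).inv ≫ (Δ[H] ▷ X ≫ (α_ H H X).hom ≫ H ◁ (β_ H X).hom ≫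
        (α_ H X H).inv) ▷ Y ≫ (α_ (H ⊗ X) H Y).hom ≫ (H ⊗ X) ◁ p') ▷ K ⊗≫
        (leftHalf p ▷ (Y ⊗ K) ≫ (H ⊗ X) ◁ rightThrough q') ⊗≫ H ◁ rightThrough q ▷ Y ⊗≫
        r ▷ X ▷ Y ⊗≫ 𝟙 _ := by
        rw [ydRight, leftHalf_tensor, rightThrough_tensor]; monoidal
    _ = _ := by rw [← whisker_exchange, ydRight]; monoidal

theorem act_leftThrough (q : X ⊗ K ⟶ X) :
    H ◁ q ≫ Δ[H] ▷ X ≫ (α_ H H X).hom ≫ H ◁ (β_ H X).hom ≫ (α_ H X H).inv =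
      (α_ H X K).inv ≫ (Δ[H] ▷ X ≫ (α_ H H X).hom ≫ H ◁ (β_ H X).hom ≫ (α_ H X H).inv) ▷ K ≫
        (α_ (H ⊗ X) H K).hom ≫ (H ⊗ X) ◁ (β_ H K).hom ≫ (α_ (H ⊗ X) K H).inv ≫
        ((α_ H X K).hom ≫ H ◁ q) ▷ H := by
  calc _ = Δ[H] ▷ (X ⊗ K) ≫ (α_ H H (X ⊗ K)).hom ≫ H ◁ (H ◁ q ≫ (β_ H X).hom) ≫
        (α_ H X H).inv := by
        rw [whisker_exchange_assoc]; monoidal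
    _ = _ := by
        rw [BraidedCategory.braiding_naturality_right, BraidedCategory.braiding_tensor_right_hom]
        monoidal

theorem act_rightThrough (p : H ⊗ Y ⟶ Y) :
    p ▷ K ≫ Y ◁ Δ[K] ≫ (α_ Y K K).inv ≫ (β_ Y K).hom ▷ K ≫ (α_ K Y K).hom =
      (α_ H Y K).hom ≫ H ◁ (Y ◁ Δ[K] ≫ (α_ Y K K).inv ≫ (β_ Y K).hom ▷ K ≫ (α_ K Y K).hom) ≫
        (α_ H K (Y ⊗ K)).inv ≫ (β_ H K).hom ▷ (Y ⊗ K) ≫ (α_ K H (Y ⊗ K)).hom ≫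
        K ◁ ((α_ H Y K).inv ≫ p ▷ K) := by
  calc _ = (H ⊗ Y) ◁ Δ[K] ≫ (α_ (H ⊗ Y) K K).inv ≫ (p ▷ K ≫ (β_ Y K).hom) ▷ K ≫
        (α_ K Y K).hom := by
        rw [← whisker_exchange_assoc]; monoidal
    _ = _ := by
        rw [BraidedCategory.braiding_naturality_left, BraidedCategory.braiding_tensor_left_hom]
        monoidal

theorem yd_middle (r : H ⊗ K ⟶ 𝟙_ D) (p : H ⊗ X ⟶ X) (q : X ⊗ K ⟶ X) (p' : H ⊗ Y ⟶ Y)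
    (q' : Y ⊗ K ⟶ Y) :
    H ◁ ((α_ X Y K).hom ≫ X ◁ (Y ◁ Δ[K] ≫ (α_ Y K K).inv ≫ (β_ Y K).hom ▷ K ≫
      (α_ K Y K).hom) ≫ (α_ X K (Y ⊗ K)).inv ≫ q ▷ (Y ⊗ K)) ≫ (α_ H X (Y ⊗ K)).inv ≫
      leftThrough p ▷ (Y ⊗ K) ≫ (α_ X H (Y ⊗ K)).hom ≫ X ◁ ydRight r p' q' =
    (α_ H (X ⊗ Y) K).inv ≫ ((α_ H X Y).inv ≫ (Δ[H] ▷ X ≫ (α_ H H X).hom ≫ H ◁ (β_ H X).hom ≫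
      (α_ H X H).inv) ▷ Y ≫ (α_ (H ⊗ X) H Y).hom ≫ (H ⊗ X) ◁ p') ▷ K ≫
      (α_ (H ⊗ X) Y K).hom ≫ (H ⊗ X) ◁ rightThrough q' ≫ (α_ (H ⊗ X) K Y).inv ≫
      (α_ H X K).hom ▷ Y ≫ ydLeft r p q ▷ Y := by
  have hU := act_leftThrough (H := H) q
  have hV := act_rightThrough (K := K) p'
  have hU' := leftThrough_comul p
  have hV' := rightThrough_comul q'
  obtain ⟨U, hU0⟩ : ∃ U, U = Δ[H] ▷ X ≫ (α_ H H X).hom ≫ H ◁ (β_ H X).hom ≫ (α_ H X H).inv :=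
    ⟨_, rfl⟩
  obtain ⟨V, hV0⟩ : ∃ V, V = Y ◁ Δ[K] ≫ (α_ Y K K).inv ≫ (β_ Y K).hom ▷ K ≫ (α_ K Y K).hom :=
    ⟨_, rfl⟩
  have hU'' : leftThrough p ≫ X ◁ Δ[H] = U ≫ leftThrough p ▷ H ≫ (α_ X H H).hom := by
    rw [hU', hU0]; simp only [Category.assoc]
  have hV'' : rightThrough q' ≫ Δ[K] ▷ Y = V ≫ K ◁ rightThrough q' ≫ (α_ K K Y).inv := by
    rw [hV', hV0]; simp only [Category.assoc]
  rw [← hU0] at hU ⊢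
  rw [← hV0] at hV ⊢
  calc _ = 𝟙 _ ⊗≫ H ◁ X ◁ V ⊗≫ H ◁ q ▷ (Y ⊗ K) ⊗≫ (leftThrough p ≫ X ◁ Δ[H]) ▷ (Y ⊗ K) ⊗≫
        X ◁ H ◁ p' ▷ K ⊗≫ X ◁ H ◁ rightThrough q' ⊗≫ X ◁ r ▷ Y ⊗≫ 𝟙 _ := by
        rw [ydRight, leftHalf]; monoidal
    _ = 𝟙 _ ⊗≫ H ◁ X ◁ V ⊗≫ (H ◁ q ≫ U) ▷ (Y ⊗ K) ⊗≫ (leftThrough p ▷ (H ⊗ (Y ⊗ K)) ≫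
        (X ⊗ H) ◁ ((α_ H Y K).inv ≫ p' ▷ K ≫ rightThrough q')) ⊗≫ X ◁ r ▷ Y ⊗≫ 𝟙 _ := by
        rw [hU'']; monoidal
    _ = 𝟙 _ ⊗≫ H ◁ X ◁ V ⊗≫ U ▷ (K ⊗ (Y ⊗ K)) ⊗≫ (H ⊗ X) ◁ (β_ H K).hom ▷ (Y ⊗ K) ⊗≫
        ((H ◁ q) ▷ (H ⊗ (Y ⊗ K)) ≫ (H ⊗ X) ◁ ((α_ H Y K).inv ≫ p' ▷ K ≫ rightThrough q')) ⊗≫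
        leftThrough p ▷ (K ⊗ Y) ⊗≫ X ◁ r ▷ Y ⊗≫ 𝟙 _ := by
        rw [← whisker_exchange, hU0, act_leftThrough, ← hU0]; monoidal
    _ = 𝟙 _ ⊗≫ ((H ⊗ X) ◁ V ≫ U ▷ (K ⊗ (Y ⊗ K))) ⊗≫ (H ⊗ X) ◁ (β_ H K).hom ▷ (Y ⊗ K) ⊗≫
        (H ⊗ (X ⊗ K)) ◁ ((α_ H Y K).inv ≫ p' ▷ K ≫ rightThrough q') ⊗≫ H ◁ q ▷ (K ⊗ Y) ⊗≫
        leftThrough p ▷ (K ⊗ Y) ⊗≫ X ◁ r ▷ Y ⊗≫ 𝟙 _ := by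
        rw [← whisker_exchange]; monoidal
    _ = 𝟙 _ ⊗≫ U ▷ (Y ⊗ K) ⊗≫ (H ⊗ X) ◁ (p' ▷ K ≫ V) ⊗≫ (H ⊗ (X ⊗ K)) ◁ rightThrough q' ⊗≫
        H ◁ q ▷ (K ⊗ Y) ⊗≫ leftThrough p ▷ (K ⊗ Y) ⊗≫ X ◁ r ▷ Y ⊗≫ 𝟙 _ := by
        rw [whisker_exchange, hV0, act_rightThrough, ← hV0]; monoidal
    _ = 𝟙 _ ⊗≫ U ▷ (Y ⊗ K) ⊗≫ (H ⊗ X) ◁ (p' ▷ K) ⊗≫ (H ⊗ X) ◁ (rightThrough q' ≫ Δ[K] ▷ Y) ⊗≫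
        H ◁ q ▷ (K ⊗ Y) ⊗≫ leftThrough p ▷ (K ⊗ Y) ⊗≫ X ◁ r ▷ Y ⊗≫ 𝟙 _ := by
        rw [hV'']; monoidal
    _ = _ := by
        rw [ydLeft, rightHalf]; monoidal

theorem yd_tensor (r : H ⊗ K ⟶ 𝟙_ D) {p : H ⊗ X ⟶ X} {q : X ⊗ K ⟶ X} {p' : H ⊗ Y ⟶ Y}
    {q' : Y ⊗ K ⟶ Y} (e : ydLeft r p q = ydRight r p q) (e' : ydLeft r p' q' = ydRight r p' q') :
    ydLeft r (leftTensor p p') (rightTensor q q') =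
      ydRight r (leftTensor p p') (rightTensor q q') := by
  rw [ydLeft_tensor, ydRight_tensor, e', yd_middle, e]

end Condition

end Actions

section Modules

variable [BraidedCategory D] {H K X Y : D} [BimonObj H] [BimonObj K]

theorem one_leftThrough {p : H ⊗ X ⟶ X} (e : η[H] ▷ X ≫ p = (λ_ X).hom) :
    η[H] ▷ X ≫ leftThrough p = (λ_ X).hom ≫ (ρ_ X).inv ≫ X ◁ η[H] := by
  have h : η[H] ≫ Δ[H] = (λ_ (𝟙_ D)).inv ≫ 𝟙_ D ◁ η[H] ≫ η[H] ▷ H := by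
    have h' : η[H] ≫ Δ[H] = (λ_ (𝟙_ D)).inv ≫ (η[H] ⊗ₘ η[H]) := BimonObj.one_comul H
    rw [h', MonoidalCategory.tensorHom_def']
  calc _ = (η[H] ≫ Δ[H]) ▷ X ≫ (α_ H H X).hom ≫ H ◁ (β_ H X).hom ≫ (α_ H X H).inv ≫ p ▷ H := by
        rw [leftThrough]; monoidal
    _ = 𝟙 _ ⊗≫ 𝟙_ D ◁ η[H] ▷ X ⊗≫ (η[H] ▷ (H ⊗ X) ≫ H ◁ (β_ H X).hom) ⊗≫ p ▷ H := by
        rw [h]; monoidal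
    _ = 𝟙 _ ⊗≫ 𝟙_ D ◁ (η[H] ▷ X ≫ (β_ H X).hom) ⊗≫ (η[H] ▷ X ≫ p) ▷ H := by
        rw [← whisker_exchange]; monoidal
    _ = _ := by
        rw [e, BraidedCategory.braiding_naturality_left, braiding_tensorUnit_left]; monoidal

theorem mul_leftThrough {p : H ⊗ X ⟶ X} (e : μ[H] ▷ X ≫ p = (α_ H H X).hom ≫ H ◁ p ≫ p) :
    μ[H] ▷ X ≫ leftThrough p = (α_ H H X).hom ≫ H ◁ leftThrough p ≫ (α_ H X H).inv ≫
      leftThrough p ▷ H ≫ (α_ X H H).hom ≫ X ◁ μ[H] := by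
  have h : μ[H] ≫ Δ[H] = (Δ[H] ⊗ₘ Δ[H]) ≫ tensorμ H H H H ≫ (μ[H] ⊗ₘ μ[H]) :=
    BimonObj.mul_comul H
  calc _ = (μ[H] ≫ Δ[H]) ▷ X ≫ (α_ H H X).hom ≫ H ◁ (β_ H X).hom ≫ (α_ H X H).inv ≫ p ▷ H := by
        rw [leftThrough]; monoidal
    _ = 𝟙 _ ⊗≫ (H ◁ Δ[H] ≫ Δ[H] ▷ (H ⊗ H)) ▷ X ⊗≫ H ◁ (β_ H H).hom ▷ H ▷ X ⊗≫
        μ[H] ▷ (H ⊗ H ⊗ X) ⊗≫ H ◁ (μ[H] ▷ X ≫ (β_ H X).hom) ⊗≫ p ▷ H := by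
        rw [h, tensorμ, MonoidalCategory.tensorHom_def', MonoidalCategory.tensorHom_def]; monoidal
    _ = 𝟙 _ ⊗≫ (H ◁ Δ[H] ≫ Δ[H] ▷ (H ⊗ H)) ▷ X ⊗≫ H ◁ (β_ H H).hom ▷ H ▷ X ⊗≫
        (μ[H] ▷ (H ⊗ H ⊗ X) ≫ H ◁ (𝟙 _ ⊗≫ H ◁ (β_ H X).hom ⊗≫ (β_ H X).hom ▷ H ⊗≫ X ◁ μ[H])) ⊗≫
          p ▷ H := by
        rw [BraidedCategory.braiding_naturality_left, BraidedCategory.braiding_tensor_left_hom]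
        monoidal
    _ = 𝟙 _ ⊗≫ (H ◁ Δ[H] ≫ Δ[H] ▷ (H ⊗ H)) ▷ X ⊗≫ H ◁ (β_ H H).hom ▷ H ▷ X ⊗≫
        (H ⊗ H ⊗ H) ◁ (β_ H X).hom ⊗≫ (H ⊗ H) ◁ (β_ H X).hom ▷ H ⊗≫
        (((H ⊗ H) ⊗ X) ◁ μ[H] ≫ (μ[H] ▷ X ≫ p) ▷ H) := by
        rw [← whisker_exchange]; monoidal
    _ = 𝟙 _ ⊗≫ (H ◁ Δ[H] ≫ Δ[H] ▷ (H ⊗ H)) ▷ X ⊗≫ H ◁ ((β_ H H).hom ▷ (H ⊗ X) ≫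
        (H ⊗ H) ◁ (β_ H X).hom) ⊗≫ (H ⊗ H) ◁ (β_ H X).hom ▷ H ⊗≫
        (H ◁ p ≫ p) ▷ (H ⊗ H) ⊗≫ X ◁ μ[H] := by
        rw [whisker_exchange (μ[H] ▷ X ≫ p) μ[H], e]; monoidal
    _ = 𝟙 _ ⊗≫ H ◁ Δ[H] ▷ X ⊗≫ (Δ[H] ▷ (H ⊗ (H ⊗ X)) ≫ (H ⊗ H) ◁ (H ◁ (β_ H X).hom)) ⊗≫
        H ◁ ((β_ H H).hom ▷ X ⊗≫ H ◁ (β_ H X).hom ⊗≫ p ▷ H) ▷ H ⊗≫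
        p ▷ (H ⊗ H) ⊗≫ X ◁ μ[H] := by
        rw [← whisker_exchange]; monoidal
    _ = 𝟙 _ ⊗≫ H ◁ Δ[H] ▷ X ⊗≫ H ◁ H ◁ (β_ H X).hom ⊗≫ Δ[H] ▷ (H ⊗ (X ⊗ H)) ⊗≫
        H ◁ (H ◁ p ≫ (β_ H X).hom) ▷ H ⊗≫
        p ▷ (H ⊗ H) ⊗≫ X ◁ μ[H] := by
        rw [← whisker_exchange, BraidedCategory.braiding_naturality_right,
          BraidedCategory.braiding_tensor_right_hom]; monoidal
    _ = 𝟙 _ ⊗≫ H ◁ Δ[H] ▷ X ⊗≫ H ◁ H ◁ (β_ H X).hom ⊗≫ (Δ[H] ▷ (H ⊗ X) ≫ (H ⊗ H) ◁ p) ▷ H ⊗≫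
        H ◁ (β_ H X).hom ▷ H ⊗≫
        p ▷ (H ⊗ H) ⊗≫ X ◁ μ[H] := by
        monoidal
    _ = _ := by
        rw [← whisker_exchange, leftThrough]; monoidal

theorem one_leftTensor {p : H ⊗ X ⟶ X} {p' : H ⊗ Y ⟶ Y} (e : η[H] ▷ X ≫ p = (λ_ X).hom)
    (e' : η[H] ▷ Y ≫ p' = (λ_ Y).hom) : η[H] ▷ (X ⊗ Y) ≫ leftTensor p p' = (λ_ (X ⊗ Y)).hom := by
  calc _ = 𝟙 _ ⊗≫ (η[H] ▷ X ≫ leftThrough p) ▷ Y ⊗≫ X ◁ p' := by rw [leftTensor]; monoidal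
    _ = 𝟙 _ ⊗≫ X ◁ (η[H] ▷ Y ≫ p') := by rw [one_leftThrough e]; monoidal
    _ = _ := by rw [e']; monoidal

theorem mul_leftTensor {p : H ⊗ X ⟶ X} {p' : H ⊗ Y ⟶ Y}
    (e : μ[H] ▷ X ≫ p = (α_ H H X).hom ≫ H ◁ p ≫ p)
    (e' : μ[H] ▷ Y ≫ p' = (α_ H H Y).hom ≫ H ◁ p' ≫ p') :
    μ[H] ▷ (X ⊗ Y) ≫ leftTensor p p' =
      (α_ H H (X ⊗ Y)).hom ≫ H ◁ leftTensor p p' ≫ leftTensor p p' := by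
  calc _ = 𝟙 _ ⊗≫ (μ[H] ▷ X ≫ leftThrough p) ▷ Y ⊗≫ X ◁ p' := by rw [leftTensor]; monoidal
    _ = 𝟙 _ ⊗≫ H ◁ leftThrough p ▷ Y ⊗≫ leftThrough p ▷ H ▷ Y ⊗≫ X ◁ (μ[H] ▷ Y ≫ p') := by
      rw [mul_leftThrough e]; monoidal
    _ = 𝟙 _ ⊗≫ H ◁ leftThrough p ▷ Y ⊗≫ (leftThrough p ▷ (H ⊗ Y) ≫ (X ⊗ H) ◁ p') ⊗≫ X ◁ p' := by
      rw [e']; monoidal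
    _ = _ := by rw [← whisker_exchange, leftTensor]; monoidal

theorem one_rightThrough {q : X ⊗ K ⟶ X} (e : X ◁ η[K] ≫ q = (ρ_ X).hom) :
    X ◁ η[K] ≫ rightThrough q = (ρ_ X).hom ≫ (λ_ X).inv ≫ η[K] ▷ X := by
  have h : η[K] ≫ Δ[K] = (λ_ (𝟙_ D)).inv ≫ η[K] ▷ 𝟙_ D ≫ K ◁ η[K] := by
    have h' : η[K] ≫ Δ[K] = (λ_ (𝟙_ D)).inv ≫ (η[K] ⊗ₘ η[K]) := BimonObj.one_comul K
    rw [h', MonoidalCategory.tensorHom_def]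
  calc _ = X ◁ (η[K] ≫ Δ[K]) ≫ (α_ X K K).inv ≫ (β_ X K).hom ▷ K ≫ (α_ K X K).hom ≫ K ◁ q := by
        rw [rightThrough]; monoidal
    _ = 𝟙 _ ⊗≫ X ◁ η[K] ▷ 𝟙_ D ⊗≫ ((X ⊗ K) ◁ η[K] ≫ (β_ X K).hom ▷ K) ⊗≫ K ◁ q := by
        rw [h]; monoidal
    _ = 𝟙 _ ⊗≫ (X ◁ η[K] ≫ (β_ X K).hom) ▷ 𝟙_ D ⊗≫ K ◁ (X ◁ η[K] ≫ q) := by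
        rw [whisker_exchange]; monoidal
    _ = _ := by
        rw [e, BraidedCategory.braiding_naturality_right, braiding_tensorUnit_right]; monoidal

theorem mul_rightThrough {q : X ⊗ K ⟶ X} (e : X ◁ μ[K] ≫ q = (α_ X K K).inv ≫ q ▷ K ≫ q) :
    X ◁ μ[K] ≫ rightThrough q = (α_ X K K).inv ≫ rightThrough q ▷ K ≫ (α_ K X K).hom ≫
      K ◁ rightThrough q ≫ (α_ K K X).inv ≫ μ[K] ▷ X := by
  have h : μ[K] ≫ Δ[K] = (Δ[K] ⊗ₘ Δ[K]) ≫ tensorμ K K K K ≫ (μ[K] ⊗ₘ μ[K]) :=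
    BimonObj.mul_comul K
  calc _ = X ◁ (μ[K] ≫ Δ[K]) ≫ (α_ X K K).inv ≫ (β_ X K).hom ▷ K ≫ (α_ K X K).hom ≫ K ◁ q := by
        rw [rightThrough]; monoidal
    _ = 𝟙 _ ⊗≫ X ◁ (Δ[K] ▷ K ≫ (K ⊗ K) ◁ Δ[K]) ⊗≫ X ◁ K ◁ (β_ K K).hom ▷ K ⊗≫
        (X ⊗ (K ⊗ K)) ◁ μ[K] ⊗≫ (X ◁ μ[K] ≫ (β_ X K).hom) ▷ K ⊗≫ K ◁ q := by
        rw [h, tensorμ, MonoidalCategory.tensorHom_def, MonoidalCategory.tensorHom_def']; monoidal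
    _ = 𝟙 _ ⊗≫ X ◁ (Δ[K] ▷ K ≫ (K ⊗ K) ◁ Δ[K]) ⊗≫ X ◁ K ◁ (β_ K K).hom ▷ K ⊗≫
        ((X ⊗ (K ⊗ K)) ◁ μ[K] ≫ (𝟙 _ ⊗≫ (β_ X K).hom ▷ K ⊗≫ K ◁ (β_ X K).hom ⊗≫ μ[K] ▷ X) ▷ K) ⊗≫
          K ◁ q := by
        rw [BraidedCategory.braiding_naturality_right, BraidedCategory.braiding_tensor_right_hom]
        monoidal
    _ = 𝟙 _ ⊗≫ X ◁ (Δ[K] ▷ K ≫ (K ⊗ K) ◁ Δ[K]) ⊗≫ X ◁ K ◁ (β_ K K).hom ▷ K ⊗≫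
        (β_ X K).hom ▷ (K ⊗ K ⊗ K) ⊗≫ K ◁ (β_ X K).hom ▷ (K ⊗ K) ⊗≫
        (μ[K] ▷ (X ⊗ (K ⊗ K)) ≫ K ◁ (X ◁ μ[K] ≫ q)) := by
        rw [whisker_exchange]; monoidal
    _ = 𝟙 _ ⊗≫ X ◁ (Δ[K] ▷ K ≫ (K ⊗ K) ◁ Δ[K]) ⊗≫ ((X ⊗ K) ◁ (β_ K K).hom ≫
        (β_ X K).hom ▷ (K ⊗ K)) ▷ K ⊗≫ K ◁ (β_ X K).hom ▷ (K ⊗ K) ⊗≫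
        (K ⊗ K) ◁ (q ▷ K ≫ q) ⊗≫ μ[K] ▷ X := by
        rw [← whisker_exchange μ[K] (X ◁ μ[K] ≫ q), e]; monoidal
    _ = 𝟙 _ ⊗≫ X ◁ Δ[K] ▷ K ⊗≫ (((X ⊗ K) ⊗ K) ◁ Δ[K] ≫ ((β_ X K).hom ▷ K) ▷ (K ⊗ K)) ⊗≫
        K ◁ (X ◁ (β_ K K).hom ⊗≫ (β_ X K).hom ▷ K ⊗≫ K ◁ q) ▷ K ⊗≫
        (K ⊗ K) ◁ q ⊗≫ μ[K] ▷ X := by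
        rw [whisker_exchange (β_ X K).hom (β_ K K).hom]; monoidal
    _ = 𝟙 _ ⊗≫ X ◁ Δ[K] ▷ K ⊗≫ (β_ X K).hom ▷ K ▷ K ⊗≫ (K ⊗ X ⊗ K) ◁ Δ[K] ⊗≫
        K ◁ (q ▷ K ≫ (β_ X K).hom) ▷ K ⊗≫ (K ⊗ K) ◁ q ⊗≫ μ[K] ▷ X := by
        rw [whisker_exchange, BraidedCategory.braiding_naturality_left,
          BraidedCategory.braiding_tensor_left_hom]; monoidal
    _ = 𝟙 _ ⊗≫ X ◁ Δ[K] ▷ K ⊗≫ (β_ X K).hom ▷ K ▷ K ⊗≫ K ◁ ((X ⊗ K) ◁ Δ[K] ≫ q ▷ (K ⊗ K)) ⊗≫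
        K ◁ (β_ X K).hom ▷ K ⊗≫ (K ⊗ K) ◁ q ⊗≫ μ[K] ▷ X := by
        monoidal
    _ = _ := by
        rw [whisker_exchange, rightThrough]; monoidal

theorem one_rightTensor {q : X ⊗ K ⟶ X} {q' : Y ⊗ K ⟶ Y} (e : X ◁ η[K] ≫ q = (ρ_ X).hom)
    (e' : Y ◁ η[K] ≫ q' = (ρ_ Y).hom) : (X ⊗ Y) ◁ η[K] ≫ rightTensor q q' = (ρ_ (X ⊗ Y)).hom := by
  calc _ = 𝟙 _ ⊗≫ X ◁ (Y ◁ η[K] ≫ rightThrough q') ⊗≫ q ▷ Y := by rw [rightTensor]; monoidal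
    _ = 𝟙 _ ⊗≫ (X ◁ η[K] ≫ q) ▷ Y := by rw [one_rightThrough e']; monoidal
    _ = _ := by rw [e]; monoidal

theorem mul_rightTensor {q : X ⊗ K ⟶ X} {q' : Y ⊗ K ⟶ Y}
    (e : X ◁ μ[K] ≫ q = (α_ X K K).inv ≫ q ▷ K ≫ q)
    (e' : Y ◁ μ[K] ≫ q' = (α_ Y K K).inv ≫ q' ▷ K ≫ q') :
    (X ⊗ Y) ◁ μ[K] ≫ rightTensor q q' =
      (α_ (X ⊗ Y) K K).inv ≫ rightTensor q q' ▷ K ≫ rightTensor q q' := by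
  calc _ = 𝟙 _ ⊗≫ X ◁ (Y ◁ μ[K] ≫ rightThrough q') ⊗≫ q ▷ Y := by rw [rightTensor]; monoidal
    _ = 𝟙 _ ⊗≫ X ◁ rightThrough q' ▷ K ⊗≫ X ◁ K ◁ rightThrough q' ⊗≫ (X ◁ μ[K] ≫ q) ▷ Y := by
      rw [mul_rightThrough e']; monoidal
    _ = 𝟙 _ ⊗≫ X ◁ rightThrough q' ▷ K ⊗≫ ((X ⊗ K) ◁ rightThrough q' ≫ q ▷ (K ⊗ Y)) ⊗≫
        q ▷ Y := by
      rw [e]; monoidal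
    _ = _ := by rw [whisker_exchange, rightTensor]; monoidal

end Modules

section Category

variable [BraidedCategory D] {H K : D} [BimonObj H] [BimonObj K]

/-- A Yetter-Drinfeld module with respect to a pairing of two bialgebras `H` and `K`: an object with
a left action of `H` and a right action of `K` that satisfy the Yetter-Drinfeld condition. -/
structure YD (r : H ⊗ K ⟶ 𝟙_ D) where
  X : D
  actl : H ⊗ X ⟶ X
  actr : X ⊗ K ⟶ X
  one_actl : η[H] ▷ X ≫ actl = (λ_ X).hom
  mul_actl : μ[H] ▷ X ≫ actl = (α_ H H X).hom ≫ H ◁ actl ≫ actl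
  one_actr : X ◁ η[K] ≫ actr = (ρ_ X).hom
  mul_actr : X ◁ μ[K] ≫ actr = (α_ X K K).inv ≫ actr ▷ K ≫ actr
  condition : ydLeft r actl actr = ydRight r actl actr

namespace YD

variable {r : H ⊗ K ⟶ 𝟙_ D}

/-- A morphism of Yetter-Drinfeld modules: a morphism in `D` compatible with both actions. -/
@[ext]
structure Hom (M N : YD r) where
  f : M.X ⟶ N.X
  left : H ◁ f ≫ N.actl = M.actl ≫ f
  right : f ▷ K ≫ N.actr = M.actr ≫ f

instance : Category (YD r) where
  Hom M N := Hom M N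
  id M := ⟨𝟙 M.X, by simp, by simp⟩
  comp g h := ⟨g.f ≫ h.f, by
    rw [MonoidalCategory.whiskerLeft_comp, Category.assoc, h.left, ← Category.assoc, g.left,
      Category.assoc], by
    rw [comp_whiskerRight, Category.assoc, h.right, ← Category.assoc, g.right, Category.assoc]⟩

@[ext]
theorem hom_ext {M N : YD r} {g h : M ⟶ N} (e : g.f = h.f) : g = h := Hom.ext e

@[simp] theorem id_f (M : YD r) : Hom.f (𝟙 M) = 𝟙 M.X := rfl

@[simp] theorem comp_f {M N L : YD r} (g : M ⟶ N) (h : N ⟶ L) : (g ≫ h).f = g.f ≫ h.f := rfl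

/-- An isomorphism in `D` compatible with both actions is an isomorphism of Yetter-Drinfeld
modules. -/
def mkIso {M N : YD r} (e : M.X ≅ N.X) (h : H ◁ e.hom ≫ N.actl = M.actl ≫ e.hom)
    (k : e.hom ▷ K ≫ N.actr = M.actr ≫ e.hom) : M ≅ N where
  hom := ⟨e.hom, h, k⟩
  inv := ⟨e.inv, by
    rw [← cancel_mono e.hom, Category.assoc, Category.assoc, ← h,
      ← MonoidalCategory.whiskerLeft_comp_assoc]
    simp, by
    rw [← cancel_mono e.hom, Category.assoc, Category.assoc, ← k, ← comp_whiskerRight_assoc]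
    simp⟩

/-- The tensor product of two Yetter-Drinfeld modules. -/
def tensor (M N : YD r) : YD r where
  X := M.X ⊗ N.X
  actl := leftTensor M.actl N.actl
  actr := rightTensor M.actr N.actr
  one_actl := one_leftTensor M.one_actl N.one_actl
  mul_actl := mul_leftTensor M.mul_actl N.mul_actl
  one_actr := one_rightTensor M.one_actr N.one_actr
  mul_actr := mul_rightTensor M.mul_actr N.mul_actr
  condition := yd_tensor r M.condition N.condition

variable (r) in
/-- The unit object, on which `H` and `K` act through their counits. -/
def trivial : YD r where
  X := 𝟙_ D
  actl := (ρ_ H).hom ≫ ε[H]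
  actr := (λ_ K).hom ≫ ε[K]
  one_actl := by
    rw [rightUnitor_naturality_assoc, BimonObj.one_counit, unitors_equal, Category.comp_id]
  mul_actl := by
    have h : μ[H] ≫ ε[H] = (ε[H] ⊗ₘ ε[H]) ≫ (λ_ (𝟙_ D)).hom := BimonObj.mul_counit H
    rw [rightUnitor_naturality_assoc, h, MonoidalCategory.tensorHom_def']
    monoidal
  one_actr := by
    rw [leftUnitor_naturality_assoc, BimonObj.one_counit, unitors_equal, Category.comp_id]
  mul_actr := by
    have h : μ[K] ≫ ε[K] = (ε[K] ⊗ₘ ε[K]) ≫ (λ_ (𝟙_ D)).hom := BimonObj.mul_counit K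
    rw [leftUnitor_naturality_assoc, h, MonoidalCategory.tensorHom_def]
    monoidal
  condition := (ydLeft_unit r).trans (ydRight_unit r).symm

/-- The tensor product of two morphisms. -/
def tensorMap {M M' N N' : YD r} (g : M ⟶ M') (h : N ⟶ N') : tensor M N ⟶ tensor M' N' where
  f := g.f ⊗ₘ h.f
  left := leftTensor_naturality g.f h.f g.left h.left
  right := rightTensor_naturality g.f h.f g.right h.right

instance : MonoidalCategoryStruct (YD r) where
  tensorObj M N := tensor M N
  tensorUnit := trivial r
  whiskerLeft M _ _ g := tensorMap (𝟙 M) g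
  whiskerRight g N := tensorMap g (𝟙 N)
  tensorHom g h := tensorMap g h
  associator M N L := mkIso (α_ M.X N.X L.X) (leftTensor_associator M.actl N.actl L.actl)
    (rightTensor_associator M.actr N.actr L.actr)
  leftUnitor M := mkIso (λ_ M.X) (leftTensor_unit_left M.actl) (rightTensor_unit_left M.actr)
  rightUnitor M := mkIso (ρ_ M.X) (leftTensor_unit_right M.actl) (rightTensor_unit_right M.actr)

/-- Yetter-Drinfeld modules form a monoidal category, with the associators and unit isomorphisms
of `D`. -/
instance : MonoidalCategory (YD r) := MonoidalCategory.ofTensorHom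
  (id_tensorHom_id := fun M N => hom_ext (id_tensorHom_id M.X N.X))
  (tensorHom_comp_tensorHom := fun g h g' h' =>
    hom_ext (tensorHom_comp_tensorHom g.f h.f g'.f h'.f))
  (associator_naturality := fun g h k => hom_ext (associator_naturality g.f h.f k.f))
  (leftUnitor_naturality := fun g => hom_ext (by
    exact (congrArg (· ≫ _) (id_tensorHom _ _)).trans (leftUnitor_naturality g.f)))
  (rightUnitor_naturality := fun g => hom_ext (by
    exact (congrArg (· ≫ _) (tensorHom_id _ _)).trans (rightUnitor_naturality g.f)))
  (pentagon := fun M N L P => hom_ext (by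
    have h := pentagon M.X N.X L.X P.X
    rw [← tensorHom_id, ← id_tensorHom] at h
    exact h))
  (triangle := fun M N => hom_ext (by
    have h := triangle M.X N.X
    rw [← tensorHom_id, ← id_tensorHom] at h
    exact h))

end YD

end Category

end YetterDrinfeld

/-! ### From Yetter-Drinfeld modules over tensor algebras to `D_F` -/

section Comparison

variable {D : Type u} [Category.{v} D] [MonoidalCategory D] [HasCountableCoproducts D]
  [∀ X : D, PreservesColimitsOfShape (Discrete ℕ) (tensorLeft X)]
  [∀ X : D, PreservesColimitsOfShape (Discrete ℕ) (tensorRight X)]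
  [BraidedCategory D] [Preadditive D] [MonoidalPreadditive D]

/-- A pairing of tensor algebras is degree preserving if it vanishes on elements of different
degrees. -/
def DegreePreserving {A B : D} (r : T A ⊗ T B ⟶ 𝟙_ D) : Prop :=
  ∀ n m : ℕ, n ≠ m → (T.incl A n ⊗ₘ T.incl B m) ≫ r = 0

variable [HasBinaryBiproducts D] {A B : D}

/-- The functor sending a Yetter-Drinfeld module `(X, m₊, m₋)` to the object of `D_F` whose
structure morphism is `m₊ ∘ (ι ⊗ id)` on `A ⊗ X` and `m₋ ∘ (id ⊗ ι) ∘ c_{X,B}⁻¹` on `B ⊗ X`. It is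
the identity on morphisms. -/
noncomputable def toPert (r : T A ⊗ T B ⟶ 𝟙_ D) :
    YD r ⥤ Pert (centreSum (plusLift A) (minusLift B)) where
  obj M :=
    { X := M.X
      m := (biprod.fst : A ⊞ B ⟶ A) ▷ M.X ≫ T.gen A ▷ M.X ≫ M.actl +
        (biprod.snd : A ⊞ B ⟶ B) ▷ M.X ≫ (β_ M.X B).inv ≫ M.X ◁ T.gen B ≫ M.actr }
  map {M N} g :=
    { f := g.f
      comm := by
        change (A ⊞ B) ◁ g.f ≫ (_ + _) = (_ + _) ≫ g.f
        have e : B ◁ g.f ≫ (β_ N.X B).inv = (β_ M.X B).inv ≫ g.f ▷ B := by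
          rw [Iso.comp_inv_eq, Category.assoc, BraidedCategory.braiding_naturality_left,
            Iso.inv_hom_id_assoc]
        have h₁ : (A ⊞ B) ◁ g.f ≫ (biprod.fst : A ⊞ B ⟶ A) ▷ N.X ≫ T.gen A ▷ N.X ≫ N.actl =
            (biprod.fst : A ⊞ B ⟶ A) ▷ M.X ≫ T.gen A ▷ M.X ≫ M.actl ≫ g.f := by
          rw [whisker_exchange_assoc, whisker_exchange_assoc, g.left]
        have h₂ : (A ⊞ B) ◁ g.f ≫ (biprod.snd : A ⊞ B ⟶ B) ▷ N.X ≫ (β_ N.X B).inv ≫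
            N.X ◁ T.gen B ≫ N.actr = (biprod.snd : A ⊞ B ⟶ B) ▷ M.X ≫ (β_ M.X B).inv ≫
            M.X ◁ T.gen B ≫ M.actr ≫ g.f := by
          rw [whisker_exchange_assoc, reassoc_of% e, ← whisker_exchange_assoc, g.right]
        rw [Preadditive.comp_add, Preadditive.add_comp, h₁, h₂]
        simp only [Category.assoc] }

/-- The commutation condition in `D_F` for `F = (A, c_{A,-}) ⊕ (B, c_{-,B}⁻¹)`, in a braided
category `D`. -/
def braidedCommutation (b : A ⊗ B ⟶ 𝟙_ D) :
    ObjectProperty (Pert (centreSum (plusLift A) (minusLift B))) :=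
  commutation (A := plusLift A) (B := minusLift B) b

instance (b : A ⊗ B ⟶ 𝟙_ D) : (braidedCommutation b).IsMonoidal where
  prop_unit := commutation_unit (A := plusLift A) (B := minusLift B) b
  prop_tensor _ _ h₁ h₂ := commutation_tensor (A := plusLift A) (B := minusLift B) b h₁ h₂

/-- The functor `toPert` with values in the full subcategory of the objects which satisfy the
commutation condition, for a pairing for which it takes values there. -/
noncomputable def toCommutation (r : T A ⊗ T B ⟶ 𝟙_ D) (b : A ⊗ B ⟶ 𝟙_ D)
    (h : ∀ M : YD r, braidedCommutation b ((toPert r).obj M)) :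
    YD r ⥤ (braidedCommutation b).FullSubcategory :=
  (braidedCommutation b).lift (toPert r) h

end Comparison

end TensorYD

open TensorYD

/-! Write `H = T(F⁺)` and `K = T(F⁻)`. For a pairing `g : V ⊗ K ⟶ 𝟙`, its contraction is `v ⊗ k ↦
g(v, k₁) k₂`. The first axiom of a Hopf pairing says `ρ(hh', k) = ρ(h, ρ(h', k₁) k₂)`: a product in
`H` contracts with its right factor first and then pairs with its left factor. So `ρ` is determined
by `ρ(1, -) = ε` and by its restriction to `F⁺ ⊗ K`. Generators are primitive, so the second axiom
makes this restriction a derivation with respect to `ε`, which forces it to be the extension of `b`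
by zero (`genPairing`). This gives uniqueness (`IsHopfPairing.eq_pairing`).

For existence, let `δ` be the contraction with `genPairing b` and define `ρ` by the recursion `ρ(1,
k) = ε(k)`, `ρ(ha, k) = ρ(h, δ(a, k))` for a generator `a`. The first axiom is an induction on the
right factor of the product (`mul_pairing`). The second one holds because `δ` is a braided
derivation (`mul_contract`), so that both sides obey one and the same recursion (`pairing_mul`). As
`δ` lowers the degree by one and `ε` lives in degree zero, `ρ` preserves degrees.

An action of a tensor algebra is the same as an arbitrary action of its generators, so on objects
only the Yetter-Drinfeld condition has to be compared with the commutation condition. The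
Yetter-Drinfeld condition passes to products in either algebra (`yd_mul_left`, `yd_mul_right`). A
product in `K` forces a coproduct on the argument in `H`, which must therefore range over a
subcoalgebra; `𝟙 ⊕ F⁺` is one. Hence the condition spreads from the generators first to all of `K`,
then to all of `H` (`yd_of_gen`). For primitive arguments it reduces to the two composites of the
actions plus two terms with `b`, and after moving `F⁻` past `X` by the inverse braiding this is the
commutation condition (`yd_gen_iff`).

Primitivity also gives the action of a generator on `X ⊗ Y`: it acts on `X`, or crosses `X` and acts
on `Y`. The crossing is `c` for `F⁺` and, once the right action is rewritten as a left one, `c⁻¹`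
for `F⁻`; these are the half-braidings of `F` (`gen_leftTensor`, `gen_rightTensor`). So the
comparison functor preserves tensor products and unit on the nose, and its inverse inherits a
monoidal structure. -/

namespace TensorYD

/-! ### Recursion for morphisms out of `T(F) ⊗ Y` -/

section TensorAlgebraLeft

variable {D : Type u} [Category.{v} D] [MonoidalCategory D] [HasCountableCoproducts D]

namespace T

variable (F : D)
variable [∀ X : D, PreservesColimitsOfShape (Discrete ℕ) (tensorLeft X)]
  [∀ X : D, PreservesColimitsOfShape (Discrete ℕ) (tensorRight X)]

/-- Two morphisms out of `Y ⊗ T(F)` agree if they agree on the unit and on all products with a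
generator. -/
theorem cases_ext {Y Z : D} {g h : Y ⊗ T F ⟶ Z} (e : Y ◁ unit F ≫ g = Y ◁ unit F ≫ h)
    (e' : Y ◁ shift F ≫ g = Y ◁ shift F ≫ h) : g = h := by
  apply left_ext
  rintro (_ | n)
  · exact e
  · change Y ◁ (inclSucc F n) ≫ g = Y ◁ (inclSucc F n) ≫ h
    rw [← incl_shift, MonoidalCategory.whiskerLeft_comp_assoc,
      MonoidalCategory.whiskerLeft_comp_assoc, e']

/-- Two morphisms out of `W ⊗ (T(F) ⊗ Y)` which agree in degree zero and satisfy the same recursion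
agree. -/
theorem middle_free_ext {W Y Z : D} (s : F ⊗ Y ⟶ Y) {g h : W ⊗ (T F ⊗ Y) ⟶ Z}
    (e : W ◁ unit F ▷ Y ≫ g = W ◁ unit F ▷ Y ≫ h)
    (hg : W ◁ shift F ▷ Y ≫ g = W ◁ (α_ (T F) F Y).hom ≫ W ◁ T F ◁ s ≫ g)
    (hh : W ◁ shift F ▷ Y ≫ h = W ◁ (α_ (T F) F Y).hom ≫ W ◁ T F ◁ s ≫ h) : g = h := by
  apply middle_ext
  intro n
  induction n with
  | zero => exact e
  | succ n ih =>
    -- The recursion lets the last generator of degree `n + 1` act on `Y`; what remains is the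
    -- morphism in degree `n`.
    have key : ∀ g : W ⊗ (T F ⊗ Y) ⟶ Z,
        W ◁ shift F ▷ Y ≫ g = W ◁ (α_ (T F) F Y).hom ≫ W ◁ T F ◁ s ≫ g →
        W ◁ inclSucc F n ▷ Y ≫ g = W ◁ (α_ (tensorPow F n) F Y).hom ≫ W ◁ tensorPow F n ◁ s ≫
          W ◁ incl F n ▷ Y ≫ g := by
      intro g hg
      rw [← incl_shift, comp_whiskerRight, MonoidalCategory.whiskerLeft_comp_assoc, hg,
        ← MonoidalCategory.whiskerLeft_comp_assoc, ← MonoidalCategory.whiskerLeft_comp_assoc,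
        associator_naturality_left, Category.assoc, ← whisker_exchange]
      simp
    change W ◁ inclSucc F n ▷ Y ≫ g = W ◁ inclSucc F n ▷ Y ≫ h
    rw [key g hg, key h hh, ih]

/-- Two morphisms out of `T(F) ⊗ Y` which agree in degree zero and satisfy the same recursion
agree. -/
theorem left_free_ext {Y Z : D} (s : F ⊗ Y ⟶ Y) {g h : T F ⊗ Y ⟶ Z}
    (e : unit F ▷ Y ≫ g = unit F ▷ Y ≫ h)
    (hg : shift F ▷ Y ≫ g = (α_ (T F) F Y).hom ≫ T F ◁ s ≫ g)
    (hh : shift F ▷ Y ≫ h = (α_ (T F) F Y).hom ≫ T F ◁ s ≫ h) : g = h := by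
  -- Inserting a unit object on the left makes this the case `W = 𝟙` of `middle_free_ext`.
  rw [← cancel_epi (λ_ (T F ⊗ Y)).hom]
  refine middle_free_ext F s ?_ ?_ ?_
  · simp only [leftUnitor_naturality_assoc, e]
  · simp only [leftUnitor_naturality_assoc, hg]
  · simp only [leftUnitor_naturality_assoc, hh]

/-- The components of `extendLeft`. -/
def extendLeftAux {Y Z : D} (s : F ⊗ Y ⟶ Y) (z : Y ⟶ Z) : ∀ n, tensorPow F n ⊗ Y ⟶ Z
  | 0 => (λ_ Y).hom ≫ z
  | n + 1 => (α_ (tensorPow F n) F Y).hom ≫ tensorPow F n ◁ s ≫ extendLeftAux s z n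

/-- The morphism `T(F) ⊗ Y ⟶ Z` which lets the generators act on `Y` through `s`, the last one
first, and then applies `z`. -/
noncomputable def extendLeft {Y Z : D} (s : F ⊗ Y ⟶ Y) (z : Y ⟶ Z) : T F ⊗ Y ⟶ Z :=
  (right_exists F (extendLeftAux F s z)).choose

theorem incl_extendLeft {Y Z : D} (s : F ⊗ Y ⟶ Y) (z : Y ⟶ Z) (n : ℕ) :
    incl F n ▷ Y ≫ extendLeft F s z = extendLeftAux F s z n :=
  (right_exists F (extendLeftAux F s z)).choose_spec n

theorem unit_extendLeft {Y Z : D} (s : F ⊗ Y ⟶ Y) (z : Y ⟶ Z) :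
    unit F ▷ Y ≫ extendLeft F s z = (λ_ Y).hom ≫ z :=
  incl_extendLeft F s z 0

/-- The recursion without reference to degrees. Together with `unit_extendLeft` it characterises
`extendLeft`, by `left_free_ext`. -/
theorem shift_extendLeft {Y Z : D} (s : F ⊗ Y ⟶ Y) (z : Y ⟶ Z) :
    shift F ▷ Y ≫ extendLeft F s z =
      (α_ (T F) F Y).hom ≫ T F ◁ s ≫ extendLeft F s z := by
  rw [← Iso.inv_comp_eq]
  apply right_ext
  intro n
  rw [associator_inv_naturality_left_assoc, ← comp_whiskerRight_assoc, incl_shift,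
    ← whisker_exchange_assoc, incl_extendLeft, Iso.inv_comp_eq]
  exact incl_extendLeft F s z (n + 1)

end T

end TensorAlgebraLeft

/-! ### Contraction with a pairing -/

section Contract

open MonObj ComonObj

variable {D : Type u} [Category.{v} D] [MonoidalCategory D]

section

variable {K V : D} [ComonObj K]

/-- For a pairing `g`, the morphism `v ⊗ k ↦ g(v, k₁) k₂`. -/
def contract (g : V ⊗ K ⟶ 𝟙_ D) : V ⊗ K ⟶ K :=
  V ◁ Δ[K] ≫ (α_ V K K).inv ≫ g ▷ K ≫ (λ_ K).hom

theorem whiskerRight_contract {W : D} (f : W ⟶ V) (g : V ⊗ K ⟶ 𝟙_ D) :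
    f ▷ K ≫ contract g = contract (f ▷ K ≫ g) := by
  rw [contract, contract, ← whisker_exchange_assoc]
  monoidal

/-- Turns the first axiom of a Hopf pairing into a statement about contractions, in which products
can be treated by iteration. -/
theorem comul_nested {H : D} (g : H ⊗ K ⟶ 𝟙_ D) :
    (H ⊗ H) ◁ Δ[K] ≫ nested g = (α_ H H K).hom ≫ H ◁ contract g ≫ g := by
  rw [nested, contract]
  monoidal

/-- The counit removes the factor `k₂` left over by the contraction, so no information on `g` is
lost. -/
theorem contract_counit (g : V ⊗ K ⟶ 𝟙_ D) : contract g ≫ ε[K] = g := by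
  calc _ = 𝟙 _ ⊗≫ V ◁ Δ[K] ⊗≫ (g ▷ K ≫ 𝟙_ D ◁ ε[K]) ⊗≫ 𝟙 _ := by
        rw [contract]; monoidal
    _ = 𝟙 _ ⊗≫ V ◁ (Δ[K] ≫ K ◁ ε[K]) ⊗≫ g := by rw [← whisker_exchange]; monoidal
    _ = _ := by rw [ComonObj.comul_counit]; monoidal

/-- Contracting with a composite of a contraction and a pairing. -/
theorem contract_contract {W : D} (g : V ⊗ K ⟶ 𝟙_ D) (g' : W ⊗ K ⟶ 𝟙_ D) :
    W ◁ contract g ≫ contract g' = (α_ W V K).inv ≫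
      contract ((α_ W V K).hom ≫ W ◁ contract g ≫ g') := by
  have h : Δ[K] ≫ K ◁ Δ[K] = Δ[K] ≫ Δ[K] ▷ K ≫ (α_ K K K).hom := ComonObj.comul_assoc K
  calc _ = 𝟙 _ ⊗≫ W ◁ V ◁ Δ[K] ⊗≫ W ◁ (g ▷ K ≫ 𝟙_ D ◁ Δ[K]) ⊗≫ g' ▷ K ⊗≫ 𝟙 _ := by
        rw [contract, contract]; monoidal
    _ = 𝟙 _ ⊗≫ W ◁ V ◁ (Δ[K] ≫ K ◁ Δ[K]) ⊗≫ W ◁ g ▷ (K ⊗ K) ⊗≫ g' ▷ K ⊗≫ 𝟙 _ := by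
        rw [← whisker_exchange]; monoidal
    _ = _ := by rw [h, contract, contract]; monoidal

end

section

variable [BraidedCategory D] [Preadditive D] [MonoidalPreadditive D] {K V : D} [BimonObj K]

/-- If `g` is a derivation with respect to the counit, then the contraction with `g` is a braided
derivation. -/
theorem mul_contract {g : V ⊗ K ⟶ 𝟙_ D} (hg : V ◁ μ[K] ≫ g =
      V ◁ K ◁ ε[K] ≫ V ◁ (ρ_ _).hom ≫ g + V ◁ ε[K] ▷ K ≫ V ◁ (λ_ _).hom ≫ g) :
    V ◁ μ[K] ≫ contract g = (α_ V K K).inv ≫ contract g ▷ K ≫ μ[K] +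
      (α_ V K K).inv ≫ (β_ K V).inv ▷ K ≫ (α_ K V K).hom ≫ K ◁ contract g ≫ μ[K] := by
  have h : μ[K] ≫ Δ[K] = (Δ[K] ⊗ₘ Δ[K]) ≫ tensorμ K K K K ≫ (μ[K] ⊗ₘ μ[K]) :=
    BimonObj.mul_comul K
  -- By multiplicativity of `Δ`, the coproduct of `kk'` is `k₁k'₁ ⊗ k₂k'₂` up to the crossing of
  -- `k₂` and `k'₁`. The pairing `g` sees only `k₁k'₁`, so the derivation rule `hg` applies there.
  have h0 : V ◁ μ[K] ≫ contract g = (V ◁ (Δ[K] ▷ K ≫ (K ⊗ K) ◁ Δ[K]) ≫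
      V ◁ ((α_ K K (K ⊗ K)).hom ≫ K ◁ ((α_ K K K).inv ≫ (β_ K K).hom ▷ K ≫ (α_ K K K).hom) ≫
        (α_ K K (K ⊗ K)).inv)) ≫ (α_ V (K ⊗ K) (K ⊗ K)).inv ≫
      (V ◁ μ[K] ≫ g) ▷ (K ⊗ K) ≫ (λ_ (K ⊗ K)).hom ≫ μ[K] := by
    calc _ = V ◁ (μ[K] ≫ Δ[K]) ≫ (α_ V K K).inv ≫ g ▷ K ≫ (λ_ K).hom := by
          rw [contract]; monoidal
      _ = 𝟙 _ ⊗≫ V ◁ (Δ[K] ▷ K ≫ (K ⊗ K) ◁ Δ[K]) ⊗≫ V ◁ K ◁ (β_ K K).hom ▷ K ⊗≫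
          V ◁ μ[K] ▷ (K ⊗ K) ⊗≫ ((V ⊗ K) ◁ μ[K] ≫ g ▷ K) ⊗≫ 𝟙 _ := by
          rw [h, tensorμ, MonoidalCategory.tensorHom_def, MonoidalCategory.tensorHom_def]
          monoidal
      _ = _ := by rw [whisker_exchange]; monoidal
  rw [h0, hg, MonoidalPreadditive.add_whiskerRight, Preadditive.add_comp, Preadditive.comp_add,
    Preadditive.comp_add]
  congr 1
  · calc _ = 𝟙 _ ⊗≫ V ◁ (Δ[K] ▷ K ≫ (K ⊗ K) ◁ Δ[K]) ⊗≫
          V ◁ K ◁ ((β_ K K).hom ≫ ε[K] ▷ K) ▷ K ⊗≫ g ▷ (K ⊗ K) ⊗≫ μ[K] := by monoidal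
      _ = 𝟙 _ ⊗≫ V ◁ Δ[K] ▷ K ⊗≫ V ◁ (K ⊗ K) ◁ (Δ[K] ≫ ε[K] ▷ K) ⊗≫ g ▷ (K ⊗ K) ⊗≫
          μ[K] := by
          rw [← BraidedCategory.braiding_naturality_right, braiding_tensorUnit_right]; monoidal
      _ = _ := by rw [ComonObj.counit_comul, contract]; monoidal
  -- In this summand `ε` removes `k₁`, and `g` has to pass `k₂`. By the hexagon, the crossing of
  -- `k₂` and `k'₁` is an inverse crossing of `k₂` with `V` followed by a crossing with `V ⊗ K`; the
  -- latter disappears under `g` by naturality. This is the source of the inverse braiding in the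
  -- statement.
  · have e : (β_ K V).hom ▷ K ≫ (α_ V K K).hom ≫ V ◁ (β_ K K).hom =
        (α_ K V K).hom ≫ (β_ K (V ⊗ K)).hom ≫ (α_ V K K).hom := by
      rw [BraidedCategory.braiding_tensor_right_hom]; simp
    have e' : V ◁ (β_ K K).hom = (α_ V K K).inv ≫ (β_ K V).inv ▷ K ≫
        (α_ K V K).hom ≫ (β_ K (V ⊗ K)).hom ≫ (α_ V K K).hom := by
      rw [← e]; simp
    calc _ = 𝟙 _ ⊗≫ V ◁ (Δ[K] ▷ K ≫ (K ⊗ K) ◁ Δ[K]) ⊗≫ V ◁ (K ◁ (β_ K K).hom ≫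
          ε[K] ▷ (K ⊗ K)) ▷ K ⊗≫ g ▷ (K ⊗ K) ⊗≫ μ[K] := by monoidal
      _ = 𝟙 _ ⊗≫ V ◁ Δ[K] ▷ K ⊗≫ V ◁ ((K ⊗ K) ◁ Δ[K] ≫ (ε[K] ▷ K) ▷ (K ⊗ K)) ⊗≫
          V ◁ (β_ K K).hom ▷ K ⊗≫ g ▷ (K ⊗ K) ⊗≫ μ[K] := by
          rw [whisker_exchange]; monoidal
      _ = 𝟙 _ ⊗≫ V ◁ (Δ[K] ≫ ε[K] ▷ K) ▷ K ⊗≫ V ◁ K ◁ Δ[K] ⊗≫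
          (V ◁ (β_ K K).hom) ▷ K ⊗≫ g ▷ (K ⊗ K) ⊗≫ μ[K] := by
          rw [whisker_exchange]; monoidal
      _ = 𝟙 _ ⊗≫ ((V ⊗ K) ◁ Δ[K] ≫ (β_ K V).inv ▷ (K ⊗ K)) ⊗≫
          ((β_ K (V ⊗ K)).hom ≫ g ▷ K) ▷ K ⊗≫ μ[K] := by
          rw [ComonObj.counit_comul, e']; monoidal
      _ = _ := by
          rw [whisker_exchange, ← BraidedCategory.braiding_naturality_right,
            braiding_tensorUnit_right, contract]
          monoidal

end

end Contract

/-! ### The pairing of generators with a tensor algebra -/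

section GenPairing

open MonObj ComonObj

variable {D : Type u} [Category.{v} D] [MonoidalCategory D] [HasCountableCoproducts D]
  [∀ X : D, PreservesColimitsOfShape (Discrete ℕ) (tensorLeft X)]
  [∀ X : D, PreservesColimitsOfShape (Discrete ℕ) (tensorRight X)]
  [BraidedCategory D] [Preadditive D] [MonoidalPreadditive D]

variable {A B : D} (b : A ⊗ B ⟶ 𝟙_ D)

/-- The components of `genPairing`. -/
noncomputable def genPairingAux : ∀ n, A ⊗ tensorPow B n ⟶ 𝟙_ D
  | 0 => 0
  | n + 1 => A ◁ (T.incl B n ≫ T.counit B) ▷ B ≫ A ◁ (λ_ B).hom ≫ b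

/-- The extension of a pairing `A ⊗ B ⟶ 𝟙` by zero to `A ⊗ T(B)`. -/
noncomputable def genPairing : A ⊗ T B ⟶ 𝟙_ D :=
  (T.left_exists B (genPairingAux b)).choose

theorem incl_genPairing (n : ℕ) : A ◁ T.incl B n ≫ genPairing b = genPairingAux b n :=
  (T.left_exists B (genPairingAux b)).choose_spec n

theorem unit_genPairing : A ◁ T.unit B ≫ genPairing b = 0 := incl_genPairing b 0

/-- The counit singles out the part of degree zero in the left factor, so that this one formula
covers all degrees at once. -/
theorem shift_genPairing : A ◁ T.shift B ≫ genPairing b =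
    A ◁ T.counit B ▷ B ≫ A ◁ (λ_ B).hom ≫ b := by
  apply T.middle_ext
  intro n
  rw [← MonoidalCategory.whiskerLeft_comp_assoc, T.incl_shift, ← MonoidalCategory.whiskerLeft_comp_assoc,
    ← comp_whiskerRight]
  exact incl_genPairing b (n + 1)

theorem gen_genPairing : A ◁ T.gen B ≫ genPairing b = b := by
  rw [T.gen_eq, MonoidalCategory.whiskerLeft_comp_assoc, MonoidalCategory.whiskerLeft_comp_assoc,
    shift_genPairing, ← MonoidalCategory.whiskerLeft_comp_assoc A (T.unit B ▷ B),
    ← comp_whiskerRight, T.unit_counit]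
  simp

/-- `genPairing b` is a derivation with respect to the counit. -/
theorem mul_genPairing : A ◁ μ[T B] ≫ genPairing b =
    A ◁ T B ◁ ε[T B] ≫ A ◁ (ρ_ _).hom ≫ genPairing b +
      A ◁ ε[T B] ▷ T B ≫ A ◁ (λ_ _).hom ≫ genPairing b := by
  have h1 : μ[T B] ≫ T.counit B = (T.counit B ⊗ₘ T.counit B) ≫ (λ_ _).hom :=
    BimonObj.mul_counit (T B)
  change A ◁ T.mul B ≫ _ = A ◁ T B ◁ T.counit B ≫ _ + A ◁ T.counit B ▷ T B ≫ _
  rw [← cancel_epi (α_ A (T B) (T B)).hom]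
  -- No induction is needed. If the second factor is the unit, the summand with `ε` on the first
  -- factor vanishes; if it is a product with a generator, the other summand does.
  refine T.cases_ext B ?_ ?_
  · have e1 : (A ⊗ T B) ◁ T.unit B ≫ (α_ A (T B) (T B)).hom ≫ A ◁ T.counit B ▷ T B ≫
        A ◁ (λ_ _).hom ≫ genPairing b = 0 := by
      calc _ = 𝟙 _ ⊗≫ A ◁ (T B ◁ T.unit B ≫ T.counit B ▷ T B) ⊗≫ genPairing b := by monoidal
        _ = 𝟙 _ ⊗≫ A ◁ T.counit B ⊗≫ (A ◁ T.unit B ≫ genPairing b) := by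
          rw [whisker_exchange]; monoidal
        _ = _ := by rw [unit_genPairing]; simp [monoidalComp]
    rw [Preadditive.comp_add, Preadditive.comp_add, e1, add_zero]
    calc _ = 𝟙 _ ⊗≫ A ◁ (T B ◁ T.unit B ≫ T.mul B) ⊗≫ genPairing b := by monoidal
      _ = 𝟙 _ ⊗≫ A ◁ T B ◁ (T.unit B ≫ T.counit B) ⊗≫ genPairing b := by
        rw [T.mul_unit, T.unit_counit]; monoidal
      _ = _ := by monoidal
  · have e1 : (A ⊗ T B) ◁ T.shift B ≫ (α_ A (T B) (T B)).hom ≫ A ◁ T B ◁ T.counit B ≫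
        A ◁ (ρ_ _).hom ≫ genPairing b = 0 := by
      calc _ = 𝟙 _ ⊗≫ A ◁ T B ◁ (T.shift B ≫ T.counit B) ⊗≫ genPairing b := by monoidal
        _ = _ := by rw [T.shift_counit]; simp [monoidalComp]
    rw [Preadditive.comp_add, Preadditive.comp_add, e1, zero_add]
    calc _ = 𝟙 _ ⊗≫ A ◁ (T B ◁ T.shift B ≫ T.mul B) ⊗≫ genPairing b := by monoidal
      _ = 𝟙 _ ⊗≫ A ◁ T.mul B ▷ B ⊗≫ (A ◁ T.shift B ≫ genPairing b) := by
        rw [T.mul_shift]; monoidal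
      _ = 𝟙 _ ⊗≫ A ◁ (μ[T B] ≫ T.counit B) ▷ B ⊗≫ b := by
        rw [shift_genPairing, T.mul_eq]; monoidal
      _ = 𝟙 _ ⊗≫ A ◁ T.counit B ▷ (T B ⊗ B) ⊗≫ A ◁ T.counit B ▷ B ⊗≫ b := by
        rw [h1, MonoidalCategory.tensorHom_def]; monoidal
      _ = 𝟙 _ ⊗≫ A ◁ T.counit B ▷ (T B ⊗ B) ⊗≫ (A ◁ T.shift B ≫ genPairing b) := by
        rw [shift_genPairing]; monoidal
      _ = 𝟙 _ ⊗≫ A ◁ (T B ◁ T.shift B ≫ T.counit B ▷ T B) ⊗≫ genPairing b := by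
        rw [whisker_exchange]; monoidal
      _ = _ := by monoidal

end GenPairing

/-! ### Construction, uniqueness and degrees of the Hopf pairing -/

section Pairing

open MonObj ComonObj

section Primitive

variable {D : Type u} [Category.{v} D] [MonoidalCategory D] [Preadditive D] [MonoidalPreadditive D]
  {H K V : D} [MonObj H] [ComonObj H] [MonObj K] [ComonObj K]

/-- Pairing with a primitive generalized element is a derivation with respect to the counit. -/
theorem IsHopfPairing.mul_primitive {r : H ⊗ K ⟶ 𝟙_ D} (h : IsHopfPairing r) {f : V ⟶ H}
    (hf : f ≫ Δ[H] = (ρ_ V).inv ≫ (f ⊗ₘ η[H]) + (λ_ V).inv ≫ (η[H] ⊗ₘ f)) :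
    V ◁ μ[K] ≫ f ▷ K ≫ r = V ◁ K ◁ ε[K] ≫ V ◁ (ρ_ _).hom ≫ f ▷ K ≫ r +
      V ◁ ε[K] ▷ K ≫ V ◁ (λ_ _).hom ≫ f ▷ K ≫ r := by
  -- The nested pairing matches the inner factors first: `η ⊗ f` puts `f` on the first factor of `K
  -- ⊗ K` and `f ⊗ η` on the second. The summands therefore come out in the opposite order, hence
  -- `add_comm`.
  rw [whisker_exchange_assoc, h.mul_right, ← comp_whiskerRight_assoc, hf,
    MonoidalPreadditive.add_whiskerRight, Preadditive.add_comp, add_comm]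
  congr 1
  · calc _ = 𝟙 _ ⊗≫ (η[H] ▷ ((V ⊗ K) ⊗ K) ≫ H ◁ (f ▷ K ≫ r) ▷ K) ⊗≫ r := by
          rw [nested, MonoidalCategory.tensorHom_def]; monoidal
      _ = 𝟙 _ ⊗≫ (f ▷ K ≫ r) ▷ K ⊗≫ (η[H] ▷ K ≫ r) := by
          rw [← whisker_exchange]; monoidal
      _ = 𝟙 _ ⊗≫ ((f ▷ K ≫ r) ▷ K ≫ 𝟙_ D ◁ ε[K]) ⊗≫ 𝟙 _ := by
          rw [h.one_left]; monoidal
      _ = _ := by rw [← whisker_exchange]; monoidal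
  · calc _ = 𝟙 _ ⊗≫ f ▷ (K ⊗ K) ⊗≫ H ◁ (η[H] ▷ K ≫ r) ▷ K ⊗≫ r := by
          rw [nested, MonoidalCategory.tensorHom_def]; monoidal
      _ = 𝟙 _ ⊗≫ (f ▷ (K ⊗ K) ≫ H ◁ ε[K] ▷ K) ⊗≫ r := by
          rw [h.one_left]; monoidal
      _ = _ := by rw [← whisker_exchange]; monoidal

end Primitive

variable {D : Type u} [Category.{v} D] [MonoidalCategory D] [HasCountableCoproducts D]
  [∀ X : D, PreservesColimitsOfShape (Discrete ℕ) (tensorLeft X)]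
  [∀ X : D, PreservesColimitsOfShape (Discrete ℕ) (tensorRight X)]
  [BraidedCategory D] [Preadditive D] [MonoidalPreadditive D]

variable {A B : D} (b : A ⊗ B ⟶ 𝟙_ D)

/-- The contraction `A ⊗ T(B) ⟶ T(B)` with the pairing `b`. -/
noncomputable def genContract : A ⊗ T B ⟶ T B := contract (genPairing b)

/-- The Hopf pairing of tensor algebras which extends `b`. -/
noncomputable def pairing : T A ⊗ T B ⟶ 𝟙_ D := T.extendLeft A (genContract b) (T.counit B)

theorem unit_pairing : T.unit A ▷ T B ≫ pairing b = (λ_ _).hom ≫ T.counit B :=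
  T.unit_extendLeft A _ _

theorem shift_pairing : T.shift A ▷ T B ≫ pairing b =
    (α_ (T A) A (T B)).hom ≫ T A ◁ genContract b ≫ pairing b :=
  T.shift_extendLeft A _ _

theorem genContract_counit : genContract b ≫ T.counit B = genPairing b := contract_counit _

theorem mul_genContract : A ◁ μ[T B] ≫ genContract b =
    (α_ A (T B) (T B)).inv ≫ genContract b ▷ T B ≫ μ[T B] +
      (α_ A (T B) (T B)).inv ≫ (β_ (T B) A).inv ▷ T B ≫ (α_ (T B) A (T B)).hom ≫
        T B ◁ genContract b ≫ μ[T B] :=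
  mul_contract (mul_genPairing b)

theorem unit_genContract : A ◁ T.unit B ≫ genContract b = 0 := by
  have h : T.unit B ≫ Δ[T B] = (λ_ (𝟙_ D)).inv ≫ (T.unit B ⊗ₘ T.unit B) := T.unit_comul B
  calc _ = A ◁ (T.unit B ≫ Δ[T B]) ≫ (α_ A (T B) (T B)).inv ≫ genPairing b ▷ T B ≫
        (λ_ _).hom := by rw [genContract, contract]; monoidal
    _ = 𝟙 _ ⊗≫ (A ◁ 𝟙_ D ◁ T.unit B) ⊗≫ (A ◁ T.unit B ≫ genPairing b) ▷ T B ⊗≫ 𝟙 _ := by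
      rw [h, MonoidalCategory.tensorHom_def']; monoidal
    _ = _ := by rw [unit_genPairing]; simp [monoidalComp]

/-- The recursion starting from `1` gives `ρ(a, k) = ε(δ(a, k))`, and the counit of a contraction is
the pairing contracted with. -/
theorem gen_pairing : T.gen A ▷ T B ≫ pairing b = genPairing b := by
  calc _ = (λ_ A).inv ▷ T B ≫ T.unit A ▷ A ▷ T B ≫ (T.shift A ▷ T B ≫ pairing b) := by
        rw [T.gen_eq]; monoidal
    _ = 𝟙 _ ⊗≫ (T.unit A ▷ (A ⊗ T B) ≫ T A ◁ genContract b) ⊗≫ pairing b := by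
      rw [shift_pairing]; monoidal
    _ = 𝟙 _ ⊗≫ genContract b ⊗≫ (T.unit A ▷ T B ≫ pairing b) := by
      rw [← whisker_exchange]; monoidal
    _ = genContract b ≫ T.counit B := by rw [unit_pairing]; monoidal
    _ = _ := genContract_counit b

theorem gen_gen_pairing : (T.gen A ⊗ₘ T.gen B) ≫ pairing b = b := by
  rw [MonoidalCategory.tensorHom_def', Category.assoc, gen_pairing, gen_genPairing]

theorem pairing_unit : T A ◁ T.unit B ≫ pairing b = (ρ_ _).hom ≫ T.counit A := by
  -- The recursion step is `0`: both sides vanish on products with a generator, the left one because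
  -- the contraction of the unit is zero, the right one because the counit is.
  refine T.left_free_ext A 0 ?_ ?_ ?_
  · rw [← whisker_exchange_assoc, unit_pairing]
    calc _ = 𝟙 _ ⊗≫ (T.unit B ≫ T.counit B) ⊗≫ 𝟙 _ := by monoidal
      _ = 𝟙 _ ⊗≫ (T.unit A ≫ T.counit A) ⊗≫ 𝟙 _ := by rw [T.unit_counit, T.unit_counit]
      _ = _ := by monoidal
  · rw [← whisker_exchange_assoc, shift_pairing]
    calc _ = 𝟙 _ ⊗≫ T A ◁ (A ◁ T.unit B ≫ genContract b) ⊗≫ pairing b := by monoidal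
      _ = _ := by rw [unit_genContract]; simp [monoidalComp]
  · rw [rightUnitor_naturality_assoc, T.shift_counit]
    simp

/-- Coassociativity carries the recursion from the pairing over to its contraction: contracting with
`ha` is contracting with `a` and then with `h`. -/
theorem shift_contract_pairing : T.shift A ▷ T B ≫ contract (pairing b) =
    (α_ (T A) A (T B)).hom ≫ T A ◁ genContract b ≫ contract (pairing b) := by
  rw [whiskerRight_contract, shift_pairing, genContract, contract_contract, Iso.hom_inv_id_assoc]

theorem unit_contract_pairing : T.unit A ▷ T B ≫ contract (pairing b) = (λ_ _).hom := by
  rw [whiskerRight_contract, unit_pairing]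
  calc _ = 𝟙 _ ⊗≫ (Δ[T B] ≫ ε[T B] ▷ T B) ⊗≫ 𝟙 _ := by
        rw [contract]
        change _ ≫ _ ≫ ((λ_ _).hom ≫ ε[T B]) ▷ _ ≫ _ = _
        monoidal
    _ = _ := by rw [ComonObj.counit_comul]; monoidal

/-- Induction on the right factor of the product: on both sides its last generator is used up by one
contraction of `T(B)`. -/
theorem mul_pairing : μ[T A] ▷ T B ≫ pairing b =
    (α_ (T A) (T A) (T B)).hom ≫ T A ◁ contract (pairing b) ≫ pairing b := by
  rw [← Iso.inv_comp_eq]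
  refine T.middle_free_ext A (genContract b) ?_ ?_ ?_
  · calc _ = 𝟙 _ ⊗≫ (T A ◁ T.unit A ≫ T.mul A) ▷ T B ⊗≫ pairing b := by rw [T.mul_eq]; monoidal
      _ = 𝟙 _ ⊗≫ pairing b := by rw [T.mul_unit]; monoidal
      _ = 𝟙 _ ⊗≫ T A ◁ (T.unit A ▷ T B ≫ contract (pairing b)) ⊗≫ pairing b := by
        rw [unit_contract_pairing]; monoidal
      _ = _ := by monoidal
  · calc _ = 𝟙 _ ⊗≫ (T A ◁ T.shift A ≫ T.mul A) ▷ T B ⊗≫ pairing b := by rw [T.mul_eq]; monoidal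
      _ = 𝟙 _ ⊗≫ T.mul A ▷ A ▷ T B ⊗≫ (T.shift A ▷ T B ≫ pairing b) := by
        rw [T.mul_shift]; monoidal
      _ = 𝟙 _ ⊗≫ (T.mul A ▷ (A ⊗ T B) ≫ T A ◁ genContract b) ⊗≫ pairing b := by
        rw [shift_pairing]; monoidal
      _ = _ := by rw [← whisker_exchange, T.mul_eq]; monoidal
  · rw [← MonoidalCategory.whiskerLeft_comp_assoc, shift_contract_pairing]
    simp only [MonoidalCategory.whiskerLeft_comp, Category.assoc]

/-- The contraction of a product with a generator. -/
theorem shift_genContract : A ◁ T.shift B ≫ genContract b =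
    (α_ A (T B) B).inv ≫ genContract b ▷ B ≫ T.shift B +
      A ◁ (β_ (T B) B).hom ≫ (α_ A B (T B)).inv ≫ b ▷ T B ≫ (λ_ _).hom := by
  have h : T.shift B ≫ Δ[T B] = Δ[T B] ▷ B ≫ (α_ (T B) (T B) B).hom ≫
    (T B ◁ (β_ (T B) B).hom ≫ (α_ (T B) B (T B)).inv ≫ T.shift B ▷ T B + T B ◁ T.shift B) :=
    T.shift_comul B
  have h0 : A ◁ T.shift B ≫ genContract b =
      A ◁ (T.shift B ≫ Δ[T B]) ≫ (α_ A (T B) (T B)).inv ≫ genPairing b ▷ T B ≫ (λ_ _).hom := by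
    rw [genContract, contract]; monoidal
  rw [h0, h, Preadditive.comp_add, Preadditive.comp_add, MonoidalPreadditive.whiskerLeft_add,
    Preadditive.add_comp, add_comm]
  congr 1
  · calc _ = 𝟙 _ ⊗≫ A ◁ Δ[T B] ▷ B ⊗≫ ((A ⊗ T B) ◁ T.shift B ≫ genPairing b ▷ T B) ⊗≫ 𝟙 _ := by
          monoidal
      _ = _ := by rw [whisker_exchange, genContract, contract]; monoidal
  -- Here the generator crosses `k₂` and joins `k₁`. Since `genPairing` of a product with a
  -- generator only retains `ε(k₁)`, all of `k` survives, moved past the generator.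
  · calc _ = 𝟙 _ ⊗≫ A ◁ Δ[T B] ▷ B ⊗≫ A ◁ T B ◁ (β_ (T B) B).hom ⊗≫
          (A ◁ T.shift B ≫ genPairing b) ▷ T B ⊗≫ 𝟙 _ := by monoidal
      _ = 𝟙 _ ⊗≫ A ◁ Δ[T B] ▷ B ⊗≫ A ◁ (T B ◁ (β_ (T B) B).hom ≫ ε[T B] ▷ (B ⊗ T B)) ⊗≫
          b ▷ T B ⊗≫ 𝟙 _ := by
          rw [shift_genPairing]
          change _ = 𝟙 _ ⊗≫ A ◁ Δ[T B] ▷ B ⊗≫ A ◁ (_ ≫ T.counit B ▷ _) ⊗≫ _ ⊗≫ 𝟙 _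
          monoidal
      _ = 𝟙 _ ⊗≫ A ◁ (Δ[T B] ≫ ε[T B] ▷ T B) ▷ B ⊗≫ A ◁ (β_ (T B) B).hom ⊗≫
          b ▷ T B ⊗≫ 𝟙 _ := by
          rw [whisker_exchange]; monoidal
      _ = _ := by rw [ComonObj.counit_comul]; monoidal

/-- `a ⊗ k ⊗ k' ↦ δ(a, k) ⊗ k' + k ⊗ δ(a, k')`, where `δ` is the contraction and `k` is moved past
`a` in the second summand. -/
noncomputable def genContractTensor : A ⊗ (T B ⊗ T B) ⟶ T B ⊗ T B :=
  (α_ A (T B) (T B)).inv ≫ genContract b ▷ T B +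
      (α_ A (T B) (T B)).inv ≫ (β_ (T B) A).inv ▷ T B ≫ (α_ (T B) A (T B)).hom ≫
        T B ◁ genContract b

/-- Both sides obey the recursion in the first argument whose step is the braided Leibniz action
`genContractTensor` on `T(B) ⊗ T(B)`: the left side because `δ` is a braided derivation, the right
side by the formula for the coproduct of a product with a generator. -/
theorem pairing_mul : T A ◁ μ[T B] ≫ pairing b = Δ[T A] ▷ (T B ⊗ T B) ≫ nested (pairing b) := by
  have hs : genContractTensor b ≫ μ[T B] = A ◁ μ[T B] ≫ genContract b := by
    rw [mul_genContract, genContractTensor]; simp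
  have h : T.shift A ≫ Δ[T A] = Δ[T A] ▷ A ≫ (α_ (T A) (T A) A).hom ≫
    (T A ◁ (β_ (T A) A).hom ≫ (α_ (T A) A (T A)).inv ≫ T.shift A ▷ T A + T A ◁ T.shift A) :=
    T.shift_comul A
  have h' : T.unit A ≫ Δ[T A] = (λ_ (𝟙_ D)).inv ≫ (T.unit A ⊗ₘ T.unit A) := T.unit_comul A
  have hc : T.mul B ≫ T.counit B = (T.counit B ⊗ₘ T.counit B) ≫ (λ_ _).hom :=
    BimonObj.mul_counit (T B)
  refine T.left_free_ext A (genContractTensor b) ?_ ?_ ?_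
  · rw [← whisker_exchange_assoc, unit_pairing, leftUnitor_naturality_assoc, T.mul_eq, hc,
      ← comp_whiskerRight_assoc, h']
    symm
    calc _ = 𝟙 _ ⊗≫ T.unit A ▷ (T B ⊗ T B) ⊗≫ T A ◁ (T.unit A ▷ T B ≫ pairing b) ▷ T B ⊗≫
          pairing b := by
          rw [nested, MonoidalCategory.tensorHom_def]; monoidal
      _ = 𝟙 _ ⊗≫ (T.unit A ▷ (T B ⊗ T B) ≫ T A ◁ T.counit B ▷ T B) ⊗≫ pairing b := by
          rw [unit_pairing]; monoidal
      _ = 𝟙 _ ⊗≫ T.counit B ▷ T B ⊗≫ (T.unit A ▷ T B ≫ pairing b) := by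
          rw [← whisker_exchange]; monoidal
      _ = _ := by rw [unit_pairing, MonoidalCategory.tensorHom_def]; monoidal
  · rw [← whisker_exchange_assoc, shift_pairing, ← MonoidalCategory.whiskerLeft_comp_assoc (T A) (genContractTensor b), hs]
    monoidal
  -- In the coproduct of `ha` the generator joins `h₂`, which is paired with the first factor `k`,
  -- or crosses `h₂` and joins `h₁`, which is paired with the second factor `k'`. These are the two
  -- summands of `genContractTensor`, in reverse order.
  · rw [← comp_whiskerRight_assoc, h, Preadditive.comp_add, Preadditive.comp_add,
      MonoidalPreadditive.add_whiskerRight, Preadditive.add_comp, genContractTensor,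
      MonoidalPreadditive.whiskerLeft_add, Preadditive.add_comp, Preadditive.comp_add, add_comm]
    congr 1
    · calc _ = 𝟙 _ ⊗≫ Δ[T A] ▷ A ▷ (T B ⊗ T B) ⊗≫
            T A ◁ (T.shift A ▷ T B ≫ pairing b) ▷ T B ⊗≫ pairing b := by
            rw [nested]; monoidal
        _ = 𝟙 _ ⊗≫ (Δ[T A] ▷ ((A ⊗ T B) ⊗ T B) ≫
            (T A ⊗ T A) ◁ genContract b ▷ T B) ⊗≫ T A ◁ pairing b ▷ T B ⊗≫ pairing b := by
            rw [shift_pairing]; monoidal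
        _ = _ := by rw [← whisker_exchange, nested]; monoidal
    -- Crossing `a` with `h₂ ⊗ k` is trivial once these two are paired to the unit object. Hence the
    -- crossing of `h₂` with `a` may be traded for the inverse crossing of `k` with `a`.
    · have hx : (β_ (T A) A).hom ▷ T B ≫ (α_ A (T A) (T B)).hom ≫ A ◁ pairing b =
          (α_ (T A) A (T B)).hom ≫ T A ◁ (β_ (T B) A).inv ≫ (α_ (T A) (T B) A).inv ≫
            pairing b ▷ A ≫ (λ_ A).hom ≫ (ρ_ A).inv := by
        have e1 : pairing b ▷ A ≫ (λ_ A).hom ≫ (ρ_ A).inv =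
            (β_ (T A ⊗ T B) A).hom ≫ A ◁ pairing b := by
          rw [← BraidedCategory.braiding_naturality_left, braiding_tensorUnit_left]
        rw [e1, BraidedCategory.braiding_tensor_left_hom]
        simp
      calc _ = 𝟙 _ ⊗≫ Δ[T A] ▷ A ▷ (T B ⊗ T B) ⊗≫ T A ◁ (β_ (T A) A).hom ▷ (T B ⊗ T B) ⊗≫
            (T.shift A ▷ ((T A ⊗ T B) ⊗ T B) ≫ T A ◁ pairing b ▷ T B) ⊗≫ pairing b := by
            rw [nested]; monoidal
        _ = 𝟙 _ ⊗≫ Δ[T A] ▷ A ▷ (T B ⊗ T B) ⊗≫ T A ◁ ((β_ (T A) A).hom ▷ T B ≫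
              (α_ A (T A) (T B)).hom ≫ A ◁ pairing b) ▷ T B ⊗≫
            (T.shift A ▷ T B ≫ pairing b) := by
            rw [← whisker_exchange]; monoidal
        _ = 𝟙 _ ⊗≫ (Δ[T A] ▷ ((A ⊗ T B) ⊗ T B) ≫ (T A ⊗ T A) ◁ (β_ (T B) A).inv ▷ T B) ⊗≫
            T A ◁ (pairing b ▷ (A ⊗ T B) ≫ 𝟙_ D ◁ genContract b) ⊗≫ pairing b := by
            rw [hx, shift_pairing]; monoidal
        _ = 𝟙 _ ⊗≫ T A ◁ (β_ (T B) A).inv ▷ T B ⊗≫ (Δ[T A] ▷ (T B ⊗ (A ⊗ T B)) ≫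
            (T A ⊗ T A) ◁ (T B ◁ genContract b)) ⊗≫ T A ◁ pairing b ▷ T B ⊗≫ pairing b := by
            rw [← whisker_exchange, ← whisker_exchange (pairing b)]; monoidal
        _ = _ := by rw [← whisker_exchange, nested]; monoidal

theorem isHopfPairing_pairing : IsHopfPairing (pairing b) where
  mul_left := (mul_pairing b).trans (comul_nested _).symm
  one_left := unit_pairing b
  mul_right := pairing_mul b
  one_right := pairing_unit b

/-- The second axiom fixes `r` on `A ⊗ T(B)`, because generators are primitive; the first axiom then
gives `r` the recursion that defines `pairing b`. -/
theorem IsHopfPairing.eq_pairing {r : T A ⊗ T B ⟶ 𝟙_ D} (h : IsHopfPairing r)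
    (e : (T.gen A ⊗ₘ T.gen B) ≫ r = b) : r = pairing b := by
  -- On a product `kf` with a generator `f` the derivation rule has a summand containing `ε(f) = 0`;
  -- the other one is `ε(k) b(a, f)`.
  have h1 : T.gen A ▷ T B ≫ r = genPairing b := by
    refine T.cases_ext B ?_ ?_
    · have e1 : T A ◁ T.unit B ≫ r = (ρ_ _).hom ≫ T.counit A := h.one_right
      rw [unit_genPairing, whisker_exchange_assoc, e1, rightUnitor_naturality_assoc, T.gen_counit,
        comp_zero]
    · have e1 := h.mul_primitive (T.gen_comul A)
      rw [shift_genPairing, T.shift_eq, MonoidalCategory.whiskerLeft_comp_assoc, e1,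
        Preadditive.comp_add]
      have e2 : A ◁ T B ◁ T.gen B ≫ A ◁ T B ◁ ε[T B] ≫ A ◁ (ρ_ (T B)).hom ≫
          T.gen A ▷ T B ≫ r = 0 := by
        have e3 : T.gen B ≫ ε[T B] = 0 := T.gen_counit B
        rw [← MonoidalCategory.whiskerLeft_comp_assoc, ← MonoidalCategory.whiskerLeft_comp, e3]
        simp
      rw [e2, zero_add, ← e]
      calc _ = 𝟙 _ ⊗≫ A ◁ (T B ◁ T.gen B ≫ T.counit B ▷ T B) ⊗≫ T.gen A ▷ T B ⊗≫ r := by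
            change _ ≫ A ◁ T.counit B ▷ T B ≫ _ = _
            monoidal
        _ = _ := by rw [whisker_exchange, MonoidalCategory.tensorHom_def']; monoidal
  refine T.left_free_ext A (genContract b) ?_ ?_ (shift_pairing b)
  · rw [unit_pairing]; exact h.one_left
  · have e1 : μ[T A] ▷ T B ≫ r = (α_ (T A) (T A) (T B)).hom ≫ T A ◁ contract r ≫ r :=
      h.mul_left.trans (comul_nested r)
    rw [T.shift_eq, comp_whiskerRight, Category.assoc, e1, associator_naturality_middle_assoc,
      ← MonoidalCategory.whiskerLeft_comp_assoc, whiskerRight_contract, h1, genContract]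

/-- The form of `shift_genContract` that keeps track of degrees: the second summand visibly lands in
degree `m`, and the first does so inductively. -/
theorem inclSucc_genContract (m : ℕ) : A ◁ T.inclSucc B m ≫ genContract b =
    (α_ A (tensorPow B m) B).inv ≫ (A ◁ T.incl B m ≫ genContract b) ▷ B ≫ T.shift B +
      (A ◁ (β_ (tensorPow B m) B).hom ≫ (α_ A B (tensorPow B m)).inv ≫ b ▷ tensorPow B m ≫
        (λ_ _).hom) ≫ T.incl B m := by
  rw [← T.incl_shift, MonoidalCategory.whiskerLeft_comp, Category.assoc, shift_genContract,
    Preadditive.comp_add]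
  congr 1
  · rw [associator_inv_naturality_middle_assoc, comp_whiskerRight, Category.assoc]
  · rw [← MonoidalCategory.whiskerLeft_comp_assoc, BraidedCategory.braiding_naturality_left]
    calc _ = 𝟙 _ ⊗≫ A ◁ (β_ (tensorPow B m) B).hom ⊗≫ ((A ⊗ B) ◁ T.incl B m ≫ b ▷ T B) ⊗≫
          𝟙 _ := by monoidal
      _ = _ := by rw [whisker_exchange]; monoidal

/-- The contraction lowers the degree by one. -/
theorem exists_incl_genContract (m : ℕ) : ∃ d : A ⊗ tensorPow B (m + 1) ⟶ tensorPow B m,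
    A ◁ T.incl B (m + 1) ≫ genContract b = d ≫ T.incl B m := by
  induction m with
  | zero =>
    have e : A ◁ T.incl B 0 ≫ genContract b = 0 := unit_genContract b
    have h := inclSucc_genContract b 0
    rw [e, MonoidalPreadditive.zero_whiskerRight, zero_comp, comp_zero, zero_add] at h
    exact ⟨_, h⟩
  | succ m ih =>
    obtain ⟨d, hd⟩ := ih
    have h : ∃ d', (α_ A (tensorPow B (m + 1)) B).inv ≫
        (A ◁ T.incl B (m + 1) ≫ genContract b) ▷ B ≫ T.shift B = d' ≫ T.incl B (m + 1) := by
      rw [hd, comp_whiskerRight, Category.assoc, T.incl_shift]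
      exact ⟨_, (Category.assoc _ _ _).symm⟩
    obtain ⟨d', hd'⟩ := h
    have h := inclSucc_genContract b (m + 1)
    rw [hd', ← Preadditive.add_comp] at h
    exact ⟨_, h⟩

theorem inclSucc_pairing (n m : ℕ) : (T.inclSucc A n ⊗ₘ T.incl B m) ≫ pairing b = (α_ _ _ _).hom ≫
    tensorPow A n ◁ (A ◁ T.incl B m ≫ genContract b) ≫ T.incl A n ▷ T B ≫ pairing b := by
  rw [← T.incl_shift, MonoidalCategory.tensorHom_def', comp_whiskerRight, Category.assoc,
    Category.assoc, shift_pairing, associator_naturality_left_assoc, ← whisker_exchange_assoc]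
  simp

/-- Each generator on the left removes one degree on the right, so degrees `n + 1` and `m + 1`
reduce to `n` and `m`. At the boundary, the contraction kills the unit and the counit kills positive
degrees. -/
theorem degreePreserving_pairing : DegreePreserving (pairing b) := by
  intro n
  induction n with
  | zero =>
    rintro (_ | m) hm
    · exact absurd rfl hm
    · have e : T.inclSucc B m ≫ T.counit B = 0 := by
        rw [← T.incl_shift, Category.assoc, T.shift_counit, comp_zero]
      change (T.unit A ⊗ₘ T.inclSucc B m) ≫ _ = 0
      rw [MonoidalCategory.tensorHom_def', Category.assoc, unit_pairing,
        leftUnitor_naturality_assoc, e, comp_zero]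
  | succ n ih =>
    rintro (_ | m) hm
    · refine (inclSucc_pairing b n 0).trans ?_
      have e : A ◁ T.incl B 0 ≫ genContract b = 0 := unit_genContract b
      rw [e, MonoidalPreadditive.whiskerLeft_zero, zero_comp, comp_zero]
      rfl
    · refine (inclSucc_pairing b n (m + 1)).trans ?_
      obtain ⟨d, hd⟩ := exists_incl_genContract b m
      have e := ih m (by omega)
      rw [MonoidalCategory.tensorHom_def', Category.assoc] at e
      rw [hd, MonoidalCategory.whiskerLeft_comp, Category.assoc, e, comp_zero, comp_zero]
      rfl

end Pairing

/-! ### The Yetter-Drinfeld condition and products -/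

section Generation

open MonObj ComonObj

variable {D : Type u} [Category.{v} D] [MonoidalCategory D] [BraidedCategory D]

section Split

variable {H K : D} [ComonObj H] [ComonObj K] (X : D)

variable (H) in
/-- The morphism `h ⊗ x ↦ h₁ ⊗ x ⊗ h₂`. -/
def splitLeft : H ⊗ X ⟶ (H ⊗ X) ⊗ H :=
  Δ[H] ▷ X ≫ (α_ H H X).hom ≫ H ◁ (β_ H X).hom ≫ (α_ H X H).inv

variable (K) in
/-- The morphism `x ⊗ k ↦ k₁ ⊗ x ⊗ k₂`. -/
def splitRight : X ⊗ K ⟶ K ⊗ (X ⊗ K) :=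
  X ◁ Δ[K] ≫ (α_ X K K).inv ≫ (β_ X K).hom ▷ K ≫ (α_ K X K).hom

variable {X}

theorem leftThrough_eq_split (p : H ⊗ X ⟶ X) : leftThrough p = splitLeft H X ≫ p ▷ H := by
  simp [leftThrough, splitLeft]

theorem rightThrough_eq_split (q : X ⊗ K ⟶ X) : rightThrough q = splitRight K X ≫ K ◁ q := by
  simp [rightThrough, splitRight]

variable (X)

/-- This and the next three lemmas are coassociativity of the splittings, one for each leg. Where
the leg that is split further has crossed `X`, naturality of the braiding and the hexagon are needed
too; otherwise coassociativity and interchange suffice. -/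
theorem splitRight_comul_left : splitRight K X ≫ Δ[K] ▷ (X ⊗ K) =
    splitRight K X ≫ K ◁ splitRight K X ≫ (α_ K K (X ⊗ K)).inv := by
  have h : Δ[K] ≫ Δ[K] ▷ K = Δ[K] ≫ K ◁ Δ[K] ≫ (α_ K K K).inv := ComonObj.comul_assoc_flip K
  calc _ = 𝟙 _ ⊗≫ X ◁ Δ[K] ⊗≫ ((β_ X K).hom ≫ Δ[K] ▷ X) ▷ K ⊗≫ 𝟙 _ := by
        rw [splitRight]; monoidal
    _ = 𝟙 _ ⊗≫ X ◁ (Δ[K] ≫ Δ[K] ▷ K) ⊗≫ (β_ X (K ⊗ K)).hom ▷ K ⊗≫ 𝟙 _ := by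
        rw [← BraidedCategory.braiding_naturality_right]; monoidal
    _ = 𝟙 _ ⊗≫ X ◁ Δ[K] ⊗≫ ((X ⊗ K) ◁ Δ[K] ≫ (β_ X K).hom ▷ (K ⊗ K)) ⊗≫
        K ◁ (β_ X K).hom ▷ K ⊗≫ 𝟙 _ := by
        rw [h, BraidedCategory.braiding_tensor_right_hom]; monoidal
    _ = _ := by rw [whisker_exchange, splitRight]; monoidal

theorem splitRight_comul_right : splitRight K X ≫ K ◁ X ◁ Δ[K] =
    𝟙 _ ⊗≫ X ◁ Δ[K] ⊗≫ splitRight K X ▷ K ⊗≫ 𝟙 _ := by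
  have h : Δ[K] ≫ K ◁ Δ[K] = Δ[K] ≫ Δ[K] ▷ K ≫ (α_ K K K).hom := ComonObj.comul_assoc K
  calc _ = 𝟙 _ ⊗≫ X ◁ Δ[K] ⊗≫ ((β_ X K).hom ▷ K ≫ (K ⊗ X) ◁ Δ[K]) ⊗≫ 𝟙 _ := by
        rw [splitRight]; monoidal
    _ = 𝟙 _ ⊗≫ X ◁ (Δ[K] ≫ K ◁ Δ[K]) ⊗≫ (β_ X K).hom ▷ (K ⊗ K) ⊗≫ 𝟙 _ := by
        rw [← whisker_exchange]; monoidal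
    _ = _ := by rw [h, splitRight]; monoidal

theorem splitLeft_comul_right : splitLeft H X ≫ (H ⊗ X) ◁ Δ[H] =
    splitLeft H X ≫ splitLeft H X ▷ H ≫ (α_ (H ⊗ X) H H).hom := by
  have h : Δ[H] ≫ H ◁ Δ[H] = Δ[H] ≫ Δ[H] ▷ H ≫ (α_ H H H).hom := ComonObj.comul_assoc H
  calc _ = 𝟙 _ ⊗≫ Δ[H] ▷ X ⊗≫ H ◁ ((β_ H X).hom ≫ X ◁ Δ[H]) ⊗≫ 𝟙 _ := by
        rw [splitLeft]; monoidal
    _ = 𝟙 _ ⊗≫ (Δ[H] ≫ H ◁ Δ[H]) ▷ X ⊗≫ H ◁ (β_ (H ⊗ H) X).hom ⊗≫ 𝟙 _ := by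
        rw [← BraidedCategory.braiding_naturality_left]; monoidal
    _ = 𝟙 _ ⊗≫ Δ[H] ▷ X ⊗≫ (Δ[H] ▷ (H ⊗ X) ≫ (H ⊗ H) ◁ (β_ H X).hom) ⊗≫
        (H ◁ (β_ H X).hom) ▷ H ⊗≫ 𝟙 _ := by
        rw [h, BraidedCategory.braiding_tensor_left_hom]; monoidal
    _ = _ := by rw [← whisker_exchange, splitLeft]; monoidal

theorem splitLeft_comul_left : splitLeft H X ≫ Δ[H] ▷ X ▷ H =
    𝟙 _ ⊗≫ Δ[H] ▷ X ⊗≫ H ◁ splitLeft H X ⊗≫ 𝟙 _ := by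
  have h : Δ[H] ≫ Δ[H] ▷ H = Δ[H] ≫ H ◁ Δ[H] ≫ (α_ H H H).inv := ComonObj.comul_assoc_flip H
  calc _ = 𝟙 _ ⊗≫ Δ[H] ▷ X ⊗≫ (H ◁ (β_ H X).hom ≫ Δ[H] ▷ (X ⊗ H)) ⊗≫ 𝟙 _ := by
        rw [splitLeft]; monoidal
    _ = 𝟙 _ ⊗≫ (Δ[H] ≫ Δ[H] ▷ H) ▷ X ⊗≫ (H ⊗ H) ◁ (β_ H X).hom ⊗≫ 𝟙 _ := by
        rw [whisker_exchange]; monoidal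
    _ = _ := by rw [h, splitLeft]; monoidal

/-- The braiding is natural along the action, at the price of a crossing of `h` with `k₁`, since
`k₁` now has to pass `H ⊗ X`. -/
theorem splitRight_act {p : H ⊗ X ⟶ X} : p ▷ K ≫ splitRight K X =
    𝟙 _ ⊗≫ H ◁ splitRight K X ⊗≫ (β_ H K).hom ▷ (X ⊗ K) ⊗≫ K ◁ p ▷ K := by
  have h := act_rightThrough (K := K) p
  rw [splitRight, h]
  monoidal

theorem splitLeft_act {q : X ⊗ K ⟶ X} : H ◁ q ≫ splitLeft H X =
    𝟙 _ ⊗≫ splitLeft H X ▷ K ⊗≫ (H ⊗ X) ◁ (β_ H K).hom ⊗≫ (H ◁ q) ▷ H := by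
  have h := act_leftThrough (H := H) q
  rw [splitLeft, h]
  monoidal

end Split

variable {H K X : D} [BimonObj H] [BimonObj K] {r : H ⊗ K ⟶ 𝟙_ D} {p : H ⊗ X ⟶ X} {q : X ⊗ K ⟶ X}

/-! ### Products in the left-hand algebra -/

section Left

theorem mul_leftHalf (e : μ[H] ▷ X ≫ p = (α_ H H X).hom ≫ H ◁ p ≫ p) :
    μ[H] ▷ X ≫ leftHalf p = 𝟙 _ ⊗≫ H ◁ leftHalf p ⊗≫ Δ[H] ▷ (H ⊗ X) ⊗≫
      H ◁ (β_ H H).hom ▷ X ⊗≫ (H ⊗ H) ◁ p ⊗≫ μ[H] ▷ X := by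
  have h : μ[H] ≫ Δ[H] = (Δ[H] ⊗ₘ Δ[H]) ≫ tensorμ H H H H ≫ (μ[H] ⊗ₘ μ[H]) :=
    BimonObj.mul_comul H
  calc _ = (μ[H] ≫ Δ[H]) ▷ X ≫ (α_ H H X).hom ≫ H ◁ p := by rw [leftHalf]; monoidal
    _ = 𝟙 _ ⊗≫ (H ◁ Δ[H] ≫ Δ[H] ▷ (H ⊗ H)) ▷ X ⊗≫ H ◁ (β_ H H).hom ▷ H ▷ X ⊗≫
        (μ[H] ▷ ((H ⊗ H) ⊗ X) ≫ H ◁ (μ[H] ▷ X ≫ p)) := by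
        rw [h, tensorμ, MonoidalCategory.tensorHom_def', MonoidalCategory.tensorHom_def]; monoidal
    _ = 𝟙 _ ⊗≫ H ◁ Δ[H] ▷ X ⊗≫ Δ[H] ▷ (H ⊗ H) ▷ X ⊗≫ ((H ◁ (β_ H H).hom) ▷ (H ⊗ X) ≫
        (H ⊗ H ⊗ H) ◁ p) ⊗≫ (H ⊗ H) ◁ p ⊗≫ μ[H] ▷ X := by
        rw [e, ← whisker_exchange]; monoidal
    _ = 𝟙 _ ⊗≫ H ◁ Δ[H] ▷ X ⊗≫ ((Δ[H] ▷ H) ▷ (H ⊗ X) ≫ ((H ⊗ H) ⊗ H) ◁ p) ⊗≫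
        H ◁ (β_ H H).hom ▷ X ⊗≫ (H ⊗ H) ◁ p ⊗≫ μ[H] ▷ X := by
        rw [← whisker_exchange]; monoidal
    _ = _ := by rw [← whisker_exchange, leftHalf]; monoidal

/-- In symbols, `hh'` sends `x ⊗ k` to `h₁ · ydLeft(h', x, k₁) ρ(h₂, k₂)`. The pairing with the
product is split by the first axiom of a Hopf pairing and the coproducts are regrouped by
coassociativity. It exposes the inner factor `h'`, to which the condition can be applied. -/
theorem mul_ydLeft (hr : IsHopfPairing r)
    (e : μ[H] ▷ X ≫ p = (α_ H H X).hom ≫ H ◁ p ≫ p) :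
    μ[H] ▷ (X ⊗ K) ≫ ydLeft r p q = 𝟙 _ ⊗≫ H ◁ H ◁ X ◁ Δ[K] ⊗≫ H ◁ ydLeft r p q ▷ K ⊗≫
      leftThrough p ▷ K ⊗≫ X ◁ r ⊗≫ 𝟙 _ := by
  have h : Δ[K] ≫ K ◁ Δ[K] = Δ[K] ≫ Δ[K] ▷ K ≫ (α_ K K K).hom := ComonObj.comul_assoc K
  have h1 : rightHalf q ≫ X ◁ Δ[K] = 𝟙 _ ⊗≫ X ◁ Δ[K] ⊗≫ rightHalf q ▷ K ⊗≫ 𝟙 _ := by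
    calc _ = 𝟙 _ ⊗≫ X ◁ Δ[K] ⊗≫ (q ▷ K ≫ X ◁ Δ[K]) := by rw [rightHalf]; monoidal
      _ = 𝟙 _ ⊗≫ X ◁ (Δ[K] ≫ K ◁ Δ[K]) ⊗≫ q ▷ (K ⊗ K) := by rw [← whisker_exchange]; monoidal
      _ = _ := by rw [h, rightHalf]; monoidal
  calc _ = (μ[H] ▷ (X ⊗ K) ≫ H ◁ rightHalf q) ≫ (α_ H X K).inv ≫ leftThrough p ▷ K ≫
        (α_ X H K).hom ≫ X ◁ r ≫ (ρ_ X).hom := by rw [ydLeft]; monoidal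
    _ = 𝟙 _ ⊗≫ H ◁ H ◁ rightHalf q ⊗≫ (μ[H] ▷ X ≫ leftThrough p) ▷ K ⊗≫ X ◁ r ⊗≫ 𝟙 _ := by
        rw [← whisker_exchange]; monoidal
    _ = 𝟙 _ ⊗≫ H ◁ H ◁ rightHalf q ⊗≫ H ◁ leftThrough p ▷ K ⊗≫ leftThrough p ▷ H ▷ K ⊗≫
        X ◁ (μ[H] ▷ K ≫ r) ⊗≫ 𝟙 _ := by
        rw [mul_leftThrough e]; monoidal
    _ = 𝟙 _ ⊗≫ H ◁ H ◁ rightHalf q ⊗≫ H ◁ leftThrough p ▷ K ⊗≫ (leftThrough p ▷ (H ⊗ K) ≫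
        (X ⊗ H) ◁ contract r) ⊗≫ X ◁ r ⊗≫ 𝟙 _ := by
        rw [hr.mul_left, comul_nested]; monoidal
    _ = 𝟙 _ ⊗≫ H ◁ H ◁ rightHalf q ⊗≫ H ◁ (leftThrough p ▷ K ≫ (X ⊗ H) ◁ Δ[K]) ⊗≫
        H ◁ X ◁ r ▷ K ⊗≫ leftThrough p ▷ K ⊗≫ X ◁ r ⊗≫ 𝟙 _ := by
        rw [← whisker_exchange, contract]; monoidal
    _ = 𝟙 _ ⊗≫ H ◁ H ◁ (rightHalf q ≫ X ◁ Δ[K]) ⊗≫ H ◁ leftThrough p ▷ (K ⊗ K) ⊗≫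
        H ◁ X ◁ r ▷ K ⊗≫ leftThrough p ▷ K ⊗≫ X ◁ r ⊗≫ 𝟙 _ := by
        rw [← whisker_exchange]; monoidal
    _ = _ := by rw [h1, ydLeft]; monoidal

/-- For a left action `p`, the morphism `h ⊗ x ⊗ k ↦ r(h₁, k₁) h₂ x ⊗ k₂`. -/
def pairLeft (r : H ⊗ K ⟶ 𝟙_ D) (p : H ⊗ X ⟶ X) : H ⊗ (X ⊗ K) ⟶ X ⊗ K :=
  (α_ H X K).inv ≫ leftHalf p ▷ K ≫ (α_ H X K).hom ≫ H ◁ splitRight K X ≫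
    (α_ H K (X ⊗ K)).inv ≫ r ▷ (X ⊗ K) ≫ (λ_ (X ⊗ K)).hom

/-- On this side `K` acts last. Splitting its action off leaves `pairLeft`, which is multiplicative
in `h`. -/
theorem ydRight_eq_pairLeft : ydRight r p q = pairLeft r p ≫ q := by
  calc _ = 𝟙 _ ⊗≫ leftHalf p ▷ K ⊗≫ H ◁ splitRight K X ⊗≫ ((H ⊗ K) ◁ q ≫ r ▷ X) ⊗≫ 𝟙 _ := by
        rw [ydRight, rightThrough_eq_split]; monoidal
    _ = _ := by rw [whisker_exchange, pairLeft]; monoidal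

/-- Coassociativity in `K`: the last leg of `k` may be split off before or after the pairing with
`h₁`. This puts the expansion of `mul_ydLeft` back into the form `ydLeft`. -/
theorem pairLeft_rightHalf : pairLeft r p ≫ rightHalf q =
    𝟙 _ ⊗≫ H ◁ X ◁ Δ[K] ⊗≫ ydRight r p q ▷ K ⊗≫ 𝟙 _ := by
  calc _ = 𝟙 _ ⊗≫ leftHalf p ▷ K ⊗≫ H ◁ splitRight K X ⊗≫ (r ▷ (X ⊗ K) ≫
        𝟙_ D ◁ (X ◁ Δ[K])) ⊗≫ q ▷ K := by rw [pairLeft, rightHalf]; monoidal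
    _ = 𝟙 _ ⊗≫ leftHalf p ▷ K ⊗≫ H ◁ (splitRight K X ≫ K ◁ X ◁ Δ[K]) ⊗≫ r ▷ (X ⊗ K ⊗ K) ⊗≫
        q ▷ K := by rw [← whisker_exchange]; monoidal
    _ = 𝟙 _ ⊗≫ (leftHalf p ▷ K ≫ (H ⊗ X) ◁ Δ[K]) ⊗≫ H ◁ splitRight K X ▷ K ⊗≫
        r ▷ (X ⊗ K ⊗ K) ⊗≫ q ▷ K := by rw [splitRight_comul_right]; monoidal
    _ = _ := by rw [← whisker_exchange, ydRight_eq_pairLeft, pairLeft]; monoidal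

/-- `pairLeft` obeys the associativity law of an action of `H` on `X ⊗ K`. The coproduct of a
product makes `h₂` cross `h'₁`, and letting `h₂` act before `K` is split makes it cross `k₁`; both
crossings cancel once `h'₁` and `k₁` are paired. -/
theorem mul_pairLeft (hr : IsHopfPairing r)
    (e : μ[H] ▷ X ≫ p = (α_ H H X).hom ≫ H ◁ p ≫ p) :
    μ[H] ▷ (X ⊗ K) ≫ pairLeft r p = (α_ H H (X ⊗ K)).hom ≫ H ◁ pairLeft r p ≫ pairLeft r p := by
  -- Crossing a pair that is sent to the unit object is trivial, by naturality of the braiding along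
  -- `r`.
  have hβ : (β_ H (H ⊗ K)).hom ≫ r ▷ H ≫ (λ_ H).hom = H ◁ r ≫ (ρ_ H).hom := by
    rw [← BraidedCategory.braiding_naturality_right_assoc, braiding_tensorUnit_right]
    simp
  have hβ' : (β_ H H).hom ▷ K ≫ (α_ H H K).hom ≫ H ◁ (β_ H K).hom ≫ (α_ H K H).inv ≫ r ▷ H ≫
      (λ_ H).hom = (α_ H H K).hom ≫ H ◁ r ≫ (ρ_ H).hom := by
    rw [← hβ, BraidedCategory.braiding_tensor_right_hom]; simp
  calc _ = 𝟙 _ ⊗≫ (μ[H] ▷ X ≫ leftHalf p) ▷ K ⊗≫ H ◁ splitRight K X ⊗≫ r ▷ (X ⊗ K) ⊗≫ 𝟙 _ := by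
        rw [pairLeft]; monoidal
    _ = 𝟙 _ ⊗≫ H ◁ leftHalf p ▷ K ⊗≫ Δ[H] ▷ (H ⊗ X) ▷ K ⊗≫ H ◁ (β_ H H).hom ▷ X ▷ K ⊗≫
        (H ⊗ H) ◁ p ▷ K ⊗≫ (μ[H] ▷ (X ⊗ K) ≫ H ◁ splitRight K X) ⊗≫ r ▷ (X ⊗ K) ⊗≫ 𝟙 _ := by
        rw [mul_leftHalf e]; monoidal
    _ = 𝟙 _ ⊗≫ H ◁ leftHalf p ▷ K ⊗≫ Δ[H] ▷ (H ⊗ X) ▷ K ⊗≫ H ◁ (β_ H H).hom ▷ X ▷ K ⊗≫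
        (H ⊗ H) ◁ (p ▷ K ≫ splitRight K X) ⊗≫ (μ[H] ▷ K ≫ r) ▷ (X ⊗ K) ⊗≫ 𝟙 _ := by
        rw [← whisker_exchange]; monoidal
    _ = 𝟙 _ ⊗≫ H ◁ leftHalf p ▷ K ⊗≫ Δ[H] ▷ (H ⊗ X) ▷ K ⊗≫ H ◁ (β_ H H).hom ▷ X ▷ K ⊗≫
        (H ⊗ H) ◁ (p ▷ K ≫ (splitRight K X ≫ Δ[K] ▷ (X ⊗ K))) ⊗≫ H ◁ r ▷ K ▷ (X ⊗ K) ⊗≫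
        r ▷ (X ⊗ K) ⊗≫ 𝟙 _ := by
        rw [hr.mul_left, nested]; monoidal
    _ = 𝟙 _ ⊗≫ H ◁ leftHalf p ▷ K ⊗≫ Δ[H] ▷ (H ⊗ X) ▷ K ⊗≫ H ◁ (β_ H H).hom ▷ X ▷ K ⊗≫
        (H ⊗ H) ◁ ((p ▷ K ≫ splitRight K X) ≫ K ◁ splitRight K X) ⊗≫ H ◁ r ▷ K ▷ (X ⊗ K) ⊗≫
        r ▷ (X ⊗ K) ⊗≫ 𝟙 _ := by
        rw [splitRight_comul_left]; monoidal
    _ = 𝟙 _ ⊗≫ H ◁ leftHalf p ▷ K ⊗≫ Δ[H] ▷ (H ⊗ X) ▷ K ⊗≫ H ◁ (β_ H H).hom ▷ X ▷ K ⊗≫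
        (H ⊗ H) ◁ H ◁ splitRight K X ⊗≫ (H ⊗ H) ◁ (β_ H K).hom ▷ (X ⊗ K) ⊗≫
        H ◁ ((H ⊗ K) ◁ (p ▷ K ≫ splitRight K X) ≫ r ▷ (K ⊗ X ⊗ K)) ⊗≫
        r ▷ (X ⊗ K) ⊗≫ 𝟙 _ := by
        nth_rewrite 1 [splitRight_act]; monoidal
    _ = 𝟙 _ ⊗≫ H ◁ leftHalf p ▷ K ⊗≫ Δ[H] ▷ (H ⊗ X) ▷ K ⊗≫ H ◁ ((β_ H H).hom ▷ (X ⊗ K) ≫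
        (H ⊗ H) ◁ splitRight K X) ⊗≫ (H ⊗ H) ◁ (β_ H K).hom ▷ (X ⊗ K) ⊗≫
        H ◁ r ▷ (H ⊗ X ⊗ K) ⊗≫ H ◁ (p ▷ K ≫ splitRight K X) ⊗≫
        r ▷ (X ⊗ K) ⊗≫ 𝟙 _ := by
        rw [whisker_exchange]; monoidal
    _ = 𝟙 _ ⊗≫ H ◁ leftHalf p ▷ K ⊗≫ Δ[H] ▷ (H ⊗ X) ▷ K ⊗≫ (H ⊗ H) ◁ H ◁ splitRight K X ⊗≫
        H ◁ ((β_ H H).hom ▷ K ≫ (α_ H H K).hom ≫ H ◁ (β_ H K).hom ≫ (α_ H K H).inv ≫ r ▷ H ≫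
          (λ_ H).hom) ▷ (X ⊗ K) ⊗≫ H ◁ (p ▷ K ≫ splitRight K X) ⊗≫
        r ▷ (X ⊗ K) ⊗≫ 𝟙 _ := by
        rw [← whisker_exchange]; monoidal
    _ = 𝟙 _ ⊗≫ H ◁ leftHalf p ▷ K ⊗≫ (Δ[H] ▷ (H ⊗ (X ⊗ K)) ≫ (H ⊗ H) ◁ (H ◁ splitRight K X ≫
        (α_ _ _ _).inv ≫ r ▷ (X ⊗ K) ≫ (λ_ _).hom)) ⊗≫ H ◁ (p ▷ K ≫ splitRight K X) ⊗≫ r ▷ (X ⊗ K) ⊗≫ 𝟙 _ := by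
        rw [hβ']; monoidal
    _ = _ := by rw [← whisker_exchange, pairLeft, leftHalf]; monoidal

/-- The left-hand factors for which the Yetter-Drinfeld condition holds are closed under
multiplication. -/
theorem yd_mul_left (hr : IsHopfPairing r) (e : μ[H] ▷ X ≫ p = (α_ H H X).hom ≫ H ◁ p ≫ p)
    {V W : D} {f : V ⟶ H} {g : W ⟶ H}
    (hf : f ▷ (X ⊗ K) ≫ ydLeft r p q = f ▷ (X ⊗ K) ≫ ydRight r p q)
    (hg : g ▷ (X ⊗ K) ≫ ydLeft r p q = g ▷ (X ⊗ K) ≫ ydRight r p q) :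
    ((f ⊗ₘ g) ≫ μ[H]) ▷ (X ⊗ K) ≫ ydLeft r p q =
      ((f ⊗ₘ g) ≫ μ[H]) ▷ (X ⊗ K) ≫ ydRight r p q := by
  calc _ = (f ⊗ₘ g) ▷ (X ⊗ K) ≫ (μ[H] ▷ (X ⊗ K) ≫ ydLeft r p q) := by simp
    _ = 𝟙 _ ⊗≫ f ▷ (W ⊗ (X ⊗ K)) ⊗≫ (H ◁ (g ▷ (X ⊗ K) ≫ H ◁ X ◁ Δ[K])) ⊗≫
        H ◁ ydLeft r p q ▷ K ⊗≫ leftThrough p ▷ K ⊗≫ X ◁ r ⊗≫ 𝟙 _ := by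
        rw [mul_ydLeft hr e, MonoidalCategory.tensorHom_def]; monoidal
    _ = 𝟙 _ ⊗≫ f ▷ (W ⊗ (X ⊗ K)) ⊗≫ (H ◁ W ◁ X ◁ Δ[K]) ⊗≫
        H ◁ (g ▷ (X ⊗ K) ≫ ydLeft r p q) ▷ K ⊗≫ leftThrough p ▷ K ⊗≫ X ◁ r ⊗≫ 𝟙 _ := by
        rw [← whisker_exchange]; monoidal
    -- The condition for the inner factor `g`, applied to `k₁`.
    _ = 𝟙 _ ⊗≫ f ▷ (W ⊗ (X ⊗ K)) ⊗≫ H ◁ (W ◁ X ◁ Δ[K] ≫ g ▷ (X ⊗ (K ⊗ K))) ⊗≫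
        H ◁ ydRight r p q ▷ K ⊗≫ leftThrough p ▷ K ⊗≫ X ◁ r ⊗≫ 𝟙 _ := by
        rw [hg]; monoidal
    _ = 𝟙 _ ⊗≫ f ▷ (W ⊗ (X ⊗ K)) ⊗≫ H ◁ g ▷ (X ⊗ K) ⊗≫ H ◁ (pairLeft r p ≫ rightHalf q) ⊗≫
        leftThrough p ▷ K ⊗≫ X ◁ r ⊗≫ 𝟙 _ := by
        rw [whisker_exchange, pairLeft_rightHalf]; monoidal
    _ = 𝟙 _ ⊗≫ (f ▷ (W ⊗ (X ⊗ K)) ≫ H ◁ (g ▷ (X ⊗ K) ≫ pairLeft r p)) ⊗≫ ydLeft r p q := by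
        rw [ydLeft]; monoidal
    _ = 𝟙 _ ⊗≫ V ◁ (g ▷ (X ⊗ K) ≫ pairLeft r p) ⊗≫ (f ▷ (X ⊗ K) ≫ ydLeft r p q) := by
        rw [← whisker_exchange]; monoidal
    -- The condition for the outer factor `f`, applied to the output of `pairLeft`; two copies of
    -- `pairLeft` then combine by `mul_pairLeft`.
    _ = 𝟙 _ ⊗≫ (V ◁ (g ▷ (X ⊗ K) ≫ pairLeft r p) ≫ f ▷ (X ⊗ K)) ⊗≫ ydRight r p q := by
        rw [hf]; monoidal
    _ = (f ⊗ₘ g) ▷ (X ⊗ K) ≫ ((α_ H H (X ⊗ K)).hom ≫ H ◁ pairLeft r p ≫ pairLeft r p) ≫ q := by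
        rw [whisker_exchange, ydRight_eq_pairLeft, MonoidalCategory.tensorHom_def]; monoidal
    _ = _ := by rw [← mul_pairLeft hr e, ydRight_eq_pairLeft]; simp

end Left

/-! ### Products in the right-hand algebra -/

section Right

theorem mul_rightHalf (e : X ◁ μ[K] ≫ q = (α_ X K K).inv ≫ q ▷ K ≫ q) :
    X ◁ μ[K] ≫ rightHalf q = 𝟙 _ ⊗≫ rightHalf q ▷ K ⊗≫ (X ⊗ K) ◁ Δ[K] ⊗≫
      X ◁ (β_ K K).hom ▷ K ⊗≫ q ▷ (K ⊗ K) ⊗≫ X ◁ μ[K] := by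
  have h : μ[K] ≫ Δ[K] = (Δ[K] ⊗ₘ Δ[K]) ≫ tensorμ K K K K ≫ (μ[K] ⊗ₘ μ[K]) :=
    BimonObj.mul_comul K
  calc _ = X ◁ (μ[K] ≫ Δ[K]) ≫ (α_ X K K).inv ≫ q ▷ K := by rw [rightHalf]; monoidal
    _ = 𝟙 _ ⊗≫ X ◁ (Δ[K] ▷ K ≫ (K ⊗ K) ◁ Δ[K]) ⊗≫ X ◁ K ◁ (β_ K K).hom ▷ K ⊗≫
        ((X ⊗ (K ⊗ K)) ◁ μ[K] ≫ (X ◁ μ[K] ≫ q) ▷ K) ⊗≫ 𝟙 _ := by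
        rw [h, tensorμ, MonoidalCategory.tensorHom_def, MonoidalCategory.tensorHom_def']; monoidal
    _ = 𝟙 _ ⊗≫ X ◁ Δ[K] ▷ K ⊗≫ X ◁ (K ⊗ K) ◁ Δ[K] ⊗≫ ((X ⊗ K) ◁ ((β_ K K).hom ▷ K) ≫
        q ▷ ((K ⊗ K) ⊗ K)) ⊗≫ q ▷ (K ⊗ K) ⊗≫ X ◁ μ[K] := by
        rw [whisker_exchange, e]; monoidal
    _ = 𝟙 _ ⊗≫ X ◁ Δ[K] ▷ K ⊗≫ ((X ⊗ K) ◁ (K ◁ Δ[K]) ≫ q ▷ (K ⊗ (K ⊗ K))) ⊗≫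
        X ◁ (β_ K K).hom ▷ K ⊗≫ q ▷ (K ⊗ K) ⊗≫ X ◁ μ[K] := by
        rw [whisker_exchange]; monoidal
    _ = _ := by rw [whisker_exchange, rightHalf]; monoidal

/-- The mirror image of `mul_ydLeft`: `h₂` meets `k` in an inner `ydRight`, and `h₁` is paired with
the first leg of `k'`. The argument `h` is split by `Δ`, which is why the induction over `K` needs a
subcoalgebra of `H`. -/
theorem mul_ydRight (hr : IsHopfPairing r)
    (e : X ◁ μ[K] ≫ q = (α_ X K K).inv ≫ q ▷ K ≫ q) :
    H ◁ X ◁ μ[K] ≫ ydRight r p q = 𝟙 _ ⊗≫ Δ[H] ▷ X ▷ K ▷ K ⊗≫ H ◁ ydRight r p q ▷ K ⊗≫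
      H ◁ rightThrough q ⊗≫ r ▷ X ⊗≫ 𝟙 _ := by
  have h : Δ[H] ≫ Δ[H] ▷ H = Δ[H] ≫ H ◁ Δ[H] ≫ (α_ H H H).inv := ComonObj.comul_assoc_flip H
  have h1 : leftHalf p ≫ Δ[H] ▷ X = 𝟙 _ ⊗≫ Δ[H] ▷ X ⊗≫ H ◁ leftHalf p ⊗≫ 𝟙 _ := by
    calc _ = 𝟙 _ ⊗≫ Δ[H] ▷ X ⊗≫ (H ◁ p ≫ Δ[H] ▷ X) := by rw [leftHalf]; monoidal
      _ = 𝟙 _ ⊗≫ (Δ[H] ≫ Δ[H] ▷ H) ▷ X ⊗≫ (H ⊗ H) ◁ p := by rw [whisker_exchange]; monoidal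
      _ = _ := by rw [h, leftHalf]; monoidal
  have h2 : H ◁ μ[K] ≫ r = Δ[H] ▷ (K ⊗ K) ≫ nested r := hr.mul_right
  calc _ = 𝟙 _ ⊗≫ ((H ⊗ X) ◁ μ[K] ≫ leftHalf p ▷ K) ⊗≫ H ◁ rightThrough q ⊗≫
        r ▷ X ⊗≫ 𝟙 _ := by rw [ydRight]; monoidal
    _ = 𝟙 _ ⊗≫ leftHalf p ▷ (K ⊗ K) ⊗≫ H ◁ (X ◁ μ[K] ≫ rightThrough q) ⊗≫ r ▷ X ⊗≫ 𝟙 _ := by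
        rw [whisker_exchange]; monoidal
    _ = 𝟙 _ ⊗≫ leftHalf p ▷ (K ⊗ K) ⊗≫ H ◁ rightThrough q ▷ K ⊗≫ H ◁ K ◁ rightThrough q ⊗≫
        (H ◁ μ[K] ≫ r) ▷ X ⊗≫ 𝟙 _ := by
        rw [mul_rightThrough e]; monoidal
    _ = 𝟙 _ ⊗≫ leftHalf p ▷ (K ⊗ K) ⊗≫ H ◁ rightThrough q ▷ K ⊗≫ ((H ⊗ K) ◁ rightThrough q ≫
        (Δ[H] ▷ K ≫ (α_ H H K).hom ≫ H ◁ r ≫ (ρ_ H).hom) ▷ (K ⊗ X)) ⊗≫ r ▷ X ⊗≫ 𝟙 _ := by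
        rw [h2, nested]; monoidal
    _ = 𝟙 _ ⊗≫ leftHalf p ▷ (K ⊗ K) ⊗≫ (H ◁ rightThrough q ≫ Δ[H] ▷ (K ⊗ X)) ▷ K ⊗≫
        H ◁ r ▷ X ▷ K ⊗≫ H ◁ rightThrough q ⊗≫ r ▷ X ⊗≫ 𝟙 _ := by
        rw [whisker_exchange]; monoidal
    _ = 𝟙 _ ⊗≫ (leftHalf p ≫ Δ[H] ▷ X) ▷ K ▷ K ⊗≫ H ◁ H ◁ rightThrough q ▷ K ⊗≫
        H ◁ r ▷ X ▷ K ⊗≫ H ◁ rightThrough q ⊗≫ r ▷ X ⊗≫ 𝟙 _ := by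
        rw [whisker_exchange]; monoidal
    _ = _ := by rw [h1, ydRight]; monoidal

/-- For a right action `q`, the morphism `h ⊗ x ⊗ k ↦ h₁ ⊗ x k₁ r(h₂, k₂)`. -/
def pairRight (r : H ⊗ K ⟶ 𝟙_ D) (q : X ⊗ K ⟶ X) : H ⊗ (X ⊗ K) ⟶ H ⊗ X :=
  H ◁ rightHalf q ≫ (α_ H X K).inv ≫ splitLeft H X ▷ K ≫ (α_ (H ⊗ X) H K).hom ≫
    (H ⊗ X) ◁ r ≫ (ρ_ (H ⊗ X)).hom

/-- On this side `H` acts last. Splitting its action off leaves `pairRight`, which is multiplicative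
in `k`. -/
theorem ydLeft_eq_pairRight : ydLeft r p q = pairRight r q ≫ p := by
  calc _ = 𝟙 _ ⊗≫ H ◁ rightHalf q ⊗≫ splitLeft H X ▷ K ⊗≫ (p ▷ (H ⊗ K) ≫ X ◁ r) ⊗≫ 𝟙 _ := by
        rw [ydLeft, leftThrough_eq_split]; monoidal
    _ = _ := by rw [← whisker_exchange, pairRight]; monoidal

theorem pairRight_leftHalf : pairRight r q ≫ leftHalf p =
    𝟙 _ ⊗≫ Δ[H] ▷ X ▷ K ⊗≫ H ◁ ydLeft r p q ⊗≫ 𝟙 _ := by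
  calc _ = 𝟙 _ ⊗≫ H ◁ rightHalf q ⊗≫ splitLeft H X ▷ K ⊗≫ ((H ⊗ X) ◁ r ≫
        Δ[H] ▷ X ▷ 𝟙_ D) ⊗≫ H ◁ p := by rw [pairRight, leftHalf]; monoidal
    _ = 𝟙 _ ⊗≫ H ◁ rightHalf q ⊗≫ (splitLeft H X ≫ Δ[H] ▷ X ▷ H) ▷ K ⊗≫
        ((H ⊗ H) ⊗ X) ◁ r ⊗≫ H ◁ p := by rw [whisker_exchange]; monoidal
    _ = 𝟙 _ ⊗≫ (H ◁ rightHalf q ≫ Δ[H] ▷ (X ⊗ K)) ⊗≫ H ◁ splitLeft H X ▷ K ⊗≫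
        ((H ⊗ H) ⊗ X) ◁ r ⊗≫ H ◁ p := by rw [splitLeft_comul_left]; monoidal
    _ = _ := by rw [whisker_exchange, ydLeft_eq_pairRight, pairRight]; monoidal

/-- The counterpart of `mul_pairLeft`: by the second axiom of a Hopf pairing, and because the extra
crossings cancel around `r(h₂, k₂)`, the operator for `kk'` is the one for `k` followed by the one
for `k'`. -/
theorem mul_pairRight (hr : IsHopfPairing r)
    (e : X ◁ μ[K] ≫ q = (α_ X K K).inv ≫ q ▷ K ≫ q) :
    H ◁ X ◁ μ[K] ≫ pairRight r q = H ◁ (α_ X K K).inv ≫ (α_ H (X ⊗ K) K).inv ≫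
      pairRight r q ▷ K ≫ (α_ H X K).hom ≫ pairRight r q := by
  have hβ : (β_ (H ⊗ K) K).hom ≫ K ◁ r ≫ (ρ_ K).hom = r ▷ K ≫ (λ_ K).hom := by
    rw [← BraidedCategory.braiding_naturality_left_assoc, braiding_tensorUnit_left]
    simp
  have hβ' : H ◁ (β_ K K).hom ≫ (α_ H K K).inv ≫ (β_ H K).hom ▷ K ≫ (α_ K H K).hom ≫ K ◁ r ≫
      (ρ_ K).hom = (α_ H K K).inv ≫ r ▷ K ≫ (λ_ K).hom := by
    rw [← hβ, BraidedCategory.braiding_tensor_left_hom]; simp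
  calc _ = 𝟙 _ ⊗≫ H ◁ (X ◁ μ[K] ≫ rightHalf q) ⊗≫ splitLeft H X ▷ K ⊗≫ (H ⊗ X) ◁ r ⊗≫ 𝟙 _ := by
        rw [pairRight]; monoidal
    _ = 𝟙 _ ⊗≫ H ◁ rightHalf q ▷ K ⊗≫ H ◁ (X ⊗ K) ◁ Δ[K] ⊗≫ H ◁ X ◁ (β_ K K).hom ▷ K ⊗≫
        H ◁ q ▷ (K ⊗ K) ⊗≫ ((H ⊗ X) ◁ μ[K] ≫ splitLeft H X ▷ K) ⊗≫ (H ⊗ X) ◁ r ⊗≫ 𝟙 _ := by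
        rw [mul_rightHalf e]; monoidal
    _ = 𝟙 _ ⊗≫ H ◁ rightHalf q ▷ K ⊗≫ H ◁ (X ⊗ K) ◁ Δ[K] ⊗≫ H ◁ X ◁ (β_ K K).hom ▷ K ⊗≫
        (H ◁ q ≫ splitLeft H X) ▷ (K ⊗ K) ⊗≫ (H ⊗ X) ◁ (H ◁ μ[K] ≫ r) ⊗≫ 𝟙 _ := by
        rw [whisker_exchange]; monoidal
    _ = 𝟙 _ ⊗≫ H ◁ rightHalf q ▷ K ⊗≫ H ◁ (X ⊗ K) ◁ Δ[K] ⊗≫ H ◁ X ◁ (β_ K K).hom ▷ K ⊗≫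
        (H ◁ q ≫ (splitLeft H X ≫ (H ⊗ X) ◁ Δ[H])) ▷ (K ⊗ K) ⊗≫ (H ⊗ X) ◁ H ◁ r ▷ K ⊗≫
        (H ⊗ X) ◁ r ⊗≫ 𝟙 _ := by
        rw [hr.mul_right, nested]; monoidal
    _ = 𝟙 _ ⊗≫ H ◁ rightHalf q ▷ K ⊗≫ H ◁ (X ⊗ K) ◁ Δ[K] ⊗≫ H ◁ X ◁ (β_ K K).hom ▷ K ⊗≫
        ((H ◁ q ≫ splitLeft H X) ≫ splitLeft H X ▷ H) ▷ (K ⊗ K) ⊗≫ (H ⊗ X) ◁ H ◁ r ▷ K ⊗≫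
        (H ⊗ X) ◁ r ⊗≫ 𝟙 _ := by
        rw [splitLeft_comul_right]; monoidal
    _ = 𝟙 _ ⊗≫ H ◁ rightHalf q ▷ K ⊗≫ H ◁ (X ⊗ K) ◁ Δ[K] ⊗≫ H ◁ X ◁ (β_ K K).hom ▷ K ⊗≫
        splitLeft H X ▷ K ▷ (K ⊗ K) ⊗≫ (H ⊗ X) ◁ (β_ H K).hom ▷ (K ⊗ K) ⊗≫
        ((H ◁ q ≫ splitLeft H X) ▷ (H ⊗ K) ≫ ((H ⊗ X) ⊗ H) ◁ r) ▷ K ⊗≫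
        (H ⊗ X) ◁ r ⊗≫ 𝟙 _ := by
        nth_rewrite 1 [splitLeft_act]; monoidal
    _ = 𝟙 _ ⊗≫ H ◁ rightHalf q ▷ K ⊗≫ H ◁ (X ⊗ K) ◁ Δ[K] ⊗≫ ((H ⊗ X) ◁ (β_ K K).hom ≫
        splitLeft H X ▷ (K ⊗ K)) ▷ K ⊗≫ (H ⊗ X) ◁ (β_ H K).hom ▷ (K ⊗ K) ⊗≫
        (H ⊗ (X ⊗ K)) ◁ r ▷ K ⊗≫ (H ◁ q ≫ splitLeft H X) ▷ K ⊗≫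
        (H ⊗ X) ◁ r ⊗≫ 𝟙 _ := by
        rw [← whisker_exchange]; monoidal
    _ = 𝟙 _ ⊗≫ H ◁ rightHalf q ▷ K ⊗≫ H ◁ (X ⊗ K) ◁ Δ[K] ⊗≫ splitLeft H X ▷ (K ⊗ K ⊗ K) ⊗≫
        (H ⊗ X) ◁ (H ◁ (β_ K K).hom ≫ (α_ H K K).inv ≫ (β_ H K).hom ▷ K ≫ (α_ K H K).hom ≫
          K ◁ r ≫ (ρ_ K).hom) ▷ K ⊗≫ (H ◁ q ≫ splitLeft H X) ▷ K ⊗≫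
        (H ⊗ X) ◁ r ⊗≫ 𝟙 _ := by
        rw [whisker_exchange]; monoidal
    _ = 𝟙 _ ⊗≫ H ◁ rightHalf q ▷ K ⊗≫ ((H ⊗ (X ⊗ K)) ◁ Δ[K] ≫ ((α_ H X K).inv ≫
        splitLeft H X ▷ K ≫ (α_ _ _ _).hom ≫ (H ⊗ X) ◁ r ≫ (ρ_ _).hom) ▷ (K ⊗ K)) ⊗≫
        (H ◁ q ≫ splitLeft H X) ▷ K ⊗≫ (H ⊗ X) ◁ r ⊗≫ 𝟙 _ := by
        rw [hβ']; monoidal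
    _ = _ := by rw [whisker_exchange, pairRight, rightHalf]; monoidal

/-- `pairRight` replaces `h` by its first leg `h₁`, so it does not leave a subcoalgebra. -/
theorem exists_pairRight {V : D} {f : V ⟶ H} {d : V ⟶ V ⊗ V} (hd : f ≫ Δ[H] = d ≫ (f ⊗ₘ f)) :
    ∃ w : V ⊗ (X ⊗ K) ⟶ V ⊗ X, f ▷ (X ⊗ K) ≫ pairRight r q = w ≫ f ▷ X := by
  -- The witness is `pairRight` with `d` in place of `Δ`, and with `f` applied only to the leg that
  -- is paired off.
  refine ⟨V ◁ rightHalf q ≫ (α_ V X K).inv ≫ (d ▷ X ≫ (α_ V V X).hom ≫ V ◁ (f ▷ X ≫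
    (β_ H X).hom) ≫ (α_ V X H).inv) ▷ K ≫ (α_ (V ⊗ X) H K).hom ≫ (V ⊗ X) ◁ r ≫
      (ρ_ (V ⊗ X)).hom, ?_⟩
  calc _ = 𝟙 _ ⊗≫ (f ▷ (X ⊗ K) ≫ H ◁ rightHalf q) ⊗≫ Δ[H] ▷ X ▷ K ⊗≫ H ◁ (β_ H X).hom ▷ K ⊗≫
        (H ⊗ X) ◁ r ⊗≫ 𝟙 _ := by rw [pairRight, splitLeft]; monoidal
    _ = 𝟙 _ ⊗≫ V ◁ rightHalf q ⊗≫ (f ≫ Δ[H]) ▷ X ▷ K ⊗≫ H ◁ (β_ H X).hom ▷ K ⊗≫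
        (H ⊗ X) ◁ r ⊗≫ 𝟙 _ := by rw [← whisker_exchange]; monoidal
    _ = 𝟙 _ ⊗≫ V ◁ rightHalf q ⊗≫ d ▷ X ▷ K ⊗≫ V ◁ f ▷ X ▷ K ⊗≫ (f ▷ ((H ⊗ X) ⊗ K) ≫
        H ◁ (β_ H X).hom ▷ K) ⊗≫ (H ⊗ X) ◁ r ⊗≫ 𝟙 _ := by
        rw [hd, MonoidalCategory.tensorHom_def']; monoidal
    _ = 𝟙 _ ⊗≫ V ◁ rightHalf q ⊗≫ d ▷ X ▷ K ⊗≫ V ◁ f ▷ X ▷ K ⊗≫ V ◁ (β_ H X).hom ▷ K ⊗≫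
        (f ▷ X ▷ (H ⊗ K) ≫ (H ⊗ X) ◁ r) ⊗≫ 𝟙 _ := by rw [← whisker_exchange]; monoidal
    _ = _ := by rw [← whisker_exchange]; monoidal

/-- The right-hand factors for which the Yetter-Drinfeld condition with a subcoalgebra holds are
closed under multiplication. -/
theorem yd_mul_right (hr : IsHopfPairing r) (e : X ◁ μ[K] ≫ q = (α_ X K K).inv ≫ q ▷ K ≫ q)
    {V W W' : D} {f : V ⟶ H} {d : V ⟶ V ⊗ V} (hd : f ≫ Δ[H] = d ≫ (f ⊗ₘ f))
    {g : W ⟶ K} {g' : W' ⟶ K}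
    (hg : f ▷ (X ⊗ W) ≫ H ◁ X ◁ g ≫ ydLeft r p q = f ▷ (X ⊗ W) ≫ H ◁ X ◁ g ≫ ydRight r p q)
    (hg' : f ▷ (X ⊗ W') ≫ H ◁ X ◁ g' ≫ ydLeft r p q =
      f ▷ (X ⊗ W') ≫ H ◁ X ◁ g' ≫ ydRight r p q) :
    f ▷ (X ⊗ (W ⊗ W')) ≫ H ◁ X ◁ ((g ⊗ₘ g') ≫ μ[K]) ≫ ydLeft r p q =
      f ▷ (X ⊗ (W ⊗ W')) ≫ H ◁ X ◁ ((g ⊗ₘ g') ≫ μ[K]) ≫ ydRight r p q := by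
  -- After splitting an element of the subcoalgebra, the second leg still comes from `V`; so the
  -- hypothesis `hg`, which is about `f` only, can be applied to that leg.
  have key : ∀ z : H ⊗ (X ⊗ K) ⟶ X, V ◁ X ◁ g ≫ (f ≫ Δ[H]) ▷ (X ⊗ K) ≫
      (α_ H H (X ⊗ K)).hom ≫ H ◁ z = (d ≫ f ▷ V) ▷ (X ⊗ W) ≫ (α_ H V (X ⊗ W)).hom ≫
        H ◁ (f ▷ (X ⊗ W) ≫ H ◁ X ◁ g ≫ z) := by
    intro z
    calc _ = 𝟙 _ ⊗≫ (V ◁ (X ◁ g) ≫ (d ≫ f ▷ V) ▷ (X ⊗ K)) ⊗≫ H ◁ f ▷ (X ⊗ K) ⊗≫ H ◁ z := by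
          rw [hd, MonoidalCategory.tensorHom_def]; monoidal
      _ = 𝟙 _ ⊗≫ (d ≫ f ▷ V) ▷ (X ⊗ W) ⊗≫ H ◁ (V ◁ (X ◁ g) ≫ f ▷ (X ⊗ K)) ⊗≫ H ◁ z := by
          rw [whisker_exchange]; monoidal
      _ = _ := by rw [whisker_exchange]; monoidal
  obtain ⟨w, hw⟩ := exists_pairRight (X := X) (r := r) (q := q) hd
  calc _ = f ▷ (X ⊗ (W ⊗ W')) ≫ H ◁ X ◁ (g ⊗ₘ g') ≫ (H ◁ X ◁ μ[K] ≫ pairRight r q) ≫ p := by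
        rw [ydLeft_eq_pairRight]; monoidal
    _ = 𝟙 _ ⊗≫ (f ▷ (X ⊗ (W ⊗ W')) ≫ H ◁ (X ◁ (g ⊗ₘ g'))) ⊗≫
        pairRight r q ▷ K ⊗≫ ydLeft r p q := by
        rw [mul_pairRight hr e, ydLeft_eq_pairRight]; monoidal
    _ = 𝟙 _ ⊗≫ V ◁ (X ◁ (g ⊗ₘ g')) ⊗≫ (f ▷ (X ⊗ K) ≫ pairRight r q) ▷ K ⊗≫ ydLeft r p q := by
        rw [← whisker_exchange]; monoidal
    _ = 𝟙 _ ⊗≫ V ◁ X ◁ g ▷ W' ⊗≫ ((V ⊗ (X ⊗ K)) ◁ g' ≫ w ▷ K) ⊗≫ f ▷ X ▷ K ⊗≫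
        ydLeft r p q := by
        rw [hw, MonoidalCategory.tensorHom_def]; monoidal
    _ = 𝟙 _ ⊗≫ V ◁ X ◁ g ▷ W' ⊗≫ w ▷ W' ⊗≫ (V ◁ (X ◁ g') ≫ f ▷ (X ⊗ K)) ⊗≫
        ydLeft r p q := by
        rw [whisker_exchange]; monoidal
    _ = 𝟙 _ ⊗≫ V ◁ X ◁ g ▷ W' ⊗≫ w ▷ W' ⊗≫ (f ▷ (X ⊗ W') ≫ H ◁ X ◁ g' ≫ ydLeft r p q) := by
        rw [whisker_exchange]; monoidal
    -- The condition for the second factor `g'`. It is available because `w` keeps the left argument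
    -- in `V`.
    _ = 𝟙 _ ⊗≫ V ◁ X ◁ g ▷ W' ⊗≫ w ▷ W' ⊗≫ (f ▷ (X ⊗ W') ≫ H ◁ (X ◁ g')) ⊗≫
        ydRight r p q := by
        rw [hg']; monoidal
    _ = 𝟙 _ ⊗≫ V ◁ X ◁ g ▷ W' ⊗≫ (w ▷ W' ≫ (V ⊗ X) ◁ g') ⊗≫ f ▷ X ▷ K ⊗≫
        ydRight r p q := by
        rw [← whisker_exchange]; monoidal
    _ = 𝟙 _ ⊗≫ V ◁ X ◁ g ▷ W' ⊗≫ V ◁ X ◁ K ◁ g' ⊗≫ (w ≫ f ▷ X) ▷ K ⊗≫ ydRight r p q := by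
        rw [← whisker_exchange]; monoidal
    _ = 𝟙 _ ⊗≫ V ◁ X ◁ g ▷ W' ⊗≫ V ◁ X ◁ K ◁ g' ⊗≫ f ▷ X ▷ K ▷ K ⊗≫
        (pairRight r q ≫ leftHalf p) ▷ K ⊗≫ H ◁ rightThrough q ⊗≫ r ▷ X ⊗≫ 𝟙 _ := by
        rw [← hw, ydRight]; monoidal
    _ = 𝟙 _ ⊗≫ V ◁ X ◁ (g ▷ W' ≫ K ◁ g') ⊗≫ (f ≫ Δ[H]) ▷ X ▷ K ▷ K ⊗≫
        H ◁ ydLeft r p q ▷ K ⊗≫ H ◁ rightThrough q ⊗≫ r ▷ X ⊗≫ 𝟙 _ := by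
        rw [pairRight_leftHalf]; monoidal
    _ = 𝟙 _ ⊗≫ V ◁ X ◁ W ◁ g' ⊗≫ (V ◁ X ◁ g ≫ (f ≫ Δ[H]) ▷ (X ⊗ K) ≫ (α_ H H (X ⊗ K)).hom ≫
        H ◁ ydLeft r p q) ▷ K ⊗≫ H ◁ rightThrough q ⊗≫ r ▷ X ⊗≫ 𝟙 _ := by
        rw [← whisker_exchange]; monoidal
    -- The condition for the first factor `g`, on the second leg of the coproduct. The result is the
    -- expansion in `mul_ydRight`.
    _ = 𝟙 _ ⊗≫ V ◁ X ◁ W ◁ g' ⊗≫ (V ◁ X ◁ g ≫ (f ≫ Δ[H]) ▷ (X ⊗ K) ≫ (α_ H H (X ⊗ K)).hom ≫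
        H ◁ ydRight r p q) ▷ K ⊗≫ H ◁ rightThrough q ⊗≫ r ▷ X ⊗≫ 𝟙 _ := by
        rw [key, hg, ← key]
    _ = 𝟙 _ ⊗≫ V ◁ X ◁ (g ▷ W' ≫ K ◁ g') ⊗≫ (f ≫ Δ[H]) ▷ X ▷ K ▷ K ⊗≫
        H ◁ ydRight r p q ▷ K ⊗≫ H ◁ rightThrough q ⊗≫ r ▷ X ⊗≫ 𝟙 _ := by
        rw [← whisker_exchange]; monoidal
    _ = (V ◁ (X ◁ (g ⊗ₘ g')) ≫ f ▷ (X ⊗ (K ⊗ K))) ≫ (H ◁ X ◁ μ[K] ≫ ydRight r p q) := by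
        rw [mul_ydRight hr e, MonoidalCategory.tensorHom_def]; monoidal
    _ = _ := by rw [whisker_exchange]; simp

end Right

/-! ### The Yetter-Drinfeld condition for the units -/

section Unit

/-- For `h = 1` the pairing becomes a counit on one leg of `k`, and both sides reduce to the right
action `q`. -/
theorem yd_one_left (hr : IsHopfPairing r) (e : η[H] ▷ X ≫ p = (λ_ X).hom) :
    η[H] ▷ (X ⊗ K) ≫ ydLeft r p q = η[H] ▷ (X ⊗ K) ≫ ydRight r p q := by
  have h : η[H] ≫ Δ[H] = (λ_ (𝟙_ D)).inv ≫ (η[H] ⊗ₘ η[H]) := BimonObj.one_comul H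
  trans (λ_ (X ⊗ K)).hom ≫ q
  · calc _ = 𝟙 _ ⊗≫ (η[H] ▷ (X ⊗ K) ≫ H ◁ rightHalf q) ⊗≫ leftThrough p ▷ K ⊗≫
          X ◁ r ⊗≫ 𝟙 _ := by rw [ydLeft]; monoidal
      _ = 𝟙 _ ⊗≫ rightHalf q ⊗≫ (η[H] ▷ X ≫ leftThrough p) ▷ K ⊗≫ X ◁ r ⊗≫ 𝟙 _ := by
          rw [← whisker_exchange]; monoidal
      _ = 𝟙 _ ⊗≫ rightHalf q ⊗≫ X ◁ (η[H] ▷ K ≫ r) ⊗≫ 𝟙 _ := by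
          rw [one_leftThrough e]; monoidal
      _ = 𝟙 _ ⊗≫ X ◁ Δ[K] ⊗≫ (q ▷ K ≫ X ◁ ε[K]) ⊗≫ 𝟙 _ := by
          rw [hr.one_left, rightHalf]; monoidal
      _ = 𝟙 _ ⊗≫ X ◁ (Δ[K] ≫ K ◁ ε[K]) ⊗≫ q := by rw [← whisker_exchange]; monoidal
      _ = _ := by rw [ComonObj.comul_counit]; monoidal
  · symm
    calc _ = 𝟙 _ ⊗≫ (η[H] ≫ Δ[H]) ▷ X ▷ K ⊗≫ H ◁ p ▷ K ⊗≫ H ◁ rightThrough q ⊗≫ r ▷ X ⊗≫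
          𝟙 _ := by rw [ydRight, leftHalf]; monoidal
      _ = 𝟙 _ ⊗≫ η[H] ▷ (𝟙_ D ⊗ X ⊗ K) ⊗≫ H ◁ (η[H] ▷ X ≫ p) ▷ K ⊗≫ H ◁ rightThrough q ⊗≫
          r ▷ X ⊗≫ 𝟙 _ := by rw [h, MonoidalCategory.tensorHom_def]; monoidal
      _ = 𝟙 _ ⊗≫ (η[H] ▷ (X ⊗ K) ≫ H ◁ rightThrough q) ⊗≫ r ▷ X ⊗≫ 𝟙 _ := by
          rw [e]; monoidal
      _ = 𝟙 _ ⊗≫ rightThrough q ⊗≫ (η[H] ▷ K ≫ r) ▷ X ⊗≫ 𝟙 _ := by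
          rw [← whisker_exchange]; monoidal
      _ = 𝟙 _ ⊗≫ X ◁ Δ[K] ⊗≫ (β_ X K).hom ▷ K ⊗≫ (K ◁ q ≫ ε[K] ▷ X) ⊗≫ 𝟙 _ := by
          rw [hr.one_left, rightThrough]; monoidal
      _ = 𝟙 _ ⊗≫ X ◁ Δ[K] ⊗≫ ((β_ X K).hom ≫ ε[K] ▷ X) ▷ K ⊗≫ q := by
          rw [whisker_exchange]; monoidal
      _ = 𝟙 _ ⊗≫ X ◁ (Δ[K] ≫ ε[K] ▷ K) ⊗≫ q := by
          rw [← BraidedCategory.braiding_naturality_right, braiding_tensorUnit_right]; monoidal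
      _ = _ := by rw [ComonObj.counit_comul]; monoidal

theorem yd_one_right (hr : IsHopfPairing r) (e : X ◁ η[K] ≫ q = (ρ_ X).hom) :
    H ◁ X ◁ η[K] ≫ ydLeft r p q = H ◁ X ◁ η[K] ≫ ydRight r p q := by
  have h : η[K] ≫ Δ[K] = (λ_ (𝟙_ D)).inv ≫ (η[K] ⊗ₘ η[K]) := BimonObj.one_comul K
  trans H ◁ (ρ_ X).hom ≫ p
  · calc _ = 𝟙 _ ⊗≫ H ◁ X ◁ (η[K] ≫ Δ[K]) ⊗≫ H ◁ q ▷ K ⊗≫ leftThrough p ▷ K ⊗≫ X ◁ r ⊗≫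
          𝟙 _ := by rw [ydLeft, rightHalf]; monoidal
      _ = 𝟙 _ ⊗≫ (H ⊗ X ⊗ 𝟙_ D) ◁ η[K] ⊗≫ H ◁ (X ◁ η[K] ≫ q) ▷ K ⊗≫ leftThrough p ▷ K ⊗≫
          X ◁ r ⊗≫ 𝟙 _ := by rw [h, MonoidalCategory.tensorHom_def']; monoidal
      _ = 𝟙 _ ⊗≫ ((H ⊗ X) ◁ η[K] ≫ leftThrough p ▷ K) ⊗≫ X ◁ r ⊗≫ 𝟙 _ := by
          rw [e]; monoidal
      _ = 𝟙 _ ⊗≫ leftThrough p ⊗≫ X ◁ (H ◁ η[K] ≫ r) ⊗≫ 𝟙 _ := by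
          rw [whisker_exchange]; monoidal
      _ = 𝟙 _ ⊗≫ Δ[H] ▷ X ⊗≫ H ◁ (β_ H X).hom ⊗≫ (p ▷ H ≫ X ◁ ε[H]) ⊗≫ 𝟙 _ := by
          rw [hr.one_right, leftThrough]; monoidal
      _ = 𝟙 _ ⊗≫ Δ[H] ▷ X ⊗≫ H ◁ ((β_ H X).hom ≫ X ◁ ε[H]) ⊗≫ p := by
          rw [← whisker_exchange]; monoidal
      _ = 𝟙 _ ⊗≫ (Δ[H] ≫ H ◁ ε[H]) ▷ X ⊗≫ p := by
          rw [← BraidedCategory.braiding_naturality_left, braiding_tensorUnit_left]; monoidal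
      _ = _ := by rw [ComonObj.comul_counit]; monoidal
  · symm
    calc _ = 𝟙 _ ⊗≫ ((H ⊗ X) ◁ η[K] ≫ leftHalf p ▷ K) ⊗≫ H ◁ rightThrough q ⊗≫
          r ▷ X ⊗≫ 𝟙 _ := by rw [ydRight]; monoidal
      _ = 𝟙 _ ⊗≫ leftHalf p ⊗≫ H ◁ (X ◁ η[K] ≫ rightThrough q) ⊗≫ r ▷ X ⊗≫ 𝟙 _ := by
          rw [whisker_exchange]; monoidal
      _ = 𝟙 _ ⊗≫ leftHalf p ⊗≫ (H ◁ η[K] ≫ r) ▷ X ⊗≫ 𝟙 _ := by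
          rw [one_rightThrough e]; monoidal
      _ = 𝟙 _ ⊗≫ Δ[H] ▷ X ⊗≫ (H ◁ p ≫ ε[H] ▷ X) ⊗≫ 𝟙 _ := by
          rw [hr.one_right, leftHalf]; monoidal
      _ = 𝟙 _ ⊗≫ (Δ[H] ≫ ε[H] ▷ H) ▷ X ⊗≫ p := by rw [whisker_exchange]; monoidal
      _ = _ := by rw [ComonObj.counit_comul]; monoidal

end Unit

/-! ### The Yetter-Drinfeld condition for primitive arguments -/

section Primitive

variable [Preadditive D] [MonoidalPreadditive D] {V W : D} {f : V ⟶ H} {g : W ⟶ K}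

theorem primitive_leftThrough (e : η[H] ▷ X ≫ p = (λ_ X).hom)
    (hf : f ≫ Δ[H] = (ρ_ V).inv ≫ (f ⊗ₘ η[H]) + (λ_ V).inv ≫ (η[H] ⊗ₘ f)) :
    f ▷ X ≫ leftThrough p = (f ▷ X ≫ p) ≫ (ρ_ X).inv ≫ X ◁ η[H] + (β_ V X).hom ≫ X ◁ f := by
  rw [leftThrough, ← comp_whiskerRight_assoc, hf, MonoidalPreadditive.add_whiskerRight,
    Preadditive.add_comp]
  congr 1
  · calc _ = 𝟙 _ ⊗≫ f ▷ (𝟙_ D ⊗ X) ⊗≫ H ◁ (η[H] ▷ X ≫ (β_ H X).hom) ⊗≫ p ▷ H := by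
          rw [MonoidalCategory.tensorHom_def]; monoidal
      _ = 𝟙 _ ⊗≫ f ▷ X ⊗≫ (H ◁ X ◁ η[H] ⊗≫ p ▷ H) := by
          rw [BraidedCategory.braiding_naturality_left, braiding_tensorUnit_left]; monoidal
      _ = 𝟙 _ ⊗≫ f ▷ X ⊗≫ ((H ⊗ X) ◁ η[H] ≫ p ▷ H) := by monoidal
      _ = _ := by rw [whisker_exchange]; monoidal
  · calc _ = 𝟙 _ ⊗≫ 𝟙_ D ◁ f ▷ X ⊗≫ (η[H] ▷ (H ⊗ X) ≫ H ◁ (β_ H X).hom) ⊗≫ p ▷ H := by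
          rw [MonoidalCategory.tensorHom_def']; monoidal
      _ = 𝟙 _ ⊗≫ (f ▷ X ≫ (β_ H X).hom) ⊗≫ (η[H] ▷ X ≫ p) ▷ H := by
          rw [← whisker_exchange]; monoidal
      _ = _ := by rw [e, BraidedCategory.braiding_naturality_left]; monoidal

theorem primitive_leftHalf (hf : f ≫ Δ[H] = (ρ_ V).inv ≫ (f ⊗ₘ η[H]) + (λ_ V).inv ≫ (η[H] ⊗ₘ f))
    (e : η[H] ▷ X ≫ p = (λ_ X).hom) :
    f ▷ X ≫ leftHalf p = f ▷ X + (f ▷ X ≫ p) ≫ (λ_ X).inv ≫ η[H] ▷ X := by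
  rw [leftHalf, ← comp_whiskerRight_assoc, hf, MonoidalPreadditive.add_whiskerRight,
    Preadditive.add_comp]
  congr 1
  · calc _ = 𝟙 _ ⊗≫ f ▷ (𝟙_ D ⊗ X) ⊗≫ H ◁ (η[H] ▷ X ≫ p) := by
          rw [MonoidalCategory.tensorHom_def]; monoidal
      _ = _ := by rw [e]; monoidal
  · calc _ = 𝟙 _ ⊗≫ 𝟙_ D ◁ f ▷ X ⊗≫ (η[H] ▷ (H ⊗ X) ≫ H ◁ p) := by
          rw [MonoidalCategory.tensorHom_def']; monoidal
      _ = _ := by rw [← whisker_exchange]; monoidal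

theorem primitive_rightThrough (e : X ◁ η[K] ≫ q = (ρ_ X).hom)
    (hg : g ≫ Δ[K] = (ρ_ W).inv ≫ (g ⊗ₘ η[K]) + (λ_ W).inv ≫ (η[K] ⊗ₘ g)) :
    X ◁ g ≫ rightThrough q = (β_ X W).hom ≫ g ▷ X + (X ◁ g ≫ q) ≫ (λ_ X).inv ≫ η[K] ▷ X := by
  rw [rightThrough, ← MonoidalCategory.whiskerLeft_comp_assoc, hg,
    MonoidalPreadditive.whiskerLeft_add, Preadditive.add_comp]
  congr 1
  · calc _ = 𝟙 _ ⊗≫ X ◁ g ▷ 𝟙_ D ⊗≫ ((X ⊗ K) ◁ η[K] ≫ (β_ X K).hom ▷ K) ⊗≫ K ◁ q := by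
          rw [MonoidalCategory.tensorHom_def]; monoidal
      _ = 𝟙 _ ⊗≫ (X ◁ g ≫ (β_ X K).hom) ⊗≫ K ◁ (X ◁ η[K] ≫ q) := by
          rw [whisker_exchange]; monoidal
      _ = _ := by rw [e, BraidedCategory.braiding_naturality_right]; monoidal
  · calc _ = 𝟙 _ ⊗≫ (X ⊗ 𝟙_ D) ◁ g ⊗≫ (X ◁ η[K] ≫ (β_ X K).hom) ▷ K ⊗≫ K ◁ q := by
          rw [MonoidalCategory.tensorHom_def']; monoidal
      _ = 𝟙 _ ⊗≫ X ◁ g ⊗≫ (η[K] ▷ (X ⊗ K) ≫ K ◁ q) := by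
          rw [BraidedCategory.braiding_naturality_right, braiding_tensorUnit_right]; monoidal
      _ = _ := by rw [← whisker_exchange]; monoidal

theorem primitive_rightHalf (e : X ◁ η[K] ≫ q = (ρ_ X).hom)
    (hg : g ≫ Δ[K] = (ρ_ W).inv ≫ (g ⊗ₘ η[K]) + (λ_ W).inv ≫ (η[K] ⊗ₘ g)) :
    X ◁ g ≫ rightHalf q = (X ◁ g ≫ q) ≫ (ρ_ X).inv ≫ X ◁ η[K] + X ◁ g := by
  rw [rightHalf, ← MonoidalCategory.whiskerLeft_comp_assoc, hg,
    MonoidalPreadditive.whiskerLeft_add, Preadditive.add_comp]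
  congr 1
  · calc _ = 𝟙 _ ⊗≫ X ◁ g ▷ 𝟙_ D ⊗≫ ((X ⊗ K) ◁ η[K] ≫ q ▷ K) := by
          rw [MonoidalCategory.tensorHom_def]; monoidal
      _ = _ := by rw [whisker_exchange]; monoidal
  · calc _ = 𝟙 _ ⊗≫ (X ⊗ 𝟙_ D) ◁ g ⊗≫ (X ◁ η[K] ≫ q) ▷ K := by
          rw [MonoidalCategory.tensorHom_def']; monoidal
      _ = _ := by rw [e]; monoidal

/-- Each coproduct has two terms, so there are four products. Two of them pair a unit with `f` or
`g` and vanish because the counit does. If both pairing legs are units, the two actions are composed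
(`h11`); if they are `f` and `g`, only `r(f, g)` and a crossing remain (`h22`). -/
theorem primitive_ydLeft (hr : IsHopfPairing r) (ep : η[H] ▷ X ≫ p = (λ_ X).hom)
    (eq : X ◁ η[K] ≫ q = (ρ_ X).hom)
    (hf : f ≫ Δ[H] = (ρ_ V).inv ≫ (f ⊗ₘ η[H]) + (λ_ V).inv ≫ (η[H] ⊗ₘ f)) (hf' : f ≫ ε[H] = 0)
    (hg : g ≫ Δ[K] = (ρ_ W).inv ≫ (g ⊗ₘ η[K]) + (λ_ W).inv ≫ (η[K] ⊗ₘ g)) (hg' : g ≫ ε[K] = 0) :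
    f ▷ (X ⊗ W) ≫ H ◁ X ◁ g ≫ ydLeft r p q = V ◁ (X ◁ g ≫ q) ≫ f ▷ X ≫ p +
      (α_ V X W).inv ≫ (β_ V X).hom ▷ W ≫ (α_ X V W).hom ≫ X ◁ ((f ⊗ₘ g) ≫ r) ≫ (ρ_ X).hom := by
  have h0 : f ▷ (X ⊗ W) ≫ H ◁ X ◁ g ≫ ydLeft r p q = V ◁ (X ◁ g ≫ rightHalf q) ≫
      (α_ V X K).inv ≫ (f ▷ X ≫ leftThrough p) ▷ K ≫ (α_ X H K).hom ≫ X ◁ r ≫ (ρ_ X).hom := by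
    calc _ = (f ▷ (X ⊗ W) ≫ H ◁ (X ◁ g ≫ rightHalf q)) ≫ (α_ H X K).inv ≫ leftThrough p ▷ K ≫
          (α_ X H K).hom ≫ X ◁ r ≫ (ρ_ X).hom := by rw [ydLeft]; monoidal
      _ = _ := by rw [← whisker_exchange]; monoidal
  obtain ⟨a, ha⟩ : ∃ a, a = f ▷ X ≫ p := ⟨_, rfl⟩
  obtain ⟨c, hc⟩ : ∃ c, c = X ◁ g ≫ q := ⟨_, rfl⟩
  have h11 : V ◁ (c ≫ (ρ_ X).inv ≫ X ◁ η[K]) ≫ (α_ V X K).inv ≫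
      (a ≫ (ρ_ X).inv ≫ X ◁ η[H]) ▷ K ≫ (α_ X H K).hom ≫ X ◁ r ≫ (ρ_ X).hom = V ◁ c ≫ a := by
    calc _ = 𝟙 _ ⊗≫ V ◁ c ⊗≫ ((V ⊗ X) ◁ η[K] ≫ (a ≫ (ρ_ X).inv ≫ X ◁ η[H]) ▷ K) ⊗≫
          X ◁ r ⊗≫ 𝟙 _ := by monoidal
      _ = 𝟙 _ ⊗≫ V ◁ c ⊗≫ a ⊗≫ X ◁ η[H] ⊗≫ X ◁ (H ◁ η[K] ≫ r) ⊗≫ 𝟙 _ := by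
          rw [whisker_exchange]; monoidal
      _ = 𝟙 _ ⊗≫ V ◁ c ⊗≫ a ⊗≫ X ◁ (η[H] ≫ ε[H]) ⊗≫ 𝟙 _ := by rw [hr.one_right]; monoidal
      _ = _ := by rw [BimonObj.one_counit]; monoidal
  have h12 : V ◁ (c ≫ (ρ_ X).inv ≫ X ◁ η[K]) ≫ (α_ V X K).inv ≫
      ((β_ V X).hom ≫ X ◁ f) ▷ K ≫ (α_ X H K).hom ≫ X ◁ r ≫ (ρ_ X).hom = 0 := by
    calc _ = 𝟙 _ ⊗≫ V ◁ c ⊗≫ ((V ⊗ X) ◁ η[K] ≫ ((β_ V X).hom ≫ X ◁ f) ▷ K) ⊗≫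
          X ◁ r ⊗≫ 𝟙 _ := by monoidal
      _ = 𝟙 _ ⊗≫ V ◁ c ⊗≫ (β_ V X).hom ⊗≫ X ◁ f ⊗≫ X ◁ (H ◁ η[K] ≫ r) ⊗≫ 𝟙 _ := by
          rw [whisker_exchange]; monoidal
      _ = 𝟙 _ ⊗≫ V ◁ c ⊗≫ (β_ V X).hom ⊗≫ X ◁ (f ≫ ε[H]) ⊗≫ 𝟙 _ := by
          rw [hr.one_right]; monoidal
      _ = _ := by rw [hf']; simp [monoidalComp]
  have h21 : V ◁ X ◁ g ≫ (α_ V X K).inv ≫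
      (a ≫ (ρ_ X).inv ≫ X ◁ η[H]) ▷ K ≫ (α_ X H K).hom ≫ X ◁ r ≫ (ρ_ X).hom = 0 := by
    calc _ = 𝟙 _ ⊗≫ ((V ⊗ X) ◁ g ≫ a ▷ K) ⊗≫ X ◁ (η[H] ▷ K ≫ r) ⊗≫ 𝟙 _ := by monoidal
      _ = 𝟙 _ ⊗≫ a ▷ W ⊗≫ X ◁ (g ≫ ε[K]) ⊗≫ 𝟙 _ := by
          rw [whisker_exchange, hr.one_left]; monoidal
      _ = _ := by rw [hg']; simp [monoidalComp]
  have h22 : V ◁ X ◁ g ≫ (α_ V X K).inv ≫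
      ((β_ V X).hom ≫ X ◁ f) ▷ K ≫ (α_ X H K).hom ≫ X ◁ r ≫ (ρ_ X).hom =
      (α_ V X W).inv ≫ (β_ V X).hom ▷ W ≫ (α_ X V W).hom ≫ X ◁ ((f ⊗ₘ g) ≫ r) ≫
        (ρ_ X).hom := by
    calc _ = 𝟙 _ ⊗≫ ((V ⊗ X) ◁ g ≫ (β_ V X).hom ▷ K) ⊗≫ X ◁ f ▷ K ⊗≫ X ◁ r ⊗≫ 𝟙 _ := by
          monoidal
      _ = _ := by rw [whisker_exchange, MonoidalCategory.tensorHom_def']; monoidal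
  rw [h0, primitive_rightHalf eq hg, primitive_leftThrough ep hf, ← ha, ← hc,
    MonoidalPreadditive.whiskerLeft_add, MonoidalPreadditive.add_whiskerRight,
    Preadditive.add_comp, Preadditive.add_comp, Preadditive.comp_add, Preadditive.comp_add,
    Preadditive.comp_add, h11, h12, h21, h22, add_zero, zero_add]

/-- The same four products, with the roles exchanged: here `h11` carries `r(f, g)` and `h22` the
composite of the actions. -/
theorem primitive_ydRight (hr : IsHopfPairing r) (ep : η[H] ▷ X ≫ p = (λ_ X).hom)
    (eq : X ◁ η[K] ≫ q = (ρ_ X).hom)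
    (hf : f ≫ Δ[H] = (ρ_ V).inv ≫ (f ⊗ₘ η[H]) + (λ_ V).inv ≫ (η[H] ⊗ₘ f)) (hf' : f ≫ ε[H] = 0)
    (hg : g ≫ Δ[K] = (ρ_ W).inv ≫ (g ⊗ₘ η[K]) + (λ_ W).inv ≫ (η[K] ⊗ₘ g)) (hg' : g ≫ ε[K] = 0) :
    f ▷ (X ⊗ W) ≫ H ◁ X ◁ g ≫ ydRight r p q = (α_ V X W).inv ≫ (f ▷ X ≫ p) ▷ W ≫ X ◁ g ≫ q +
      V ◁ (β_ X W).hom ≫ (α_ V W X).inv ≫ ((f ⊗ₘ g) ≫ r) ▷ X ≫ (λ_ X).hom := by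
  have h0 : f ▷ (X ⊗ W) ≫ H ◁ X ◁ g ≫ ydRight r p q = (α_ V X W).inv ≫
      (f ▷ X ≫ leftHalf p) ▷ W ≫ (α_ H X W).hom ≫ H ◁ (X ◁ g ≫ rightThrough q) ≫
      (α_ H K X).inv ≫ r ▷ X ≫ (λ_ X).hom := by
    calc _ = 𝟙 _ ⊗≫ f ▷ X ▷ W ⊗≫ ((H ⊗ X) ◁ g ≫ leftHalf p ▷ K) ⊗≫ H ◁ rightThrough q ⊗≫
          r ▷ X ⊗≫ 𝟙 _ := by rw [ydRight]; monoidal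
      _ = _ := by rw [whisker_exchange]; monoidal
  obtain ⟨a, ha⟩ : ∃ a, a = f ▷ X ≫ p := ⟨_, rfl⟩
  obtain ⟨c, hc⟩ : ∃ c, c = X ◁ g ≫ q := ⟨_, rfl⟩
  have h11 : (α_ V X W).inv ≫ (f ▷ X) ▷ W ≫ (α_ H X W).hom ≫ H ◁ ((β_ X W).hom ≫ g ▷ X) ≫
      (α_ H K X).inv ≫ r ▷ X ≫ (λ_ X).hom =
      V ◁ (β_ X W).hom ≫ (α_ V W X).inv ≫ ((f ⊗ₘ g) ≫ r) ▷ X ≫ (λ_ X).hom := by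
    calc _ = 𝟙 _ ⊗≫ (f ▷ (X ⊗ W) ≫ H ◁ (β_ X W).hom) ⊗≫ H ◁ g ▷ X ⊗≫ r ▷ X ⊗≫ 𝟙 _ := by
          monoidal
      _ = _ := by rw [← whisker_exchange, MonoidalCategory.tensorHom_def]; monoidal
  have h12 : (α_ V X W).inv ≫ (f ▷ X) ▷ W ≫ (α_ H X W).hom ≫
      H ◁ (c ≫ (λ_ X).inv ≫ η[K] ▷ X) ≫ (α_ H K X).inv ≫ r ▷ X ≫ (λ_ X).hom = 0 := by
    calc _ = 𝟙 _ ⊗≫ (f ▷ (X ⊗ W) ≫ H ◁ c) ⊗≫ (H ◁ η[K] ≫ r) ▷ X ⊗≫ 𝟙 _ := by monoidal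
      _ = 𝟙 _ ⊗≫ V ◁ c ⊗≫ (f ≫ ε[H]) ▷ X ⊗≫ 𝟙 _ := by
          rw [← whisker_exchange, hr.one_right]; monoidal
      _ = _ := by rw [hf']; simp [monoidalComp]
  have h21 : (α_ V X W).inv ≫ (a ≫ (λ_ X).inv ≫ η[H] ▷ X) ▷ W ≫ (α_ H X W).hom ≫
      H ◁ ((β_ X W).hom ≫ g ▷ X) ≫ (α_ H K X).inv ≫ r ▷ X ≫ (λ_ X).hom = 0 := by
    calc _ = 𝟙 _ ⊗≫ a ▷ W ⊗≫ (η[H] ▷ (X ⊗ W) ≫ H ◁ ((β_ X W).hom ≫ g ▷ X)) ⊗≫ r ▷ X ⊗≫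
          𝟙 _ := by monoidal
      _ = 𝟙 _ ⊗≫ a ▷ W ⊗≫ (β_ X W).hom ⊗≫ g ▷ X ⊗≫ (η[H] ▷ K ≫ r) ▷ X ⊗≫ 𝟙 _ := by
          rw [← whisker_exchange]; monoidal
      _ = 𝟙 _ ⊗≫ a ▷ W ⊗≫ (β_ X W).hom ⊗≫ (g ≫ ε[K]) ▷ X ⊗≫ 𝟙 _ := by
          rw [hr.one_left]; monoidal
      _ = _ := by rw [hg']; simp [monoidalComp]
  have h22 : (α_ V X W).inv ≫ (a ≫ (λ_ X).inv ≫ η[H] ▷ X) ▷ W ≫ (α_ H X W).hom ≫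
      H ◁ (c ≫ (λ_ X).inv ≫ η[K] ▷ X) ≫ (α_ H K X).inv ≫ r ▷ X ≫ (λ_ X).hom =
      (α_ V X W).inv ≫ a ▷ W ≫ c := by
    calc _ = 𝟙 _ ⊗≫ a ▷ W ⊗≫ (η[H] ▷ (X ⊗ W) ≫ H ◁ (c ≫ (λ_ X).inv ≫ η[K] ▷ X)) ⊗≫ r ▷ X ⊗≫
          𝟙 _ := by monoidal
      _ = 𝟙 _ ⊗≫ a ▷ W ⊗≫ c ⊗≫ η[K] ▷ X ⊗≫ (η[H] ▷ K ≫ r) ▷ X ⊗≫ 𝟙 _ := by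
          rw [← whisker_exchange]; monoidal
      _ = 𝟙 _ ⊗≫ a ▷ W ⊗≫ c ⊗≫ (η[K] ≫ ε[K]) ▷ X ⊗≫ 𝟙 _ := by
          rw [hr.one_left]; monoidal
      _ = _ := by rw [BimonObj.one_counit]; monoidal
  rw [h0, primitive_rightThrough eq hg, primitive_leftHalf hf ep, ← ha, ← hc,
    MonoidalPreadditive.whiskerLeft_add, MonoidalPreadditive.add_whiskerRight,
    Preadditive.add_comp, Preadditive.add_comp, Preadditive.comp_add, Preadditive.comp_add,
    Preadditive.comp_add, Preadditive.comp_add, Preadditive.comp_add, Preadditive.comp_add, h11,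
    h12, h21, h22, add_zero, zero_add, add_comm]

end Primitive

end Generation

/-! ### Modules over tensor algebras and reduction to generators -/

section TensorModules

open MonObj ComonObj

variable {D : Type u} [Category.{v} D] [MonoidalCategory D] [HasCountableCoproducts D]
  [∀ X : D, PreservesColimitsOfShape (Discrete ℕ) (tensorLeft X)]
  [∀ X : D, PreservesColimitsOfShape (Discrete ℕ) (tensorRight X)]

namespace T

variable (F : D) {X : D}

theorem inclSucc_eq_mul (n : ℕ) : inclSucc F n = (incl F n ⊗ₘ gen F) ≫ μ[T F] := by
  rw [MonoidalCategory.tensorHom_def, Category.assoc, ← shift_eq, incl_shift]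

theorem gen_extendLeft {Y Z : D} (s : F ⊗ Y ⟶ Y) (z : Y ⟶ Z) :
    gen F ▷ Y ≫ extendLeft F s z = s ≫ z := by
  calc _ = 𝟙 _ ⊗≫ unit F ▷ F ▷ Y ⊗≫ (shift F ▷ Y ≫ extendLeft F s z) := by
        rw [gen_eq]; monoidal
    _ = 𝟙 _ ⊗≫ (unit F ▷ (F ⊗ Y) ≫ T F ◁ s) ⊗≫ extendLeft F s z := by
        rw [shift_extendLeft]; monoidal
    _ = 𝟙 _ ⊗≫ s ⊗≫ (unit F ▷ Y ≫ extendLeft F s z) := by rw [← whisker_exchange]; monoidal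
    _ = _ := by rw [unit_extendLeft]; monoidal

theorem gen_extend {Y Z : D} (y : Y ⟶ Z) (z : Z ⊗ F ⟶ Z) :
    Y ◁ gen F ≫ extend F y z = y ▷ F ≫ z := by
  calc _ = 𝟙 _ ⊗≫ Y ◁ unit F ▷ F ⊗≫ (Y ◁ shift F ≫ extend F y z) := by
        rw [gen_eq]; monoidal
    _ = 𝟙 _ ⊗≫ (Y ◁ unit F ≫ extend F y z) ▷ F ⊗≫ z := by rw [shift_extend]; monoidal
    _ = _ := by rw [unit_extend]; monoidal

theorem unit_actLeft (s : F ⊗ X ⟶ X) : unit F ▷ X ≫ extendLeft F s (𝟙 X) = (λ_ X).hom := by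
  rw [unit_extendLeft, Category.comp_id]

/-- Induction on the right factor of the product, as its last generator acts on `X` first on both
sides. There is no condition on `s`, because the tensor algebra is free. -/
theorem mul_actLeft (s : F ⊗ X ⟶ X) : μ[T F] ▷ X ≫ extendLeft F s (𝟙 X) =
    (α_ (T F) (T F) X).hom ≫ T F ◁ extendLeft F s (𝟙 X) ≫ extendLeft F s (𝟙 X) := by
  rw [← Iso.inv_comp_eq]
  refine middle_free_ext F s ?_ ?_ ?_
  · calc _ = 𝟙 _ ⊗≫ (T F ◁ unit F ≫ mul F) ▷ X ⊗≫ extendLeft F s (𝟙 X) := by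
          rw [mul_eq]; monoidal
      _ = 𝟙 _ ⊗≫ extendLeft F s (𝟙 X) := by rw [mul_unit]; monoidal
      _ = 𝟙 _ ⊗≫ T F ◁ (unit F ▷ X ≫ extendLeft F s (𝟙 X)) ⊗≫ extendLeft F s (𝟙 X) := by
          rw [unit_actLeft]; monoidal
      _ = _ := by monoidal
  · calc _ = 𝟙 _ ⊗≫ (T F ◁ shift F ≫ mul F) ▷ X ⊗≫ extendLeft F s (𝟙 X) := by
          rw [mul_eq]; monoidal
      _ = 𝟙 _ ⊗≫ mul F ▷ F ▷ X ⊗≫ (shift F ▷ X ≫ extendLeft F s (𝟙 X)) := by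
          rw [mul_shift]; monoidal
      _ = 𝟙 _ ⊗≫ (mul F ▷ (F ⊗ X) ≫ T F ◁ s) ⊗≫ extendLeft F s (𝟙 X) := by
          rw [shift_extendLeft]; monoidal
      _ = _ := by rw [← whisker_exchange, mul_eq]; monoidal
  · rw [← MonoidalCategory.whiskerLeft_comp_assoc, shift_extendLeft]
    simp only [MonoidalCategory.whiskerLeft_comp, Category.assoc]

theorem unit_actRight (s : X ⊗ F ⟶ X) : X ◁ unit F ≫ extend F (𝟙 X) s = (ρ_ X).hom := by
  rw [unit_extend, Category.comp_id]

theorem mul_actRight (s : X ⊗ F ⟶ X) : X ◁ μ[T F] ≫ extend F (𝟙 X) s =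
    (α_ X (T F) (T F)).inv ≫ extend F (𝟙 X) s ▷ T F ≫ extend F (𝟙 X) s := by
  rw [Iso.eq_inv_comp]
  refine free_ext F s ?_ ?_ ?_
  · calc _ = 𝟙 _ ⊗≫ X ◁ (T F ◁ unit F ≫ mul F) ⊗≫ extend F (𝟙 X) s := by
          rw [mul_eq]; monoidal
      _ = 𝟙 _ ⊗≫ extend F (𝟙 X) s := by rw [mul_unit]; monoidal
      _ = 𝟙 _ ⊗≫ extend F (𝟙 X) s ⊗≫ (X ◁ unit F ≫ extend F (𝟙 X) s) := by
          rw [unit_actRight]; monoidal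
      _ = 𝟙 _ ⊗≫ (extend F (𝟙 X) s ▷ 𝟙_ D ≫ X ◁ unit F) ⊗≫ extend F (𝟙 X) s := by monoidal
      _ = _ := by rw [← whisker_exchange]; monoidal
  · calc _ = 𝟙 _ ⊗≫ X ◁ (T F ◁ shift F ≫ mul F) ⊗≫ extend F (𝟙 X) s := by
          rw [mul_eq]; monoidal
      _ = 𝟙 _ ⊗≫ X ◁ mul F ▷ F ⊗≫ (X ◁ shift F ≫ extend F (𝟙 X) s) := by
          rw [mul_shift]; monoidal
      _ = _ := by rw [shift_extend, mul_eq]; monoidal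
  · calc _ = ((X ⊗ T F) ◁ shift F ≫ extend F (𝟙 X) s ▷ T F) ≫ extend F (𝟙 X) s := by monoidal
      _ = 𝟙 _ ⊗≫ extend F (𝟙 X) s ▷ (T F ⊗ F) ⊗≫ (X ◁ shift F ≫ extend F (𝟙 X) s) := by
          rw [whisker_exchange]; monoidal
      _ = _ := by rw [shift_extend]; monoidal

/-- A left action of the tensor algebra is determined by the action of the generators. -/
theorem eq_actLeft {p : T F ⊗ X ⟶ X} (e : η[T F] ▷ X ≫ p = (λ_ X).hom)
    (e' : μ[T F] ▷ X ≫ p = (α_ (T F) (T F) X).hom ≫ T F ◁ p ≫ p) :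
    p = extendLeft F (gen F ▷ X ≫ p) (𝟙 X) := by
  refine left_free_ext F (gen F ▷ X ≫ p) ?_ ?_ (shift_extendLeft F _ _)
  · rw [unit_actLeft]; exact e
  · rw [shift_eq, comp_whiskerRight, Category.assoc, e']
    monoidal

/-- A right action of the tensor algebra is determined by the action of the generators. -/
theorem eq_actRight {q : X ⊗ T F ⟶ X} (e : X ◁ η[T F] ≫ q = (ρ_ X).hom)
    (e' : X ◁ μ[T F] ≫ q = (α_ X (T F) (T F)).inv ≫ q ▷ T F ≫ q) :
    q = extend F (𝟙 X) (X ◁ gen F ≫ q) := by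
  refine free_ext F (X ◁ gen F ≫ q) ?_ ?_ (shift_extend F _ _)
  · rw [unit_actRight]; exact e
  · rw [shift_eq, MonoidalCategory.whiskerLeft_comp, Category.assoc, e',
      ← whisker_exchange_assoc]
    monoidal

/-- Compatibility with the generators suffices, which is why morphisms are the same in the two
categories. -/
theorem actLeft_naturality {Y : D} {s : F ⊗ X ⟶ X} {t : F ⊗ Y ⟶ Y} {g : X ⟶ Y}
    (e : F ◁ g ≫ t = s ≫ g) :
    T F ◁ g ≫ extendLeft F t (𝟙 Y) = extendLeft F s (𝟙 X) ≫ g := by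
  refine left_free_ext F s ?_ ?_ ?_
  · rw [← whisker_exchange_assoc, unit_actLeft, reassoc_of% (unit_actLeft F s)]
    simp
  · rw [← whisker_exchange_assoc, shift_extendLeft]
    simp only [associator_naturality_right_assoc, ← MonoidalCategory.whiskerLeft_comp_assoc, e]
  · rw [reassoc_of% (shift_extendLeft F s)]

theorem actRight_naturality {Y : D} {s : X ⊗ F ⟶ X} {t : Y ⊗ F ⟶ Y} {g : X ⟶ Y}
    (e : g ▷ F ≫ t = s ≫ g) :
    g ▷ T F ≫ extend F (𝟙 Y) t = extend F (𝟙 X) s ≫ g := by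
  refine free_ext F t ?_ ?_ ?_
  · rw [whisker_exchange_assoc, unit_actRight, reassoc_of% (unit_actRight F s)]
    simp
  · rw [whisker_exchange_assoc, shift_extend]
    monoidal
  · rw [reassoc_of% (shift_extend F (𝟙 X) s), comp_whiskerRight, Category.assoc, e]

end T

variable [BraidedCategory D] [Preadditive D] [MonoidalPreadditive D] [HasBinaryBiproducts D]

variable {A B X : D} {r : T A ⊗ T B ⟶ 𝟙_ D} {p : T A ⊗ X ⟶ X} {q : X ⊗ T B ⟶ X}

/-- The Yetter-Drinfeld condition for actions of tensor algebras follows from its restriction to the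
generators. -/
theorem yd_of_gen (hr : IsHopfPairing r) (ep : η[T A] ▷ X ≫ p = (λ_ X).hom)
    (ep' : μ[T A] ▷ X ≫ p = (α_ (T A) (T A) X).hom ≫ T A ◁ p ≫ p)
    (eq : X ◁ η[T B] ≫ q = (ρ_ X).hom)
    (eq' : X ◁ μ[T B] ≫ q = (α_ X (T B) (T B)).inv ≫ q ▷ T B ≫ q)
    (h : T.gen A ▷ (X ⊗ B) ≫ T A ◁ X ◁ T.gen B ≫ ydLeft r p q =
      T.gen A ▷ (X ⊗ B) ≫ T A ◁ X ◁ T.gen B ≫ ydRight r p q) :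
    ydLeft r p q = ydRight r p q := by
  have h1 : T.unit A ▷ (X ⊗ T B) ≫ ydLeft r p q = T.unit A ▷ (X ⊗ T B) ≫ ydRight r p q :=
    yd_one_left hr ep
  -- The coproduct of a generator involves the unit, so `A` alone does not satisfy the hypothesis of
  -- `yd_mul_right`; `𝟙 ⊕ A` does.
  obtain ⟨f, hf⟩ : ∃ f : 𝟙_ D ⊞ A ⟶ T A, f = biprod.fst ≫ T.unit A + biprod.snd ≫ T.gen A :=
    ⟨_, rfl⟩
  have hinl : biprod.inl ≫ f = T.unit A := by rw [hf]; simp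
  have hinr : biprod.inr ≫ f = T.gen A := by rw [hf]; simp
  obtain ⟨d, hd⟩ : ∃ d : 𝟙_ D ⊞ A ⟶ (𝟙_ D ⊞ A) ⊗ (𝟙_ D ⊞ A), f ≫ Δ[T A] = d ≫ (f ⊗ₘ f) := by
    -- The coproduct on `𝟙 ⊕ A`: `1 ↦ 1 ⊗ 1` and `a ↦ a ⊗ 1 + 1 ⊗ a`.
    refine ⟨biprod.fst ≫ (λ_ _).inv ≫ (biprod.inl ⊗ₘ biprod.inl) +
      biprod.snd ≫ ((ρ_ A).inv ≫ (biprod.inr ⊗ₘ biprod.inl) +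
        (λ_ A).inv ≫ (biprod.inl ⊗ₘ biprod.inr)), ?_⟩
    have e1 : T.unit A ≫ Δ[T A] = (λ_ (𝟙_ D)).inv ≫ (T.unit A ⊗ₘ T.unit A) := T.unit_comul A
    have e2 : T.gen A ≫ Δ[T A] = (ρ_ A).inv ≫ (T.gen A ⊗ₘ T.unit A) +
      (λ_ A).inv ≫ (T.unit A ⊗ₘ T.gen A) := T.gen_comul A
    have e3 : f ≫ Δ[T A] = biprod.fst ≫ T.unit A ≫ Δ[T A] + biprod.snd ≫ T.gen A ≫ Δ[T A] := by
      rw [hf]; simp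
    rw [e3, e1, e2]
    simp only [Preadditive.add_comp, Preadditive.comp_add, Category.assoc,
      tensorHom_comp_tensorHom, hinl, hinr]
  have hgen : f ▷ (X ⊗ B) ≫ T A ◁ X ◁ T.gen B ≫ ydLeft r p q =
      f ▷ (X ⊗ B) ≫ T A ◁ X ◁ T.gen B ≫ ydRight r p q := by
    rw [hf]
    simp only [MonoidalPreadditive.add_whiskerRight, Preadditive.add_comp, comp_whiskerRight,
      Category.assoc, h]
    congr 2
    rw [← whisker_exchange_assoc, h1, whisker_exchange_assoc]
  -- Induction on the degree in `T(B)`, with the left argument kept in `𝟙 ⊕ A`.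
  have hincl : ∀ n, f ▷ (X ⊗ tensorPow B n) ≫ T A ◁ X ◁ T.incl B n ≫ ydLeft r p q =
      f ▷ (X ⊗ tensorPow B n) ≫ T A ◁ X ◁ T.incl B n ≫ ydRight r p q := by
    intro n
    induction n with
    | zero => exact congrArg (f ▷ (X ⊗ 𝟙_ D) ≫ ·) (yd_one_right hr eq)
    | succ n ih =>
      have e := yd_mul_right hr eq' hd ih hgen
      rw [← T.inclSucc_eq_mul] at e
      exact e
  have hleft : f ▷ (X ⊗ T B) ≫ ydLeft r p q = f ▷ (X ⊗ T B) ≫ ydRight r p q := by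
    rw [← cancel_epi (α_ (𝟙_ D ⊞ A) X (T B)).hom]
    apply T.left_ext
    intro n
    have e := hincl n
    simp only [← whisker_exchange_assoc] at e
    rw [associator_naturality_right_assoc, e, ← associator_naturality_right_assoc]
  have hgen' : T.gen A ▷ (X ⊗ T B) ≫ ydLeft r p q = T.gen A ▷ (X ⊗ T B) ≫ ydRight r p q := by
    rw [← hinr, comp_whiskerRight, Category.assoc, hleft, Category.assoc]
  -- Induction on the degree in `T(A)`, now that all of `T(B)` is available for a generator on the
  -- left.
  apply T.right_ext
  intro n
  induction n with
  | zero => exact h1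
  | succ n ih =>
    have e := yd_mul_left hr ep' ih hgen'
    rw [← T.inclSucc_eq_mul] at e
    exact e

/-- The Yetter-Drinfeld condition on generators, in terms of the actions of the generators. -/
theorem yd_gen_iff (hr : IsHopfPairing r) (ep : η[T A] ▷ X ≫ p = (λ_ X).hom)
    (eq : X ◁ η[T B] ≫ q = (ρ_ X).hom) {b : A ⊗ B ⟶ 𝟙_ D} (hb : (T.gen A ⊗ₘ T.gen B) ≫ r = b) :
    (T.gen A ▷ (X ⊗ B) ≫ T A ◁ X ◁ T.gen B ≫ ydLeft r p q =
      T.gen A ▷ (X ⊗ B) ≫ T A ◁ X ◁ T.gen B ≫ ydRight r p q) ↔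
    (α_ A B X).hom ≫ A ◁ ((β_ X B).inv ≫ X ◁ T.gen B ≫ q) ≫ T.gen A ▷ X ≫ p -
        (β_ A B).hom ▷ X ≫ (α_ B A X).hom ≫ B ◁ (T.gen A ▷ X ≫ p) ≫
          (β_ X B).inv ≫ X ◁ T.gen B ≫ q =
      b ▷ X ≫ (λ_ X).hom - ((α_ A B X).hom ≫ A ◁ (β_ X B).inv ≫ (α_ A X B).inv ≫
        (β_ A X).hom ▷ B ≫ (α_ X A B).hom) ≫ X ◁ b ≫ (ρ_ X).hom := by
  rw [primitive_ydLeft hr ep eq (T.gen_comul A) (T.gen_counit A) (T.gen_comul B) (T.gen_counit B),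
    primitive_ydRight hr ep eq (T.gen_comul A) (T.gen_counit A) (T.gen_comul B) (T.gen_counit B),
    hb]
  obtain ⟨a, ha⟩ : ∃ a, a = T.gen A ▷ X ≫ p := ⟨_, rfl⟩
  obtain ⟨c, hc⟩ : ∃ c, c = X ◁ T.gen B ≫ q := ⟨_, rfl⟩
  -- Naturality of the braiding along the action of `A`. It identifies the composite in which `A`
  -- acts first on the two sides of the equivalence.
  have h3 : (β_ A B).hom ▷ X ≫ (α_ B A X).hom ≫ B ◁ a ≫ (β_ X B).inv =
      (α_ A B X).hom ≫ A ◁ (β_ X B).inv ≫ (α_ A X B).inv ≫ a ▷ B := by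
    rw [← cancel_mono (β_ X B).hom]
    simp only [Category.assoc, Iso.inv_hom_id, Category.comp_id,
      BraidedCategory.braiding_naturality_left, BraidedCategory.braiding_tensor_left_hom]
    simp [← MonoidalCategory.whiskerLeft_comp_assoc]
  -- The isomorphism `A ⊗ B ⊗ X ≅ A ⊗ X ⊗ B` by the inverse braiding converts between `B` on the
  -- left and on the right of `X`. Removing the differences makes the two equations match term by
  -- term.
  rw [← ha, ← hc, ← cancel_epi ((α_ A B X).hom ≫ A ◁ (β_ X B).inv), sub_eq_sub_iff_add_eq_add,
    Preadditive.comp_add, Preadditive.comp_add]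
  have h4 : ((α_ A B X).hom ≫ A ◁ (β_ X B).inv) ≫ (α_ A X B).inv ≫ a ▷ B ≫ c =
      (β_ A B).hom ▷ X ≫ (α_ B A X).hom ≫ B ◁ a ≫ (β_ X B).inv ≫ c := by
    rw [reassoc_of% h3, Category.assoc]
  have h5 : ((α_ A B X).hom ≫ A ◁ (β_ X B).inv) ≫ A ◁ (β_ X B).hom ≫ (α_ A B X).inv ≫ b ▷ X ≫
      (λ_ X).hom = b ▷ X ≫ (λ_ X).hom := by
    simp [← MonoidalCategory.whiskerLeft_comp_assoc]
  rw [h4, h5, add_comm (b ▷ X ≫ _)]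
  simp only [MonoidalCategory.whiskerLeft_comp, Category.assoc]

end TensorModules

/-! ### Tensor products with a biproduct -/

section Biproducts

variable {D : Type u} [Category.{v} D] [MonoidalCategory D] [Preadditive D]
  [MonoidalPreadditive D] [HasBinaryBiproducts D] {A B X Y Z : D}

theorem inl_whiskerRight_desc (g : A ⊗ X ⟶ Z) (h : B ⊗ X ⟶ Z) :
    (biprod.inl : A ⟶ A ⊞ B) ▷ X ≫ (biprod.fst ▷ X ≫ g + biprod.snd ▷ X ≫ h) = g := by
  simp [← comp_whiskerRight_assoc]

theorem inr_whiskerRight_desc (g : A ⊗ X ⟶ Z) (h : B ⊗ X ⟶ Z) :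
    (biprod.inr : B ⟶ A ⊞ B) ▷ X ≫ (biprod.fst ▷ X ≫ g + biprod.snd ▷ X ≫ h) = h := by
  simp [← comp_whiskerRight_assoc]

theorem biprod_whiskerRight_ext {g h : (A ⊞ B) ⊗ X ⟶ Z}
    (hl : (biprod.inl : A ⟶ A ⊞ B) ▷ X ≫ g = (biprod.inl : A ⟶ A ⊞ B) ▷ X ≫ h)
    (hr : (biprod.inr : B ⟶ A ⊞ B) ▷ X ≫ g = (biprod.inr : B ⟶ A ⊞ B) ▷ X ≫ h) : g = h := by
  have e : 𝟙 ((A ⊞ B) ⊗ X) = biprod.fst ▷ X ≫ biprod.inl ▷ X +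
      biprod.snd ▷ X ≫ biprod.inr ▷ X := by
    rw [← comp_whiskerRight, ← comp_whiskerRight, ← MonoidalPreadditive.add_whiskerRight,
      biprod.total, id_whiskerRight]
  rw [← Category.id_comp g, ← Category.id_comp h, e]
  simp only [Preadditive.add_comp, Category.assoc, hl, hr]

end Biproducts

/-! ### Objects of `D_F` and their restrictions -/

section Restrictions

variable {D : Type u} [Category.{v} D] [MonoidalCategory D] [Preadditive D]
  [MonoidalPreadditive D] [HasBinaryBiproducts D] {A B : Center D}

theorem resLeft_naturality {M N : Pert (centreSum A B)} (g : M ⟶ N) :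
    A.1 ◁ g.f ≫ resLeft N = resLeft M ≫ g.f := by
  rw [resLeft, resLeft, whisker_exchange_assoc, Category.assoc, ← g.comm]

theorem resRight_naturality {M N : Pert (centreSum A B)} (g : M ⟶ N) :
    B.1 ◁ g.f ≫ resRight N = resRight M ≫ g.f := by
  rw [resRight, resRight, whisker_exchange_assoc, Category.assoc, ← g.comm]

/-- Two objects of `D_F` on the same object of `D` agree if the restrictions of their structure
morphisms do. -/
theorem Pert.ext_restrictions {X : D} {m m' : (centreSum A B).1 ⊗ X ⟶ X}
    (hl : resLeft (⟨X, m⟩ : Pert (centreSum A B)) = resLeft (⟨X, m'⟩ : Pert (centreSum A B)))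
    (hr : resRight (⟨X, m⟩ : Pert (centreSum A B)) = resRight (⟨X, m'⟩ : Pert (centreSum A B))) :
    (⟨X, m⟩ : Pert (centreSum A B)) = ⟨X, m'⟩ :=
  congrArg _ (biprod_whiskerRight_ext hl hr)

/-- The two functors are inverse to each other on the nose, and equality of functors is checked on
morphisms up to `eqToHom`; this brings such a comparison down to `D`. -/
theorem Pert.eqToHom_f {F : Center D} {M N : Pert F} (h : M = N) :
    Hom.f (eqToHom h) = eqToHom (congrArg X h) := by
  subst h
  rfl

end Restrictions

/-! ### The comparison functor, its inverse and their monoidal structures -/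

section Comparison

open MonObj ComonObj

variable {D : Type u} [Category.{v} D] [MonoidalCategory D] [BraidedCategory D]

theorem YD.eqToHom_f {H K : D} [BimonObj H] [BimonObj K] {r : H ⊗ K ⟶ 𝟙_ D} {M N : YD r}
    (h : M = N) : Hom.f (eqToHom h) = eqToHom (congrArg X h) := by
  subst h
  rfl

variable [HasCountableCoproducts D]
  [∀ X : D, PreservesColimitsOfShape (Discrete ℕ) (tensorLeft X)]
  [∀ X : D, PreservesColimitsOfShape (Discrete ℕ) (tensorRight X)]
  [Preadditive D] [MonoidalPreadditive D] [HasBinaryBiproducts D] {A B : D}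

theorem resLeft_toPert {r : T A ⊗ T B ⟶ 𝟙_ D} (M : YD r) :
    resLeft ((toPert r).obj M) = T.gen A ▷ M.X ≫ M.actl :=
  inl_whiskerRight_desc _ _

theorem resRight_toPert {r : T A ⊗ T B ⟶ 𝟙_ D} (M : YD r) :
    resRight ((toPert r).obj M) = (β_ M.X B).inv ≫ M.X ◁ T.gen B ≫ M.actr :=
  inr_whiskerRight_desc _ _

/-- Extending a left `B`-action, viewed as a right action, recovers it on generators. -/
theorem T.gen_extend_braiding {X : D} (s : B ⊗ X ⟶ X) :
    (β_ X B).inv ≫ X ◁ gen B ≫ extend B (𝟙 X) ((β_ X B).hom ≫ s) = s := by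
  rw [gen_extend, id_whiskerRight, Category.id_comp, Iso.inv_hom_id_assoc]

theorem braiding_comp_naturality {X Y : D} {s : B ⊗ X ⟶ X} {t : B ⊗ Y ⟶ Y} {g : X ⟶ Y}
    (e : B ◁ g ≫ t = s ≫ g) : g ▷ B ≫ (β_ Y B).hom ≫ t = ((β_ X B).hom ≫ s) ≫ g := by
  rw [BraidedCategory.braiding_naturality_left_assoc, e, Category.assoc]

/-- The commutation condition for the two lifts of a pair of objects of `D`. -/
theorem braidedCommutation_iff (b : A ⊗ B ⟶ 𝟙_ D)
    (M : Pert (centreSum (plusLift A) (minusLift B))) {s : A ⊗ M.X ⟶ M.X} {t : B ⊗ M.X ⟶ M.X}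
    (hs : resLeft M = s) (ht : resRight M = t) : braidedCommutation b M ↔
    (α_ A B M.X).hom ≫ A ◁ t ≫ s - (β_ A B).hom ▷ M.X ≫ (α_ B A M.X).hom ≫ B ◁ s ≫ t =
      b ▷ M.X ≫ (λ_ M.X).hom - ((α_ A B M.X).hom ≫ A ◁ (β_ M.X B).inv ≫ (α_ A M.X B).inv ≫
        (β_ A M.X).hom ▷ B ≫ (α_ M.X A B).hom) ≫ M.X ◁ b ≫ (ρ_ M.X).hom := by
  subst hs ht
  exact Iff.rfl

theorem braidedCommutation_toPert {r : T A ⊗ T B ⟶ 𝟙_ D} (hr : IsHopfPairing r)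
    {b : A ⊗ B ⟶ 𝟙_ D} (hb : (T.gen A ⊗ₘ T.gen B) ≫ r = b) (M : YD r) :
    braidedCommutation b ((toPert r).obj M) :=
  (braidedCommutation_iff b _ (resLeft_toPert M) (resRight_toPert M)).2
    ((yd_gen_iff hr M.one_actl M.one_actr hb).1 (by rw [M.condition]))

/-- The Yetter-Drinfeld module whose actions extend the two restrictions of the structure morphism
of an object satisfying the commutation condition. -/
noncomputable def ofCommutation {r : T A ⊗ T B ⟶ 𝟙_ D} (hr : IsHopfPairing r)
    {b : A ⊗ B ⟶ 𝟙_ D} (hb : (T.gen A ⊗ₘ T.gen B) ≫ r = b)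
    (M : (braidedCommutation b).FullSubcategory) : YD r where
  X := M.obj.X
  actl := T.extendLeft A (resLeft M.obj) (𝟙 _)
  actr := T.extend B (𝟙 _) ((β_ M.obj.X B).hom ≫ resRight M.obj)
  one_actl := T.unit_actLeft A _
  mul_actl := T.mul_actLeft A _
  one_actr := T.unit_actRight B _
  mul_actr := T.mul_actRight B _
  condition := by
    -- Only the generators have to be checked, and there the extended actions restrict to the given
    -- ones, so that the condition is the commutation condition of `M`.
    refine yd_of_gen hr (T.unit_actLeft A _) (T.mul_actLeft A _) (T.unit_actRight B _)
      (T.mul_actRight B _) ((yd_gen_iff hr (T.unit_actLeft A _) (T.unit_actRight B _) hb).2 ?_)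
    refine (braidedCommutation_iff b M.obj ?_ ?_).1 M.property
    · exact ((T.gen_extendLeft A _ _).trans (Category.comp_id _)).symm
    · exact (T.gen_extend_braiding _).symm

/-- The functor extending the action of the generators to the tensor algebras. -/
noncomputable def fromCommutation {r : T A ⊗ T B ⟶ 𝟙_ D} (hr : IsHopfPairing r)
    {b : A ⊗ B ⟶ 𝟙_ D} (hb : (T.gen A ⊗ₘ T.gen B) ≫ r = b) :
    (braidedCommutation b).FullSubcategory ⥤ YD r where
  obj M := ofCommutation hr hb M
  map {M N} g :=
    { f := g.hom.f
      left := T.actLeft_naturality A (resLeft_naturality g.hom)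
      right := T.actRight_naturality B (braiding_comp_naturality (resRight_naturality g.hom)) }

/-- An action of a tensor algebra is the extension of its restriction to the generators, so a module
is recovered as an equal object and not merely an isomorphic one. -/
theorem toCommutation_comp_fromCommutation {r : T A ⊗ T B ⟶ 𝟙_ D} (hr : IsHopfPairing r)
    {b : A ⊗ B ⟶ 𝟙_ D} (hb : (T.gen A ⊗ₘ T.gen B) ≫ r = b) :
    toCommutation r b (braidedCommutation_toPert hr hb) ⋙ fromCommutation hr hb = 𝟭 (YD r) := by
  have hobj (M : YD r) : ofCommutation hr hb ((toCommutation r b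
      (braidedCommutation_toPert hr hb)).obj M) = M := by
    have hl : T.extendLeft A (resLeft ((toPert r).obj M)) (𝟙 M.X) = M.actl := by
      rw [resLeft_toPert]
      exact (T.eq_actLeft A M.one_actl M.mul_actl).symm
    have hr' : T.extend B (𝟙 M.X) ((β_ M.X B).hom ≫ resRight ((toPert r).obj M)) = M.actr := by
      rw [resRight_toPert, Iso.hom_inv_id_assoc]
      exact (T.eq_actRight B M.one_actr M.mul_actr).symm
    -- The remaining fields are proofs, so equality of the modules amounts to `hl` and `hr'`.
    cases M
    dsimp only at hl hr'
    unfold ofCommutation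
    congr 1
  refine CategoryTheory.Functor.ext hobj fun M N g => YD.hom_ext ?_
  change g.f = YD.Hom.f (eqToHom (hobj M)) ≫ g.f ≫ YD.Hom.f (eqToHom (hobj N).symm)
  rw [YD.eqToHom_f, YD.eqToHom_f]
  -- The underlying objects of `D` agree definitionally, so both `eqToHom` are identities.
  exact ((Category.id_comp _).trans (Category.comp_id _)).symm

theorem fromCommutation_comp_toCommutation {r : T A ⊗ T B ⟶ 𝟙_ D} (hr : IsHopfPairing r)
    {b : A ⊗ B ⟶ 𝟙_ D} (hb : (T.gen A ⊗ₘ T.gen B) ≫ r = b) :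
    fromCommutation hr hb ⋙ toCommutation r b (braidedCommutation_toPert hr hb) = 𝟭 _ := by
  have hobj (M : (braidedCommutation b).FullSubcategory) :
      (toPert r).obj (ofCommutation hr hb M) = M.obj := by
    refine Pert.ext_restrictions (A := plusLift A) (B := minusLift B) ?_ ?_
    · refine (resLeft_toPert (ofCommutation hr hb M)).trans ?_
      exact (T.gen_extendLeft A _ _).trans (Category.comp_id _)
    · refine (resRight_toPert (ofCommutation hr hb M)).trans ?_
      exact T.gen_extend_braiding (resRight M.obj)
  have hobj' (M : (braidedCommutation b).FullSubcategory) :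
      (toCommutation r b (braidedCommutation_toPert hr hb)).obj (ofCommutation hr hb M) = M :=
    ObjectProperty.FullSubcategory.ext (hobj M)
  have hhom {M N : (braidedCommutation b).FullSubcategory} (h : M = N) :
      (eqToHom h).hom = eqToHom (congrArg ObjectProperty.FullSubcategory.obj h) := by
    subst h
    rfl
  refine CategoryTheory.Functor.ext hobj' fun M N g => ObjectProperty.hom_ext _ (Pert.hom_ext ?_)
  change g.hom.f = (eqToHom (hobj' M)).hom.f ≫ g.hom.f ≫ (eqToHom (hobj' N).symm).hom.f
  rw [hhom, hhom, Pert.eqToHom_f, Pert.eqToHom_f]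
  exact ((Category.id_comp _).trans (Category.comp_id _)).symm

/-- Since a generator is primitive and the unit acts trivially, it acts on `X` alone, or crosses `X`
by the braiding and acts on `Y`. This is the structure morphism of a tensor product in `D_F`, for
the half-braiding of `plusLift`. -/
theorem gen_leftTensor {X Y : D} {p : T A ⊗ X ⟶ X} {p' : T A ⊗ Y ⟶ Y}
    (e : η[T A] ▷ X ≫ p = (λ_ X).hom) (e' : η[T A] ▷ Y ≫ p' = (λ_ Y).hom) :
    T.gen A ▷ (X ⊗ Y) ≫ leftTensor p p' =
      (α_ A X Y).inv ≫ ((T.gen A ▷ X ≫ p) ▷ Y +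
        (β_ A X).hom ▷ Y ≫ (α_ X A Y).hom ≫ X ◁ (T.gen A ▷ Y ≫ p')) := by
  calc _ = (α_ A X Y).inv ≫ (T.gen A ▷ X ≫ leftThrough p) ▷ Y ≫ (α_ X (T A) Y).hom ≫ X ◁ p' := by
        rw [leftTensor]; monoidal
    _ = (α_ A X Y).inv ≫ ((T.gen A ▷ X ≫ p) ▷ Y ≫ ((ρ_ X).inv ▷ Y ⊗≫ X ◁ (η[T A] ▷ Y ≫ p')) +
        (β_ A X).hom ▷ Y ≫ (α_ X A Y).hom ≫ X ◁ (T.gen A ▷ Y ≫ p')) := by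
      rw [primitive_leftThrough e (T.gen_comul A), MonoidalPreadditive.add_whiskerRight,
        Preadditive.add_comp]
      congr 2 <;> monoidal
    _ = _ := by
      rw [e']
      congr 2
      monoidal

/-- A generator coming from the right acts on `Y`, or crosses `Y` and acts on `X`. Moving it to the
left by the inverse braiding of `X ⊗ Y` cancels the crossing with `Y` and leaves an inverse crossing
with `X` in the other term: the half-braiding of `minusLift`. -/
theorem gen_rightTensor {X Y : D} {q : X ⊗ T B ⟶ X} {q' : Y ⊗ T B ⟶ Y}
    (e : X ◁ η[T B] ≫ q = (ρ_ X).hom) (e' : Y ◁ η[T B] ≫ q' = (ρ_ Y).hom) :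
    (β_ (X ⊗ Y) B).inv ≫ (X ⊗ Y) ◁ T.gen B ≫ rightTensor q q' =
      (α_ B X Y).inv ≫ (((β_ X B).inv ≫ X ◁ T.gen B ≫ q) ▷ Y +
        (β_ X B).inv ▷ Y ≫ (α_ X B Y).hom ≫ X ◁ ((β_ Y B).inv ≫ Y ◁ T.gen B ≫ q')) := by
  rw [Iso.inv_comp_eq]
  calc _ = (α_ X Y B).hom ≫ X ◁ (Y ◁ T.gen B ≫ rightThrough q') ≫ (α_ X (T B) Y).inv ≫ q ▷ Y := by
        rw [rightTensor]; monoidal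
    _ = ((α_ X Y B).hom ≫ X ◁ (β_ Y B).hom ≫ (α_ X B Y).inv) ≫ (X ◁ T.gen B ≫ q) ▷ Y +
        (α_ X Y B).hom ≫ X ◁ (Y ◁ T.gen B ≫ q') ≫ (X ◁ (λ_ Y).inv ⊗≫ (X ◁ η[T B] ≫ q) ▷ Y) := by
      rw [primitive_rightThrough e' (T.gen_comul B), MonoidalPreadditive.whiskerLeft_add,
        Preadditive.add_comp, Preadditive.comp_add]
      congr 1 <;> monoidal
    _ = ((α_ X Y B).hom ≫ X ◁ (β_ Y B).hom ≫ (α_ X B Y).inv) ≫ (X ◁ T.gen B ≫ q) ▷ Y +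
        (α_ X Y B).hom ≫ X ◁ (Y ◁ T.gen B ≫ q') := by
      rw [e]
      congr 1
      monoidal
    _ = _ := by
      rw [BraidedCategory.braiding_tensor_left_hom]
      simp only [Preadditive.comp_add, Category.assoc, comp_whiskerRight,
        MonoidalCategory.whiskerLeft_comp, Iso.hom_inv_id_assoc, hom_inv_whiskerRight_assoc,
        Iso.inv_hom_id_assoc, whiskerLeft_hom_inv_assoc]

theorem resLeft_toPert_tensor {r : T A ⊗ T B ⟶ 𝟙_ D} (M N : YD r) :
    resLeft ((toPert r).obj M ⊗ (toPert r).obj N) = resLeft ((toPert r).obj (M ⊗ N)) := by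
  rw [resLeft_tensor, resLeft_toPert, resLeft_toPert]
  exact (gen_leftTensor M.one_actl N.one_actl).symm.trans (resLeft_toPert (M ⊗ N)).symm

theorem resRight_toPert_tensor {r : T A ⊗ T B ⟶ 𝟙_ D} (M N : YD r) :
    resRight ((toPert r).obj M ⊗ (toPert r).obj N) = resRight ((toPert r).obj (M ⊗ N)) := by
  rw [resRight_tensor, resRight_toPert, resRight_toPert]
  exact (gen_rightTensor M.one_actr N.one_actr).symm.trans (resRight_toPert (M ⊗ N)).symm

/-- An equality of objects, which together with `toPert_unit` allows identities of `D` as structure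
morphisms of the comparison functor. -/
theorem toPert_tensor {r : T A ⊗ T B ⟶ 𝟙_ D} (M N : YD r) :
    (toPert r).obj M ⊗ (toPert r).obj N = (toPert r).obj (M ⊗ N) :=
  Pert.ext_restrictions (A := plusLift A) (B := minusLift B) (resLeft_toPert_tensor M N)
    (resRight_toPert_tensor M N)

theorem toPert_unit (r : T A ⊗ T B ⟶ 𝟙_ D) :
    𝟙_ (Pert (centreSum (plusLift A) (minusLift B))) = (toPert r).obj (𝟙_ (YD r)) := by
  refine Pert.ext_restrictions (A := plusLift A) (B := minusLift B) ?_ ?_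
  · refine Eq.trans ?_ (resLeft_toPert (𝟙_ (YD r))).symm
    have h : T.gen A ▷ 𝟙_ D ≫ (ρ_ (T A)).hom ≫ T.counit A = 0 := by
      rw [rightUnitor_naturality_assoc, T.gen_counit, comp_zero]
    exact Eq.trans comp_zero h.symm
  · refine Eq.trans ?_ (resRight_toPert (𝟙_ (YD r))).symm
    have h : (β_ (𝟙_ D) B).inv ≫ 𝟙_ D ◁ T.gen B ≫ (λ_ (T B)).hom ≫ T.counit B = 0 := by
      rw [leftUnitor_naturality_assoc, T.gen_counit, comp_zero, comp_zero]
    exact Eq.trans comp_zero h.symm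

/-- Lets the identity of `X` serve as a morphism between equal objects, so that no `eqToHom` enters
the monoidal structure. -/
theorem Pert.comm_of_eq {F : Center D} {X : D} {m m' : F.1 ⊗ X ⟶ X}
    (h : (⟨X, m⟩ : Pert F) = ⟨X, m'⟩) : F.1 ◁ 𝟙 X ≫ m' = m ≫ 𝟙 X := by
  cases h
  simp

/-- The comparison functor is strict monoidal. -/
noncomputable def toCommutationCoreMonoidal (r : T A ⊗ T B ⟶ 𝟙_ D) (b : A ⊗ B ⟶ 𝟙_ D)
    (h : ∀ M : YD r, braidedCommutation b ((toPert r).obj M)) :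
    (toCommutation r b h).CoreMonoidal where
  εIso := (braidedCommutation b).isoMk (Pert.mkIso (Iso.refl (𝟙_ D))
    (Pert.comm_of_eq (toPert_unit r)))
  μIso M N := (braidedCommutation b).isoMk (Pert.mkIso (Iso.refl (M.X ⊗ N.X))
    (Pert.comm_of_eq (toPert_tensor M N)))
  μIso_hom_natural_left {M N} g L := by
    refine ObjectProperty.hom_ext _ (Pert.hom_ext ?_)
    -- Whiskering in `YD r` is by definition the tensor product with an identity, whence `⊗ₘ` on the
    -- right.
    change g.f ▷ L.X ≫ 𝟙 _ = 𝟙 _ ≫ (g.f ⊗ₘ 𝟙 L.X)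
    simp
  μIso_hom_natural_right {M N} L g := by
    refine ObjectProperty.hom_ext _ (Pert.hom_ext ?_)
    change L.X ◁ g.f ≫ 𝟙 _ = 𝟙 _ ≫ (𝟙 L.X ⊗ₘ g.f)
    simp
  associativity M N L := by
    refine ObjectProperty.hom_ext _ (Pert.hom_ext ?_)
    change 𝟙 (M.X ⊗ N.X) ▷ L.X ≫ 𝟙 _ ≫ (α_ M.X N.X L.X).hom =
      (α_ M.X N.X L.X).hom ≫ M.X ◁ 𝟙 (N.X ⊗ L.X) ≫ 𝟙 _
    simp
  left_unitality M := by
    refine ObjectProperty.hom_ext _ (Pert.hom_ext ?_)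
    change (λ_ M.X).hom = 𝟙 (𝟙_ D) ▷ M.X ≫ 𝟙 _ ≫ (λ_ M.X).hom
    simp
  right_unitality M := by
    refine ObjectProperty.hom_ext _ (Pert.hom_ext ?_)
    change (ρ_ M.X).hom = M.X ◁ 𝟙 (𝟙_ D) ≫ 𝟙 _ ≫ (ρ_ M.X).hom
    simp

/-- The comparison functor and its inverse, as an equivalence of categories. -/
noncomputable def commutationEquivalence {r : T A ⊗ T B ⟶ 𝟙_ D} (hr : IsHopfPairing r)
    {b : A ⊗ B ⟶ 𝟙_ D} (hb : (T.gen A ⊗ₘ T.gen B) ≫ r = b) :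
    YD r ≌ (braidedCommutation b).FullSubcategory :=
  CategoryTheory.Equivalence.mk (toCommutation r b (braidedCommutation_toPert hr hb))
    (fromCommutation hr hb) (eqToIso (toCommutation_comp_fromCommutation hr hb).symm)
    (eqToIso (fromCommutation_comp_toCommutation hr hb))

/-- The inverse of the comparison functor is monoidal. -/
@[reducible]
noncomputable def fromCommutationMonoidal {r : T A ⊗ T B ⟶ 𝟙_ D} (hr : IsHopfPairing r)
    {b : A ⊗ B ⟶ 𝟙_ D} (hb : (T.gen A ⊗ₘ T.gen B) ≫ r = b) :
    (fromCommutation hr hb).Monoidal :=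
  -- The functor of this equivalence is the comparison functor by definition, and the inverse of a
  -- monoidal equivalence inherits its monoidal structure through the adjunction.
  letI : (commutationEquivalence hr hb).functor.Monoidal :=
    (toCommutationCoreMonoidal r b (braidedCommutation_toPert hr hb)).toMonoidal
  (commutationEquivalence hr hb).inverseMonoidal

end Comparison

end TensorYD

/-! ### The theorem -/

theorem mainTheorem1 {D : Type u} [Category.{v} D] [Abelian D] [MonoidalCategory D]
    [BraidedCategory D] [MonoidalPreadditive D] [HasCountableCoproducts D]
    [∀ X : D, PreservesColimitsOfShape (Discrete ℕ) (tensorLeft X)]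
    [∀ X : D, PreservesColimitsOfShape (Discrete ℕ) (tensorRight X)]
    (Fp Fm : D) (b : Fp ⊗ Fm ⟶ 𝟙_ D) :
    ∃ r : T Fp ⊗ T Fm ⟶ 𝟙_ D,
      IsHopfPairing r ∧ DegreePreserving r ∧ (T.gen Fp ⊗ₘ T.gen Fm) ≫ r = b ∧
      (∀ r' : T Fp ⊗ T Fm ⟶ 𝟙_ D, IsHopfPairing r' →
        (T.gen Fp ⊗ₘ T.gen Fm) ≫ r' = b → r' = r) ∧
      ∃ (h : ∀ M : YD r, braidedCommutation b ((toPert r).obj M))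
        (Ψ : (braidedCommutation b).FullSubcategory ⥤ YD r)
        (_ : (toCommutation r b h).Monoidal) (_ : Ψ.Monoidal),
        toCommutation r b h ⋙ Ψ = 𝟭 (YD r) ∧
        Ψ ⋙ toCommutation r b h = 𝟭 (braidedCommutation b).FullSubcategory ∧
        (Functor.LaxMonoidal.ε (toCommutation r b h)).hom.f = 𝟙 (𝟙_ D) ∧
        ∀ M N : YD r,
          (Functor.LaxMonoidal.μ (toCommutation r b h) M N).hom.f = 𝟙 (M.X ⊗ N.X) :=
  ⟨pairing b, isHopfPairing_pairing b, degreePreserving_pairing b, gen_gen_pairing b,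
    fun _ h e => IsHopfPairing.eq_pairing b h e,
    braidedCommutation_toPert (isHopfPairing_pairing b) (gen_gen_pairing b),
    fromCommutation (isHopfPairing_pairing b) (gen_gen_pairing b),
    (toCommutationCoreMonoidal _ b _).toMonoidal,
    fromCommutationMonoidal (isHopfPairing_pairing b) (gen_gen_pairing b),
    toCommutation_comp_fromCommutation _ _, fromCommutation_comp_toCommutation _ _,
    -- The structure isomorphisms were built from `Iso.refl`, so their underlying morphisms are
    -- identities by definition.
    rfl, fun _ _ => rfl⟩
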